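/- **Syntax.** Formulas are two-sorted: number variables $x,y,z,\dots$ and string variables $X,Y,Z,\dots$ (finite sets of numbers). The base vocabulary is $\mathcal L^2_A=[0,1,+,\cdot,|\ |;\in,\le,=^1,=^2]$, where $|X|$ is a number term and $X(t)$ stands for $t\in X$; $s<t$ abbreviates $s\le t\wedge s\ne t$. A vocabulary $\mathcal L\supseteq\mathcal L^2_A$ may have further number- and string-valued function symbols. A structure has two nonempty domains, equality is true equality, and $\mathcal T\vdash\varphi$ means that the universal closure of $\varphi$ is a logical consequence of $\mathcal T$. Bounded quantifiers are $\forall x\le t,\ \exists x\le t,\ \forall x<t,\ \exists x<t$ and $\exists X\le t\,\varphi:\equiv\exists X(|X|\le t\wedge\varphi)$, $\forall X\le t\,\varphi:\equiv\forall X(|X|\le t\supset\varphi)$, where $t$ does not contain the bound variable; in the classes below $t$ is always an $\mathcal L^2_A$-term. A $\Sigma^B_0(\mathcal L)$ formula has no string quantifiers, and all its number quantifiers are bounded. The class $g\Sigma^B_1(\mathcal L)$ (resp. $g\Pi^B_1(\mathcal L)$) consists of the formulas obtained from $\Sigma^B_0(\mathcal L)$ formulas using $\wedge$, $\vee$, bounded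 number quantifiers and bounded existential (resp. universal) string quantifiers. **The rule.** A theory $\mathcal T$ over $\mathcal L$ *admits the $g\Delta^B_1(\mathcal L)$ comprehension rule* if for all $g\Sigma^B_1(\mathcal L)$ formulas $\varphi(z)$, all $g\Pi^B_1(\mathcal L)$ formulas $\psi(z)$ (both may have other free variables) and every number term $b$ not containing $z$ (for example a variable), $$\mathcal T\vdash\forall z<b\,(\varphi(z)\leftrightarrow\psi(z))\quad\text{implies}\quad \mathcal T\vdash\exists X\le b\,\forall z<b\,(X(z)\leftrightarrow\varphi(z)),$$ where $X$ does not occur in $b$ or $\varphi$. **$VTC^0$** is the theory over $\mathcal L^2_A$ with the axioms B1 $x+1\ne0$; B2 $x+1=y+1\supset x=y$; B3 $x+0=x$; B4 $x+(y+1)=(x+y)+1$; B5 $x\cdot0=0$; B6 $x\cdot(y+1)=(x\cdot y)+x$; B7 $(x\le y\wedge y\le x)\supset x=y$; B8 $0\le x$; B9 $(x\le y\wedge y\le z)\supset x\le z$; B10 $x\le y\vee y\le x$; B11 $x\le y\leftrightarrow x<y+1$; B12 $x\ne0\supset\exists y<x\,(y+1=x)$; L1 $X(y)\supset y<|X|$;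 L2 $y+1=|X|\supset X(y)$; SE $X=Y\leftrightarrow[\,|X|=|Y|\wedge\forall z<|X|\,(X(z)\leftrightarrow Y(z))]$; the comprehension scheme $\exists X\le a\,\forall z<a\,(X(z)\leftrightarrow\varphi(z))$ for every $\Sigma^B_0(\mathcal L^2_A)$ formula $\varphi$ not containing $X$; and the axiom $\forall X\exists Y\,\varphi_{NUMONES}(X,Y)$, where, with $Y(z,y):\equiv Y(\langle z,y\rangle)$ and $\langle x,y\rangle=(x+y)(x+y+1)+2y$, $\varphi_{NUMONES}(X,Y)$ is $$\forall z\le|X|\,\exists!y\le|X|\,Y(z,y)\ \wedge\ Y(0,0)\ \wedge\ \forall z<|X|\,\forall y\le|X|\,\bigl(Y(z,y)\supset[(X(z)\supset Y(z+1,y+1))\wedge(\neg X(z)\supset Y(z+1,y))]\bigr).$$ **$\overline{VTC}^0$.** The vocabulary $\mathcal L_{FTC^0}$ is the smallest one that includes $\mathcal L^2_A$, number functions $pd(x)$, $f_{SE}(X,Y)$, $numones(x,X)$ and, for each open formula $\alpha(z,\vec x,\vec X)$ over $\mathcal L_{FTC^0}$ and each $\mathcal L^2_A$-term $t(\vec x,\vec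 X)$, a string function $F_{\alpha,t}(\vec x,\vec X)$ and a number function $f_{\alpha,t}(\vec x,\vec X)$. The theory $\overline{VTC}^0$ over $\mathcal L_{FTC^0}$ has as axioms the universal closures of: B1–B11, L1, L2; $pd(0)=0$; $x\ne0\supset pd(x)+1=x$; $X=Y\supset[\,|X|=|Y|\wedge(z<|X|\supset(X(z)\leftrightarrow Y(z)))]$; $(|X|=|Y|\wedge f_{SE}(X,Y)=|X|)\supset X=Y$; the axioms $f_{SE}(X,Y)\le|X|$, $\ f_{SE}(X,Y)<|X|\supset\neg\bigl(X(f_{SE}(X,Y))\leftrightarrow Y(f_{SE}(X,Y))\bigr)$ and $z<f_{SE}(X,Y)\supset(X(z)\leftrightarrow Y(z))$; $numones(0,X)=0$; $X(z)\supset numones(z+1,X)=numones(z,X)+1$; $\neg X(z)\supset numones(z+1,X)=numones(z,X)$; and, for all $\alpha,t$ as above, $F_{\alpha,t}(\vec x,\vec X)(z)\leftrightarrow(z<t\wedge\alpha(z,\vec x,\vec X))$; $f_{\alpha,t}(\vec x,\vec X)\le t$; $f_{\alpha,t}(\vec x,\vec X)<t\supset\alpha(f_{\alpha,t}(\vec x,\vec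 X),\vec x,\vec X)$; $z<f_{\alpha,t}(\vec x,\vec X)\supset\neg\alpha(z,\vec x,\vec X)$. **Theorem.** $VTC^0$ admits the $g\Delta^B_1(\mathcal L^2_A)$ comprehension rule, and $\overline{VTC}^0$ admits the $g\Delta^B_1(\mathcal L_{FTC^0})$ comprehension rule. -/

import Mathlib

namespace TwoSorted

/-- The two sorts: numbers and strings (finite sets of numbers). -/
inductive Srt
  | num
  | str

/-- A two-sorted vocabulary extending `[0, 1, +, ·, | |; ∈, ≤, =¹, =²]`.  The symbols of the base
vocabulary are built into terms and formulas, so a vocabulary is given by its additional function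
symbols: `L s k l` is the type of symbols with `k` number arguments, `l` string arguments and
values of sort `s`. -/
abbrev Vocab := Srt → ℕ → ℕ → Type

/-- The base vocabulary: no additional function symbols. -/
abbrev L2A : Vocab := fun _ _ _ => Empty

/-- Number terms and string terms over `L` whose variables are among `n` number variables and
`m` string variables. -/
inductive Term (L : Vocab) : Srt → ℕ → ℕ → Type
  | nvar {n m : ℕ} (i : Fin n) : Term L .num n m
  | svar {n m : ℕ} (j : Fin m) : Term L .str n m
  | zero {n m : ℕ} : Term L .num n m
  | one {n m : ℕ} : Term L .num n m
  | add {n m : ℕ} (s t : Term L .num n m) : Term L .num n m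
  | mul {n m : ℕ} (s t : Term L .num n m) : Term L .num n m
  | len {n m : ℕ} (T : Term L .str n m) : Term L .num n m
  | app {n m k l : ℕ} {s : Srt} (f : L s k l) (ts : Fin k → Term L .num n m)
      (Ts : Fin l → Term L .str n m) : Term L s n m

/-- Formulas over `L` whose free variables are among `n` number variables and `m` string
variables.  `Formula L true n m` are all formulas, `Formula L false n m` the open (quantifier-free)
ones.  A quantifier binds the variable with index `0` of its sort in its scope. -/
inductive Formula (L : Vocab) : Bool → ℕ → ℕ → Type
  | top {q : Bool} {n m : ℕ} : Formula L q n m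
  | bot {q : Bool} {n m : ℕ} : Formula L q n m
  | eqN {q : Bool} {n m : ℕ} (s t : Term L .num n m) : Formula L q n m
  | eqS {q : Bool} {n m : ℕ} (S T : Term L .str n m) : Formula L q n m
  | le {q : Bool} {n m : ℕ} (s t : Term L .num n m) : Formula L q n m
  | mem {q : Bool} {n m : ℕ} (t : Term L .num n m) (T : Term L .str n m) : Formula L q n m
  | not {q : Bool} {n m : ℕ} (φ : Formula L q n m) : Formula L q n m
  | and {q : Bool} {n m : ℕ} (φ ψ : Formula L q n m) : Formula L q n m
  | or {q : Bool} {n m : ℕ} (φ ψ : Formula L q n m) : Formula L q n m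
  | allN {n m : ℕ} (φ : Formula L true (n + 1) m) : Formula L true n m
  | exN {n m : ℕ} (φ : Formula L true (n + 1) m) : Formula L true n m
  | allS {n m : ℕ} (φ : Formula L true n (m + 1)) : Formula L true n m
  | exS {n m : ℕ} (φ : Formula L true n (m + 1)) : Formula L true n m

/-! ### Substitution and abbreviations -/

namespace Term

/-- Simultaneous substitution of terms for variables. -/
def subst {L : Vocab} {n m n' m' : ℕ} (σ : Fin n → Term L .num n' m')
    (τ : Fin m → Term L .str n' m') : {s : Srt} → Term L s n m → Term L s n' m'
  | _, nvar i => σ i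
  | _, svar j => τ j
  | _, zero => zero
  | _, one => one
  | _, add s t => add (subst σ τ s) (subst σ τ t)
  | _, mul s t => mul (subst σ τ s) (subst σ τ t)
  | _, len T => len (subst σ τ T)
  | _, app f ts Ts => app f (fun i => subst σ τ (ts i)) (fun j => subst σ τ (Ts j))

/-- Weakening: the same term in the presence of a new number variable (with index `0`). -/
def wkN {L : Vocab} {s : Srt} {n m : ℕ} (t : Term L s n m) : Term L s (n + 1) m :=
  t.subst (fun i => nvar i.succ) svar

/-- Weakening: the same term in the presence of a new string variable (with index `0`). -/
def wkS {L : Vocab} {s : Srt} {n m : ℕ} (t : Term L s n m) : Term L s n (m + 1) :=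
  t.subst nvar (fun j => svar j.succ)

/-- A term of the base vocabulary is a term of every vocabulary. -/
def ofBase {L : Vocab} : {s : Srt} → {n m : ℕ} → Term L2A s n m → Term L s n m
  | _, _, _, nvar i => nvar i
  | _, _, _, svar j => svar j
  | _, _, _, zero => zero
  | _, _, _, one => one
  | _, _, _, add s t => add (ofBase s) (ofBase t)
  | _, _, _, mul s t => mul (ofBase s) (ofBase t)
  | _, _, _, len T => len (ofBase T)
  | _, _, _, app f _ _ => nomatch f

/-- The term `⟨x, y⟩ = (x + y)(x + y + 1) + 2y`. -/
def pair {L : Vocab} {n m : ℕ} (x y : Term L .num n m) : Term L .num n m :=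
  add (mul (add x y) (add (add x y) one)) (mul (add one one) y)

end Term

namespace Formula

open Term

/-- An open formula regarded as a formula. -/
def forget {L : Vocab} : {q : Bool} → {n m : ℕ} → Formula L q n m → Formula L true n m
  | _, _, _, top => top
  | _, _, _, bot => bot
  | _, _, _, eqN s t => eqN s t
  | _, _, _, eqS S T => eqS S T
  | _, _, _, le s t => le s t
  | _, _, _, mem t T => mem t T
  | _, _, _, not φ => not φ.forget
  | _, _, _, and φ ψ => and φ.forget ψ.forget
  | _, _, _, or φ ψ => or φ.forget ψ.forget
  | _, _, _, allN φ => allN φ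
  | _, _, _, exN φ => exN φ
  | _, _, _, allS φ => allS φ
  | _, _, _, exS φ => exS φ

/-- Simultaneous (capture-avoiding) substitution of terms for free variables. -/
def subst {L : Vocab} : {q : Bool} → {n m n' m' : ℕ} → (Fin n → Term L .num n' m') →
    (Fin m → Term L .str n' m') → Formula L q n m → Formula L q n' m'
  | _, _, _, _, _, _, _, top => top
  | _, _, _, _, _, _, _, bot => bot
  | _, _, _, _, _, σ, τ, eqN s t => eqN (s.subst σ τ) (t.subst σ τ)
  | _, _, _, _, _, σ, τ, eqS S T => eqS (S.subst σ τ) (T.subst σ τ)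
  | _, _, _, _, _, σ, τ, le s t => le (s.subst σ τ) (t.subst σ τ)
  | _, _, _, _, _, σ, τ, mem t T => mem (t.subst σ τ) (T.subst σ τ)
  | _, _, _, _, _, σ, τ, not φ => not (subst σ τ φ)
  | _, _, _, _, _, σ, τ, and φ ψ => and (subst σ τ φ) (subst σ τ ψ)
  | _, _, _, _, _, σ, τ, or φ ψ => or (subst σ τ φ) (subst σ τ ψ)
  | _, _, _, _, _, σ, τ, allN φ =>
      allN (subst (Fin.cons (nvar 0) fun i => (σ i).wkN) (fun j => (τ j).wkN) φ)
  | _, _, _, _, _, σ, τ, exN φ =>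
      exN (subst (Fin.cons (nvar 0) fun i => (σ i).wkN) (fun j => (τ j).wkN) φ)
  | _, _, _, _, _, σ, τ, allS φ =>
      allS (subst (fun i => (σ i).wkS) (Fin.cons (svar 0) fun j => (τ j).wkS) φ)
  | _, _, _, _, _, σ, τ, exS φ =>
      exS (subst (fun i => (σ i).wkS) (Fin.cons (svar 0) fun j => (τ j).wkS) φ)

/-- Weakening: the same formula in the presence of a new string variable (with index `0`), which
does not occur in it. -/
def wkS {L : Vocab} {q : Bool} {n m : ℕ} (φ : Formula L q n m) : Formula L q n (m + 1) :=
  φ.subst nvar (fun j => svar j.succ)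

/-- `φ ⊃ ψ` -/
def imp {L : Vocab} {q : Bool} {n m : ℕ} (φ ψ : Formula L q n m) : Formula L q n m :=
  or (not φ) ψ

/-- `φ ↔ ψ` -/
def iff {L : Vocab} {q : Bool} {n m : ℕ} (φ ψ : Formula L q n m) : Formula L q n m :=
  and (imp φ ψ) (imp ψ φ)

/-- `s < t`, that is `s ≤ t ∧ s ≠ t` -/
def lt {L : Vocab} {q : Bool} {n m : ℕ} (s t : Term L .num n m) : Formula L q n m :=
  and (le s t) (not (eqN s t))

/-- `∀ x ≤ t, φ` -/
def allLe {L : Vocab} {n m : ℕ} (t : Term L .num n m) (φ : Formula L true (n + 1) m) :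
    Formula L true n m :=
  allN (imp (le (nvar 0) t.wkN) φ)

/-- `∃ x ≤ t, φ` -/
def exLe {L : Vocab} {n m : ℕ} (t : Term L .num n m) (φ : Formula L true (n + 1) m) :
    Formula L true n m :=
  exN (and (le (nvar 0) t.wkN) φ)

/-- `∀ x < t, φ` -/
def allLt {L : Vocab} {n m : ℕ} (t : Term L .num n m) (φ : Formula L true (n + 1) m) :
    Formula L true n m :=
  allN (imp (lt (nvar 0) t.wkN) φ)

/-- `∃ x < t, φ` -/
def exLt {L : Vocab} {n m : ℕ} (t : Term L .num n m) (φ : Formula L true (n + 1) m) :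
    Formula L true n m :=
  exN (and (lt (nvar 0) t.wkN) φ)

/-- `∀ X ≤ t, φ`, that is `∀ X, |X| ≤ t ⊃ φ` -/
def allSLe {L : Vocab} {n m : ℕ} (t : Term L .num n m) (φ : Formula L true n (m + 1)) :
    Formula L true n m :=
  allS (imp (le (len (svar 0)) t.wkS) φ)

/-- `∃ X ≤ t, φ`, that is `∃ X, |X| ≤ t ∧ φ` -/
def exSLe {L : Vocab} {n m : ℕ} (t : Term L .num n m) (φ : Formula L true n (m + 1)) :
    Formula L true n m :=
  exS (and (le (len (svar 0)) t.wkS) φ)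

/-! ### Classes of formulas

Bounding terms are terms of the base vocabulary, for every vocabulary `L`. -/

/-- `Σ₀ᴮ(L)`: no string quantifiers, and all number quantifiers are bounded. -/
inductive IsSigma0B {L : Vocab} : {n m : ℕ} → Formula L true n m → Prop
  | ofOpen {n m : ℕ} (α : Formula L false n m) : IsSigma0B α.forget
  | not {n m : ℕ} {φ : Formula L true n m} : IsSigma0B φ → IsSigma0B (not φ)
  | and {n m : ℕ} {φ ψ : Formula L true n m} : IsSigma0B φ → IsSigma0B ψ → IsSigma0B (and φ ψ)
  | or {n m : ℕ} {φ ψ : Formula L true n m} : IsSigma0B φ → IsSigma0B ψ → IsSigma0B (or φ ψ)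
  | allLe {n m : ℕ} (t : Term L2A .num n m) {φ : Formula L true (n + 1) m} :
      IsSigma0B φ → IsSigma0B (allLe t.ofBase φ)
  | exLe {n m : ℕ} (t : Term L2A .num n m) {φ : Formula L true (n + 1) m} :
      IsSigma0B φ → IsSigma0B (exLe t.ofBase φ)
  | allLt {n m : ℕ} (t : Term L2A .num n m) {φ : Formula L true (n + 1) m} :
      IsSigma0B φ → IsSigma0B (allLt t.ofBase φ)
  | exLt {n m : ℕ} (t : Term L2A .num n m) {φ : Formula L true (n + 1) m} :
      IsSigma0B φ → IsSigma0B (exLt t.ofBase φ)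

/-- `gΣ₁ᴮ(L)`: built from `Σ₀ᴮ(L)` formulas by `∧`, `∨`, bounded number quantifiers and bounded
existential string quantifiers. -/
inductive IsGSigma1B {L : Vocab} : {n m : ℕ} → Formula L true n m → Prop
  | ofSigma0B {n m : ℕ} {φ : Formula L true n m} : IsSigma0B φ → IsGSigma1B φ
  | and {n m : ℕ} {φ ψ : Formula L true n m} : IsGSigma1B φ → IsGSigma1B ψ → IsGSigma1B (and φ ψ)
  | or {n m : ℕ} {φ ψ : Formula L true n m} : IsGSigma1B φ → IsGSigma1B ψ → IsGSigma1B (or φ ψ)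
  | allLe {n m : ℕ} (t : Term L2A .num n m) {φ : Formula L true (n + 1) m} :
      IsGSigma1B φ → IsGSigma1B (allLe t.ofBase φ)
  | exLe {n m : ℕ} (t : Term L2A .num n m) {φ : Formula L true (n + 1) m} :
      IsGSigma1B φ → IsGSigma1B (exLe t.ofBase φ)
  | allLt {n m : ℕ} (t : Term L2A .num n m) {φ : Formula L true (n + 1) m} :
      IsGSigma1B φ → IsGSigma1B (allLt t.ofBase φ)
  | exLt {n m : ℕ} (t : Term L2A .num n m) {φ : Formula L true (n + 1) m} :
      IsGSigma1B φ → IsGSigma1B (exLt t.ofBase φ)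
  | exSLe {n m : ℕ} (t : Term L2A .num n m) {φ : Formula L true n (m + 1)} :
      IsGSigma1B φ → IsGSigma1B (exSLe t.ofBase φ)

/-- `gΠ₁ᴮ(L)`: built from `Σ₀ᴮ(L)` formulas by `∧`, `∨`, bounded number quantifiers and bounded
universal string quantifiers. -/
inductive IsGPi1B {L : Vocab} : {n m : ℕ} → Formula L true n m → Prop
  | ofSigma0B {n m : ℕ} {φ : Formula L true n m} : IsSigma0B φ → IsGPi1B φ
  | and {n m : ℕ} {φ ψ : Formula L true n m} : IsGPi1B φ → IsGPi1B ψ → IsGPi1B (and φ ψ)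
  | or {n m : ℕ} {φ ψ : Formula L true n m} : IsGPi1B φ → IsGPi1B ψ → IsGPi1B (or φ ψ)
  | allLe {n m : ℕ} (t : Term L2A .num n m) {φ : Formula L true (n + 1) m} :
      IsGPi1B φ → IsGPi1B (allLe t.ofBase φ)
  | exLe {n m : ℕ} (t : Term L2A .num n m) {φ : Formula L true (n + 1) m} :
      IsGPi1B φ → IsGPi1B (exLe t.ofBase φ)
  | allLt {n m : ℕ} (t : Term L2A .num n m) {φ : Formula L true (n + 1) m} :
      IsGPi1B φ → IsGPi1B (allLt t.ofBase φ)
  | exLt {n m : ℕ} (t : Term L2A .num n m) {φ : Formula L true (n + 1) m} :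
      IsGPi1B φ → IsGPi1B (exLt t.ofBase φ)
  | allSLe {n m : ℕ} (t : Term L2A .num n m) {φ : Formula L true n (m + 1)} :
      IsGPi1B φ → IsGPi1B (allSLe t.ofBase φ)

end Formula

/-! ### Structures, theories, provability -/

/-- A structure for `L`: two nonempty domains, one for each sort, with an interpretation of every
symbol.  Both equality symbols are interpreted as true equality. -/
structure Struc (L : Vocab) where
  Dom : Srt → Type
  nonemptyStr : Nonempty (Dom .str)
  zero : Dom .num
  one : Dom .num
  add : Dom .num → Dom .num → Dom .num
  mul : Dom .num → Dom .num → Dom .num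
  len : Dom .str → Dom .num
  le : Dom .num → Dom .num → Prop
  mem : Dom .num → Dom .str → Prop
  fn : {s : Srt} → {k l : ℕ} → L s k l → (Fin k → Dom .num) → (Fin l → Dom .str) → Dom s

/-- The value of a term under an assignment. -/
def Term.eval {L : Vocab} (M : Struc L) {n m : ℕ} (x : Fin n → M.Dom .num)
    (X : Fin m → M.Dom .str) : {s : Srt} → Term L s n m → M.Dom s
  | _, nvar i => x i
  | _, svar j => X j
  | _, zero => M.zero
  | _, one => M.one
  | _, add s t => M.add (eval M x X s) (eval M x X t)
  | _, mul s t => M.mul (eval M x X s) (eval M x X t)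
  | _, len T => M.len (eval M x X T)
  | _, app f ts Ts => M.fn f (fun i => eval M x X (ts i)) (fun j => eval M x X (Ts j))

/-- Truth of a formula under an assignment. -/
def Formula.Holds {L : Vocab} (M : Struc L) : {q : Bool} → {n m : ℕ} → (Fin n → M.Dom .num) →
    (Fin m → M.Dom .str) → Formula L q n m → Prop
  | _, _, _, _, _, top => True
  | _, _, _, _, _, bot => False
  | _, _, _, x, X, eqN s t => s.eval M x X = t.eval M x X
  | _, _, _, x, X, eqS S T => S.eval M x X = T.eval M x X
  | _, _, _, x, X, le s t => M.le (s.eval M x X) (t.eval M x X)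
  | _, _, _, x, X, mem t T => M.mem (t.eval M x X) (T.eval M x X)
  | _, _, _, x, X, not φ => ¬ Holds M x X φ
  | _, _, _, x, X, and φ ψ => Holds M x X φ ∧ Holds M x X ψ
  | _, _, _, x, X, or φ ψ => Holds M x X φ ∨ Holds M x X ψ
  | _, _, _, x, X, allN φ => ∀ a : M.Dom .num, Holds M (Fin.cons a x) X φ
  | _, _, _, x, X, exN φ => ∃ a : M.Dom .num, Holds M (Fin.cons a x) X φ
  | _, _, _, x, X, allS φ => ∀ A : M.Dom .str, Holds M x (Fin.cons A X) φ
  | _, _, _, x, X, exS φ => ∃ A : M.Dom .str, Holds M x (Fin.cons A X) φ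

/-- The universal closure of `φ` is true in `M`. -/
def Struc.Models {L : Vocab} (M : Struc L) {n m : ℕ} (φ : Formula L true n m) : Prop :=
  ∀ (x : Fin n → M.Dom .num) (X : Fin m → M.Dom .str), φ.Holds M x X

/-- A theory over `L`, given by the set of its axioms.  An axiom with free variables stands for its
universal closure. -/
abbrev Theory (L : Vocab) := (n m : ℕ) → Formula L true n m → Prop

/-- `T ⊢ φ`: (the universal closure of) `φ` is a logical consequence of `T`. -/
def Theory.Proves {L : Vocab} (T : Theory L) {n m : ℕ} (φ : Formula L true n m) : Prop :=
  ∀ M : Struc L, (∀ (n' m' : ℕ) (ψ : Formula L true n' m'), T n' m' ψ → M.Models ψ) → M.Models φ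

/-- `T` admits the `gΔ₁ᴮ(L)` comprehension rule: whenever `T ⊢ ∀ z < b, φ(z) ↔ ψ(z)`, where `φ` is
`gΣ₁ᴮ(L)` and `ψ` is `gΠ₁ᴮ(L)`, then `T ⊢ ∃ X ≤ b, ∀ z < b, X(z) ↔ φ(z)`.  Here `z` is the number
variable `0` of `φ` and `ψ`; all their other free variables are parameters, which may occur in
`b`. -/
def Theory.AdmitsGDelta1BComprehension {L : Vocab} (T : Theory L) : Prop :=
  ∀ (n m : ℕ) (b : Term L .num n m) (φ ψ : Formula L true (n + 1) m),
    φ.IsGSigma1B → ψ.IsGPi1B →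
    T.Proves (.allLt b (.iff φ ψ)) →
    T.Proves (.exSLe b (.allLt b.wkS (.iff (.mem (.nvar 0) (.svar 0)) φ.wkS)))

/-! ### The axioms -/

open Term Formula

/-- The axioms B1 - B11, L1, L2. -/
inductive Basic (L : Vocab) : (n m : ℕ) → Formula L true n m → Prop
  /-- `x + 1 ≠ 0` -/
  | B1 : Basic L 1 0 (.not (.eqN (.add (.nvar 0) .one) .zero))
  /-- `x + 1 = y + 1 ⊃ x = y` -/
  | B2 : Basic L 2 0
      (.imp (.eqN (.add (.nvar 0) .one) (.add (.nvar 1) .one)) (.eqN (.nvar 0) (.nvar 1)))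
  /-- `x + 0 = x` -/
  | B3 : Basic L 1 0 (.eqN (.add (.nvar 0) .zero) (.nvar 0))
  /-- `x + (y + 1) = (x + y) + 1` -/
  | B4 : Basic L 2 0
      (.eqN (.add (.nvar 0) (.add (.nvar 1) .one)) (.add (.add (.nvar 0) (.nvar 1)) .one))
  /-- `x · 0 = 0` -/
  | B5 : Basic L 1 0 (.eqN (.mul (.nvar 0) .zero) .zero)
  /-- `x · (y + 1) = (x · y) + x` -/
  | B6 : Basic L 2 0
      (.eqN (.mul (.nvar 0) (.add (.nvar 1) .one)) (.add (.mul (.nvar 0) (.nvar 1)) (.nvar 0)))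
  /-- `x ≤ y ∧ y ≤ x ⊃ x = y` -/
  | B7 : Basic L 2 0
      (.imp (.and (.le (.nvar 0) (.nvar 1)) (.le (.nvar 1) (.nvar 0))) (.eqN (.nvar 0) (.nvar 1)))
  /-- `0 ≤ x` -/
  | B8 : Basic L 1 0 (.le .zero (.nvar 0))
  /-- `x ≤ y ∧ y ≤ z ⊃ x ≤ z` -/
  | B9 : Basic L 3 0
      (.imp (.and (.le (.nvar 0) (.nvar 1)) (.le (.nvar 1) (.nvar 2))) (.le (.nvar 0) (.nvar 2)))
  /-- `x ≤ y ∨ y ≤ x` -/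
  | B10 : Basic L 2 0 (.or (.le (.nvar 0) (.nvar 1)) (.le (.nvar 1) (.nvar 0)))
  /-- `x ≤ y ↔ x < y + 1` -/
  | B11 : Basic L 2 0 (.iff (.le (.nvar 0) (.nvar 1)) (.lt (.nvar 0) (.add (.nvar 1) .one)))
  /-- `X(y) ⊃ y < |X|` -/
  | L1 : Basic L 1 1 (.imp (.mem (.nvar 0) (.svar 0)) (.lt (.nvar 0) (.len (.svar 0))))
  /-- `y + 1 = |X| ⊃ X(y)` -/
  | L2 : Basic L 1 1
      (.imp (.eqN (.add (.nvar 0) .one) (.len (.svar 0))) (.mem (.nvar 0) (.svar 0)))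

/-- The formula `φ_NUMONES(X, Y)`, saying that `Y` is the counting array of `X`; here `X` is the
string variable `1` and `Y` the string variable `0`, and `Y(z, y)` stands for `Y(⟨z, y⟩)`:
`[∀ z ≤ |X| ∃! y ≤ |X|, Y(z, y)] ∧ Y(0, 0) ∧
 ∀ z < |X| ∀ y ≤ |X|, Y(z, y) ⊃ [(X(z) ⊃ Y(z + 1, y + 1)) ∧ (¬ X(z) ⊃ Y(z + 1, y))]`. -/
def phiNumones : Formula L2A true 0 2 :=
  .and
    (.and
      (.allLe (.len (.svar 1)) (.exLe (.len (.svar 1))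
        (.and (.mem (pair (.nvar 1) (.nvar 0)) (.svar 0))
          (.allLe (.len (.svar 1))
            (.imp (.mem (pair (.nvar 2) (.nvar 0)) (.svar 0)) (.eqN (.nvar 0) (.nvar 1)))))))
      (.mem (pair .zero .zero) (.svar 0)))
    (.allLt (.len (.svar 1)) (.allLe (.len (.svar 1))
      (.imp (.mem (pair (.nvar 1) (.nvar 0)) (.svar 0))
        (.and
          (.imp (.mem (.nvar 1) (.svar 1))
            (.mem (pair (.add (.nvar 1) .one) (.add (.nvar 0) .one)) (.svar 0)))
          (.imp (.not (.mem (.nvar 1) (.svar 1)))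
            (.mem (pair (.add (.nvar 1) .one) (.nvar 0)) (.svar 0)))))))

/-- The theory `VTC⁰` over the base vocabulary. -/
inductive VTC0 : (n m : ℕ) → Formula L2A true n m → Prop
  | basic {n m : ℕ} {φ : Formula L2A true n m} : Basic L2A n m φ → VTC0 n m φ
  /-- `x ≠ 0 ⊃ ∃ y < x, y + 1 = x` -/
  | B12 : VTC0 1 0
      (.imp (.not (.eqN (.nvar 0) .zero))
        (.exLt (.nvar 0) (.eqN (.add (.nvar 0) .one) (.nvar 1))))
  /-- `X = Y ↔ [|X| = |Y| ∧ ∀ z < |X|, X(z) ↔ Y(z)]` -/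
  | SE : VTC0 0 2
      (.iff (.eqS (.svar 0) (.svar 1))
        (.and (.eqN (.len (.svar 0)) (.len (.svar 1)))
          (.allLt (.len (.svar 0))
            (.iff (.mem (.nvar 0) (.svar 0)) (.mem (.nvar 0) (.svar 1))))))
  /-- `Σ₀ᴮ` comprehension: `∃ X ≤ a, ∀ z < a, X(z) ↔ φ(z)`, where `a` is a number variable and `φ`
  a `Σ₀ᴮ` formula not containing `X` (with arbitrary other free variables). -/
  | comp {n m : ℕ} (a : Fin n) (φ : Formula L2A true (n + 1) m) : φ.IsSigma0B →
      VTC0 n m (.exSLe (.nvar a) (.allLt (.nvar a) (.iff (.mem (.nvar 0) (.svar 0)) φ.wkS)))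
  /-- `∀ X ∃ Y, φ_NUMONES(X, Y)` -/
  | numones : VTC0 0 0 (.allS (.exS phiNumones))

/-- The vocabulary of `VTC⁰-bar`: the smallest one that contains the base vocabulary, `pd`, `f_SE`,
`numones` and, for each open formula `α(z, x⃗, X⃗)` of the vocabulary itself and each term
`t(x⃗, X⃗)` of the base vocabulary, a string function `F_{α,t}(x⃗, X⃗)` and a number function
`f_{α,t}(x⃗, X⃗)`.  The variable `z` is the number variable `0` of `α`. -/
inductive LFTC0 : Srt → ℕ → ℕ → Type
  | pd : LFTC0 .num 1 0
  | fSE : LFTC0 .num 0 2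
  | numones : LFTC0 .num 1 1
  | F {n m : ℕ} (α : Formula LFTC0 false (n + 1) m) (t : Term L2A .num n m) : LFTC0 .str n m
  | f {n m : ℕ} (α : Formula LFTC0 false (n + 1) m) (t : Term L2A .num n m) : LFTC0 .num n m

/-- The term `pd(s)`. -/
def pdT {n m : ℕ} (s : Term LFTC0 .num n m) : Term LFTC0 .num n m := .app .pd ![s] ![]

/-- The term `f_SE(S, T)`. -/
def fSET {n m : ℕ} (S T : Term LFTC0 .str n m) : Term LFTC0 .num n m := .app .fSE ![] ![S, T]

/-- The term `numones(s, T)`. -/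
def numonesT {n m : ℕ} (s : Term LFTC0 .num n m) (T : Term LFTC0 .str n m) :
    Term LFTC0 .num n m :=
  .app .numones ![s] ![T]

/-- The term `f_{α,t}(x⃗, X⃗)`. -/
def fT {n m : ℕ} (α : Formula LFTC0 false (n + 1) m) (t : Term L2A .num n m) :
    Term LFTC0 .num n m :=
  .app (.f α t) .nvar .svar

/-- The term `F_{α,t}(x⃗, X⃗)`. -/
def FT {n m : ℕ} (α : Formula LFTC0 false (n + 1) m) (t : Term L2A .num n m) :
    Term LFTC0 .str n m :=
  .app (.F α t) .nvar .svar

/-- The universal theory `VTC⁰-bar` over `LFTC0`; all its axioms are open formulas. -/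
inductive VTC0bar : (n m : ℕ) → Formula LFTC0 true n m → Prop
  | basic {n m : ℕ} {φ : Formula LFTC0 true n m} : Basic LFTC0 n m φ → VTC0bar n m φ
  /-- `pd(0) = 0` -/
  | B12' : VTC0bar 0 0 (.eqN (pdT .zero) .zero)
  /-- `x ≠ 0 ⊃ pd(x) + 1 = x` -/
  | B12'' : VTC0bar 1 0
      (.imp (.not (.eqN (.nvar 0) .zero)) (.eqN (.add (pdT (.nvar 0)) .one) (.nvar 0)))
  /-- `X = Y ⊃ [|X| = |Y| ∧ (z < |X| ⊃ (X(z) ↔ Y(z)))]` -/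
  | SE' : VTC0bar 1 2
      (.imp (.eqS (.svar 0) (.svar 1))
        (.and (.eqN (.len (.svar 0)) (.len (.svar 1)))
          (.imp (.lt (.nvar 0) (.len (.svar 0)))
            (.iff (.mem (.nvar 0) (.svar 0)) (.mem (.nvar 0) (.svar 1))))))
  /-- `(|X| = |Y| ∧ f_SE(X, Y) = |X|) ⊃ X = Y` -/
  | SE'' : VTC0bar 0 2
      (.imp
        (.and (.eqN (.len (.svar 0)) (.len (.svar 1)))
          (.eqN (fSET (.svar 0) (.svar 1)) (.len (.svar 0))))
        (.eqS (.svar 0) (.svar 1)))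
  /-- `f_SE(X, Y) ≤ |X|` -/
  | fSE1 : VTC0bar 0 2 (.le (fSET (.svar 0) (.svar 1)) (.len (.svar 0)))
  /-- `f_SE(X, Y) < |X| ⊃ ¬ (X(f_SE(X, Y)) ↔ Y(f_SE(X, Y)))` -/
  | fSE2 : VTC0bar 0 2
      (.imp (.lt (fSET (.svar 0) (.svar 1)) (.len (.svar 0)))
        (.not (.iff (.mem (fSET (.svar 0) (.svar 1)) (.svar 0))
          (.mem (fSET (.svar 0) (.svar 1)) (.svar 1)))))
  /-- `z < f_SE(X, Y) ⊃ (X(z) ↔ Y(z))` -/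
  | fSE3 : VTC0bar 1 2
      (.imp (.lt (.nvar 0) (fSET (.svar 0) (.svar 1)))
        (.iff (.mem (.nvar 0) (.svar 0)) (.mem (.nvar 0) (.svar 1))))
  /-- `numones(0, X) = 0` -/
  | numones1 : VTC0bar 0 1 (.eqN (numonesT .zero (.svar 0)) .zero)
  /-- `X(z) ⊃ numones(z + 1, X) = numones(z, X) + 1` -/
  | numones2 : VTC0bar 1 1
      (.imp (.mem (.nvar 0) (.svar 0))
        (.eqN (numonesT (.add (.nvar 0) .one) (.svar 0))
          (.add (numonesT (.nvar 0) (.svar 0)) .one)))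
  /-- `¬ X(z) ⊃ numones(z + 1, X) = numones(z, X)` -/
  | numones3 : VTC0bar 1 1
      (.imp (.not (.mem (.nvar 0) (.svar 0)))
        (.eqN (numonesT (.add (.nvar 0) .one) (.svar 0)) (numonesT (.nvar 0) (.svar 0))))
  /-- `F_{α,t}(x⃗, X⃗)(z) ↔ z < t(x⃗, X⃗) ∧ α(z, x⃗, X⃗)` -/
  | defF {n m : ℕ} (α : Formula LFTC0 false (n + 1) m) (t : Term L2A .num n m) :
      VTC0bar (n + 1) m
        (.iff (.mem (.nvar 0) (FT α t).wkN) (.and (.lt (.nvar 0) t.ofBase.wkN) α.forget))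
  /-- `f_{α,t}(x⃗, X⃗) ≤ t(x⃗, X⃗)` -/
  | deff1 {n m : ℕ} (α : Formula LFTC0 false (n + 1) m) (t : Term L2A .num n m) :
      VTC0bar n m (.le (fT α t) t.ofBase)
  /-- `f_{α,t}(x⃗, X⃗) < t(x⃗, X⃗) ⊃ α(f_{α,t}(x⃗, X⃗), x⃗, X⃗)` -/
  | deff2 {n m : ℕ} (α : Formula LFTC0 false (n + 1) m) (t : Term L2A .num n m) :
      VTC0bar n m
        (.imp (.lt (fT α t) t.ofBase) (α.forget.subst (Fin.cons (fT α t) .nvar) .svar))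
  /-- `z < f_{α,t}(x⃗, X⃗) ⊃ ¬ α(z, x⃗, X⃗)` -/
  | deff3 {n m : ℕ} (α : Formula LFTC0 false (n + 1) m) (t : Term L2A .num n m) :
      VTC0bar (n + 1) m (.imp (.lt (.nvar 0) (fT α t).wkN) (.not α.forget))

end TwoSorted

namespace TwoSorted

open Term Formula

/-! ### Substitution, weakening and embedding lemmas -/

section Substitution

variable {L : Vocab}

namespace Term

theorem eval_subst (M : Struc L) {n m n' m' : ℕ} (x : Fin n' → M.Dom .num) (X : Fin m' → M.Dom .str)
    (σ : Fin n → Term L .num n' m') (τ : Fin m → Term L .str n' m') {s : Srt} (t : Term L s n m) :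
    (t.subst σ τ).eval M x X
      = t.eval M (fun i => (σ i).eval M x X) (fun j => (τ j).eval M x X) := by
  induction t with
  | _ => simp only [Term.subst, eval, *]

@[simp] theorem eval_wkN (M : Struc L) {n m : ℕ} {s : Srt} (t : Term L s n m) (a : M.Dom .num)
    (x : Fin n → M.Dom .num) (X : Fin m → M.Dom .str) :
    t.wkN.eval M (Fin.cons a x) X = t.eval M x X := by
  simp [wkN, eval_subst, eval]

@[simp] theorem eval_wkS (M : Struc L) {n m : ℕ} {s : Srt} (t : Term L s n m) (A : M.Dom .str)
    (x : Fin n → M.Dom .num) (X : Fin m → M.Dom .str) :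
    t.wkS.eval M x (Fin.cons A X) = t.eval M x X := by
  simp [wkS, eval_subst, eval]

theorem subst_subst {n m n' m' n'' m'' : ℕ} (σ : Fin n → Term L .num n' m')
    (τ : Fin m → Term L .str n' m') (σ' : Fin n' → Term L .num n'' m'')
    (τ' : Fin m' → Term L .str n'' m'') {s : Srt} (t : Term L s n m) :
    (t.subst σ τ).subst σ' τ'
      = t.subst (fun i => (σ i).subst σ' τ') (fun j => (τ j).subst σ' τ') := by
  induction t with
  | _ => simp only [Term.subst, *]

theorem wkN_subst {n m n' m' : ℕ} (σ : Fin n → Term L .num n' m')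
    (τ : Fin m → Term L .str n' m') {s : Srt} (t : Term L s n m) :
    t.wkN.subst (Fin.cons (nvar 0) fun i => (σ i).wkN) (fun j => (τ j).wkN)
      = (t.subst σ τ).wkN := by
  simp [wkN, subst_subst, subst]

theorem ofBase_subst {n m n' m' : ℕ} (σ : Fin n → Term L2A .num n' m')
    (τ : Fin m → Term L2A .str n' m') {s : Srt} (t : Term L2A s n m) :
    (t.subst σ τ).ofBase (L := L)
      = t.ofBase.subst (fun i => (σ i).ofBase) (fun j => (τ j).ofBase) := by
  induction t with
  | app f => exact nomatch f
  | _ => simp only [Term.subst, ofBase, *]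

@[simp] theorem ofBase_wkN {n m : ℕ} {s : Srt} (t : Term L2A s n m) :
    (t.wkN.ofBase : Term L s _ _) = t.ofBase.wkN := by
  simp [wkN, ofBase_subst, ofBase]

@[simp] theorem ofBase_wkS {n m : ℕ} {s : Srt} (t : Term L2A s n m) :
    (t.wkS.ofBase : Term L s _ _) = t.ofBase.wkS := by
  simp [wkS, ofBase_subst, ofBase]

@[simp] theorem ofBase_self {n m : ℕ} {s : Srt} (t : Term L2A s n m) :
    (t.ofBase : Term L2A s n m) = t := by
  induction t with
  | app f => exact nomatch f
  | _ => simp_all [ofBase]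

end Term

namespace Formula

theorem holds_subst (M : Struc L) {q : Bool} {n m : ℕ} (φ : Formula L q n m) :
    ∀ {n' m' : ℕ} (x : Fin n' → M.Dom .num) (X : Fin m' → M.Dom .str)
    (σ : Fin n → Term L .num n' m') (τ : Fin m → Term L .str n' m'),
    (φ.subst σ τ).Holds M x X
      ↔ φ.Holds M (fun i => (σ i).eval M x X) (fun j => (τ j).eval M x X) := by
  have hN : ∀ {n n' m' : ℕ} (x : Fin n' → M.Dom .num) (X : Fin m' → M.Dom .str)
      (σ : Fin n → Term L .num n' m') (a : M.Dom .num),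
      (fun i => ((Fin.cons (nvar 0) fun i => (σ i).wkN : Fin (n + 1) → Term L .num (n' + 1) m') i).eval
        M (Fin.cons a x) X) = Fin.cons a (fun i => (σ i).eval M x X) := by
    intro n n' m' x X σ a
    funext i
    refine Fin.cases ?_ (fun i => ?_) i <;> simp [Term.eval]
  have hS : ∀ {m n' m' : ℕ} (x : Fin n' → M.Dom .num) (X : Fin m' → M.Dom .str)
      (τ : Fin m → Term L .str n' m') (A : M.Dom .str),
      (fun i => ((Fin.cons (svar 0) fun i => (τ i).wkS : Fin (m + 1) → Term L .str n' (m' + 1)) i).eval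
        M x (Fin.cons A X)) = Fin.cons A (fun i => (τ i).eval M x X) := by
    intro m n' m' x X σ a
    funext i
    refine Fin.cases ?_ (fun i => ?_) i <;> simp [Term.eval]
  induction φ with
  | allN φ ih | exN φ ih | allS φ ih | exS φ ih =>
    intros; simp only [subst, Holds, ih, hN, hS, eval_wkN, eval_wkS]
  | _ => intros; simp only [Formula.subst, Holds, Term.eval_subst, *]

@[simp] theorem holds_wkS (M : Struc L) {q : Bool} {n m : ℕ} (φ : Formula L q n m) (A : M.Dom .str)
    (x : Fin n → M.Dom .num) (X : Fin m → M.Dom .str) :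
    φ.wkS.Holds M x (Fin.cons A X) ↔ φ.Holds M x X := by
  simp [wkS, holds_subst, Term.eval]

@[simp] theorem holds_forget (M : Struc L) {q : Bool} {n m : ℕ} (φ : Formula L q n m)
    (x : Fin n → M.Dom .num) (X : Fin m → M.Dom .str) :
    φ.forget.Holds M x X ↔ φ.Holds M x X := by
  induction φ with
  | _ => simp only [forget, Holds, *]

section Abbreviations

variable (M : Struc L) {q : Bool} {n m : ℕ} (x : Fin n → M.Dom .num) (X : Fin m → M.Dom .str)

@[simp] theorem holds_imp (φ ψ : Formula L q n m) :
    (imp φ ψ).Holds M x X ↔ (φ.Holds M x X → ψ.Holds M x X) := by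
  simp only [imp, Holds]; tauto

@[simp] theorem holds_iff (φ ψ : Formula L q n m) :
    (iff φ ψ).Holds M x X ↔ (φ.Holds M x X ↔ ψ.Holds M x X) := by
  simp only [iff, Holds, holds_imp]; tauto

end Abbreviations

/-- A formula without quantifiers. -/
def IsQF : {q : Bool} → {n m : ℕ} → Formula L q n m → Prop
  | _, _, _, top => True
  | _, _, _, bot => True
  | _, _, _, eqN _ _ => True
  | _, _, _, eqS _ _ => True
  | _, _, _, le _ _ => True
  | _, _, _, mem _ _ => True
  | _, _, _, not φ => φ.IsQF
  | _, _, _, and φ ψ => φ.IsQF ∧ ψ.IsQF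
  | _, _, _, or φ ψ => φ.IsQF ∧ ψ.IsQF
  | _, _, _, allN _ => False
  | _, _, _, exN _ => False
  | _, _, _, allS _ => False
  | _, _, _, exS _ => False

theorem isQF_of_false {q : Bool} {n m : ℕ} (α : Formula L q n m) (hq : q = false) : α.IsQF := by
  induction α with
  | not _ ih => exact ih hq
  | and _ _ ih ih' | or _ _ ih ih' => exact ⟨ih hq, ih' hq⟩
  | allN | exN | allS | exS => exact Bool.noConfusion hq
  | _ => trivial

theorem isQF {n m : ℕ} (α : Formula L false n m) : α.IsQF := isQF_of_false α rfl

theorem IsQF.forget {q : Bool} {n m : ℕ} {α : Formula L q n m} (h : α.IsQF) : α.forget.IsQF := by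
  induction α with
  | not _ ih => exact ih h
  | and _ _ ih ih' | or _ _ ih ih' => exact ⟨ih h.1, ih' h.2⟩
  | allN | exN | allS | exS => exact h
  | _ => trivial

theorem isQF_forget {n m : ℕ} (α : Formula L false n m) : α.forget.IsQF :=
  α.isQF.forget

theorem IsQF.exists_forget {q : Bool} {n m : ℕ} {φ : Formula L q n m} (h : φ.IsQF) :
    ∃ α : Formula L false n m, α.forget = φ.forget := by
  induction φ with
  | top => exact ⟨top, rfl⟩
  | bot => exact ⟨bot, rfl⟩
  | eqN s t => exact ⟨eqN s t, rfl⟩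
  | eqS s t => exact ⟨eqS s t, rfl⟩
  | le s t => exact ⟨le s t, rfl⟩
  | mem s t => exact ⟨mem s t, rfl⟩
  | not φ ih => obtain ⟨α, hα⟩ := ih h; exact ⟨not α, by simp [Formula.forget, hα]⟩
  | and φ ψ ih ih' =>
    obtain ⟨α, hα⟩ := ih h.1; obtain ⟨β, hβ⟩ := ih' h.2
    exact ⟨and α β, by simp [Formula.forget, hα, hβ]⟩
  | or φ ψ ih ih' =>
    obtain ⟨α, hα⟩ := ih h.1; obtain ⟨β, hβ⟩ := ih' h.2
    exact ⟨or α β, by simp [Formula.forget, hα, hβ]⟩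
  | _ => exact h.elim

theorem IsQF.subst {q : Bool} {n m n' m' : ℕ} {φ : Formula L q n m} (h : φ.IsQF)
    (σ : Fin n → Term L .num n' m') (τ : Fin m → Term L .str n' m') : (φ.subst σ τ).IsQF := by
  induction φ with
  | and _ _ ih ih' | or _ _ ih ih' => exact ⟨ih h.1 σ τ, ih' h.2 σ τ⟩
  | not _ ih => exact ih h σ τ
  | allN | exN | allS | exS => exact h.elim
  | _ => trivial

theorem forget_self : {n m : ℕ} → (φ : Formula L true n m) → φ.forget = φ
  | _, _, top | _, _, bot | _, _, eqN _ _ | _, _, eqS _ _ | _, _, le _ _ | _, _, mem _ _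
  | _, _, allN _ | _, _, exN _ | _, _, allS _ | _, _, exS _ => rfl
  | _, _, not φ => congrArg not (forget_self φ)
  | _, _, and φ ψ => congrArg₂ and (forget_self φ) (forget_self ψ)
  | _, _, or φ ψ => congrArg₂ or (forget_self φ) (forget_self ψ)

/-- A base formula is a formula over every vocabulary. -/
def ofBase : {q : Bool} → {n m : ℕ} → Formula L2A q n m → Formula L q n m
  | _, _, _, top => top
  | _, _, _, bot => bot
  | _, _, _, eqN s t => eqN s.ofBase t.ofBase
  | _, _, _, eqS S T => eqS S.ofBase T.ofBase
  | _, _, _, le s t => le s.ofBase t.ofBase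
  | _, _, _, mem t T => mem t.ofBase T.ofBase
  | _, _, _, not φ => not (ofBase φ)
  | _, _, _, and φ ψ => and (ofBase φ) (ofBase ψ)
  | _, _, _, or φ ψ => or (ofBase φ) (ofBase ψ)
  | _, _, _, allN φ => allN (ofBase φ)
  | _, _, _, exN φ => exN (ofBase φ)
  | _, _, _, allS φ => allS (ofBase φ)
  | _, _, _, exS φ => exS (ofBase φ)

theorem ofBase_forget {q : Bool} {n m : ℕ} (φ : Formula L2A q n m) :
    (φ.forget.ofBase : Formula L true n m) = φ.ofBase.forget := by
  induction φ <;> simp_all [forget, ofBase]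

section OfBase

variable {n m : ℕ} (t : Term L2A .num n m)

theorem ofBase_allLe (φ : Formula L2A true (n + 1) m) :
    (allLe t φ).ofBase (L := L) = allLe t.ofBase φ.ofBase := by
  simp only [allLe, imp, ofBase, Term.ofBase, ofBase_wkN]

theorem ofBase_exLe (φ : Formula L2A true (n + 1) m) :
    (exLe t φ).ofBase (L := L) = exLe t.ofBase φ.ofBase := by
  simp only [exLe, ofBase, Term.ofBase, ofBase_wkN]

theorem ofBase_allLt (φ : Formula L2A true (n + 1) m) :
    (allLt t φ).ofBase (L := L) = allLt t.ofBase φ.ofBase := by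
  simp only [allLt, imp, lt, ofBase, Term.ofBase, ofBase_wkN]

theorem ofBase_exLt (φ : Formula L2A true (n + 1) m) :
    (exLt t φ).ofBase (L := L) = exLt t.ofBase φ.ofBase := by
  simp only [exLt, lt, ofBase, Term.ofBase, ofBase_wkN]

theorem ofBase_exSLe (φ : Formula L2A true n (m + 1)) :
    (exSLe t φ).ofBase (L := L) = exSLe t.ofBase φ.ofBase := by
  simp only [exSLe, ofBase, Term.ofBase, ofBase_wkS]

theorem ofBase_allSLe (φ : Formula L2A true n (m + 1)) :
    (allSLe t φ).ofBase (L := L) = allSLe t.ofBase φ.ofBase := by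
  simp only [allSLe, imp, ofBase, Term.ofBase, ofBase_wkS]

end OfBase

theorem IsSigma0B.ofBase {n m : ℕ} {φ : Formula L2A true n m} (h : φ.IsSigma0B) :
    (φ.ofBase : Formula L true n m).IsSigma0B := by
  induction h with
  | ofOpen α => rw [ofBase_forget]; exact .ofOpen _
  | not _ ih => exact .not ih
  | and _ _ ih ih' => exact .and ih ih'
  | or _ _ ih ih' => exact .or ih ih'
  | allLe t _ ih => rw [ofBase_allLe, ofBase_self]; exact .allLe t ih
  | exLe t _ ih => rw [ofBase_exLe, ofBase_self]; exact .exLe t ih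
  | allLt t _ ih => rw [ofBase_allLt, ofBase_self]; exact .allLt t ih
  | exLt t _ ih => rw [ofBase_exLt, ofBase_self]; exact .exLt t ih

theorem IsGSigma1B.ofBase {n m : ℕ} {φ : Formula L2A true n m} (h : φ.IsGSigma1B) :
    (φ.ofBase : Formula L true n m).IsGSigma1B := by
  induction h with
  | ofSigma0B h => exact .ofSigma0B h.ofBase
  | and _ _ ih ih' => exact .and ih ih'
  | or _ _ ih ih' => exact .or ih ih'
  | allLe t _ ih => rw [ofBase_allLe, ofBase_self]; exact .allLe t ih
  | exLe t _ ih => rw [ofBase_exLe, ofBase_self]; exact .exLe t ih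
  | allLt t _ ih => rw [ofBase_allLt, ofBase_self]; exact .allLt t ih
  | exLt t _ ih => rw [ofBase_exLt, ofBase_self]; exact .exLt t ih
  | exSLe t _ ih => rw [ofBase_exSLe, ofBase_self]; exact .exSLe t ih

theorem IsGPi1B.ofBase {n m : ℕ} {φ : Formula L2A true n m} (h : φ.IsGPi1B) :
    (φ.ofBase : Formula L true n m).IsGPi1B := by
  induction h with
  | ofSigma0B h => exact .ofSigma0B h.ofBase
  | and _ _ ih ih' => exact .and ih ih'
  | or _ _ ih ih' => exact .or ih ih'
  | allLe t _ ih => rw [ofBase_allLe, ofBase_self]; exact .allLe t ih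
  | exLe t _ ih => rw [ofBase_exLe, ofBase_self]; exact .exLe t ih
  | allLt t _ ih => rw [ofBase_allLt, ofBase_self]; exact .allLt t ih
  | exLt t _ ih => rw [ofBase_exLt, ofBase_self]; exact .exLt t ih
  | allSLe t _ ih => rw [ofBase_allSLe, ofBase_self]; exact .allSLe t ih

end Formula

/-- The reduct of a structure to the base vocabulary. -/
def Struc.reduct (M : Struc L) : Struc L2A where
  Dom := M.Dom
  nonemptyStr := M.nonemptyStr
  zero := M.zero
  one := M.one
  add := M.add
  mul := M.mul
  len := M.len
  le := M.le
  mem := M.mem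
  fn f := nomatch f

theorem Term.eval_reduct (M : Struc L) {n m : ℕ} (x : Fin n → M.Dom .num) (X : Fin m → M.Dom .str)
    {s : Srt} (t : Term L2A s n m) : t.eval M.reduct x X = (t.ofBase : Term L s n m).eval M x X := by
  induction t with
  | nvar | svar | zero | one => rfl
  | add s t ih ih' => exact congrArg₂ M.add (ih x X) (ih' x X)
  | mul s t ih ih' => exact congrArg₂ M.mul (ih x X) (ih' x X)
  | len T ih => exact congrArg M.len (ih x X)
  | app f => exact nomatch f

theorem Formula.holds_reduct (M : Struc L) {q : Bool} {n m : ℕ} (φ : Formula L2A q n m)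
    (x : Fin n → M.Dom .num) (X : Fin m → M.Dom .str) :
    φ.Holds M.reduct x X ↔ (φ.ofBase : Formula L q n m).Holds M x X := by
  induction φ with
  | top | bot => rfl
  | eqN s t | eqS s t => simp only [ofBase, Holds, Term.eval_reduct]; rfl
  | le s t | mem s t => simp only [ofBase, Holds, Term.eval_reduct]; rfl
  | not φ ih => exact not_congr (ih x X)
  | and φ ψ ih ih' => exact and_congr (ih x X) (ih' x X)
  | or φ ψ ih ih' => exact or_congr (ih x X) (ih' x X)
  | allN φ ih => exact forall_congr' fun a => ih _ _
  | exN φ ih => exact exists_congr fun a => ih _ _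
  | allS φ ih => exact forall_congr' fun a => ih _ _
  | exS φ ih => exact exists_congr fun a => ih _ _

end Substitution


/-! ### Arithmetic in models of `V⁰` -/

section Notation

variable {L : Vocab} {M : Struc L}

instance : Zero (M.Dom .num) := ⟨M.zero⟩
instance : One (M.Dom .num) := ⟨M.one⟩
instance : Add (M.Dom .num) := ⟨M.add⟩
instance : Mul (M.Dom .num) := ⟨M.mul⟩
instance : LE (M.Dom .num) := ⟨M.le⟩
instance : LT (M.Dom .num) := ⟨fun a b => a ≤ b ∧ a ≠ b⟩
instance : Membership (M.Dom .num) (M.Dom .str) := ⟨fun X z => M.mem z X⟩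
instance : Nonempty (M.Dom .str) := M.nonemptyStr

/-- The length `|X|` of a string. -/
def slen (X : M.Dom .str) : M.Dom .num := M.len X

variable {n m : ℕ} (x : Fin n → M.Dom .num) (X : Fin m → M.Dom .str)

@[simp] theorem Term.eval_nvar (i : Fin n) : (nvar i : Term L _ n m).eval M x X = x i := rfl
@[simp] theorem Term.eval_svar (i : Fin m) : (svar i : Term L _ n m).eval M x X = X i := rfl
@[simp] theorem Term.eval_zero : (zero : Term L _ n m).eval M x X = 0 := rfl
@[simp] theorem Term.eval_one : (one : Term L _ n m).eval M x X = 1 := rfl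
@[simp] theorem Term.eval_add (s t : Term L _ n m) :
    (add s t).eval M x X = s.eval M x X + t.eval M x X := rfl
@[simp] theorem Term.eval_mul (s t : Term L _ n m) :
    (mul s t).eval M x X = s.eval M x X * t.eval M x X := rfl
@[simp] theorem Term.eval_len (T : Term L _ n m) :
    (len T).eval M x X = slen (T.eval M x X) := rfl
@[simp] theorem Term.eval_app {k l : ℕ} {s : Srt} (f : L s k l) (ts : Fin k → Term L .num n m)
    (Ts : Fin l → Term L .str n m) : (app f ts Ts).eval M x X
      = M.fn f (fun i => (ts i).eval M x X) (fun j => (Ts j).eval M x X) := rfl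

variable {q : Bool}

@[simp] theorem Formula.holds_top : (top : Formula L q n m).Holds M x X ↔ True := Iff.rfl
@[simp] theorem Formula.holds_bot : (bot : Formula L q n m).Holds M x X ↔ False := Iff.rfl
@[simp] theorem Formula.holds_eqN (s t : Term L _ n m) :
    (eqN s t : Formula L q n m).Holds M x X ↔ s.eval M x X = t.eval M x X := Iff.rfl
@[simp] theorem Formula.holds_eqS (s t : Term L _ n m) :
    (eqS s t : Formula L q n m).Holds M x X ↔ s.eval M x X = t.eval M x X := Iff.rfl
@[simp] theorem Formula.holds_le (s t : Term L _ n m) :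
    (le s t : Formula L q n m).Holds M x X ↔ s.eval M x X ≤ t.eval M x X := Iff.rfl
@[simp] theorem Formula.holds_mem (s : Term L _ n m) (t : Term L _ n m) :
    (mem s t : Formula L q n m).Holds M x X ↔ s.eval M x X ∈ t.eval M x X := Iff.rfl
@[simp] theorem Formula.holds_not (φ : Formula L q n m) :
    (not φ).Holds M x X ↔ ¬ φ.Holds M x X := Iff.rfl
@[simp] theorem Formula.holds_and (φ ψ : Formula L q n m) :
    (and φ ψ).Holds M x X ↔ φ.Holds M x X ∧ ψ.Holds M x X := Iff.rfl
@[simp] theorem Formula.holds_or (φ ψ : Formula L q n m) :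
    (or φ ψ).Holds M x X ↔ φ.Holds M x X ∨ ψ.Holds M x X := Iff.rfl
@[simp] theorem Formula.holds_lt (s t : Term L _ n m) :
    (lt s t : Formula L q n m).Holds M x X ↔ s.eval M x X < t.eval M x X := Iff.rfl

@[simp] theorem Formula.holds_allLe (t : Term L .num n m) (φ : Formula L true (n + 1) m) :
    (allLe t φ).Holds M x X ↔ ∀ a ≤ t.eval M x X, φ.Holds M (Fin.cons a x) X := by
  simp only [allLe, Holds, holds_imp, eval_wkN]; rfl
@[simp] theorem Formula.holds_exLe (t : Term L .num n m) (φ : Formula L true (n + 1) m) :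
    (exLe t φ).Holds M x X ↔ ∃ a ≤ t.eval M x X, φ.Holds M (Fin.cons a x) X := by
  simp only [exLe, Holds, eval_wkN]; rfl
@[simp] theorem Formula.holds_allLt (t : Term L .num n m) (φ : Formula L true (n + 1) m) :
    (allLt t φ).Holds M x X ↔ ∀ a < t.eval M x X, φ.Holds M (Fin.cons a x) X := by
  simp only [allLt, Holds, holds_imp, holds_lt, eval_wkN]; rfl
@[simp] theorem Formula.holds_exLt (t : Term L .num n m) (φ : Formula L true (n + 1) m) :
    (exLt t φ).Holds M x X ↔ ∃ a < t.eval M x X, φ.Holds M (Fin.cons a x) X := by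
  simp only [exLt, Holds, holds_lt, eval_wkN]; rfl
@[simp] theorem Formula.holds_allSLe (t : Term L .num n m) (φ : Formula L true n (m + 1)) :
    (allSLe t φ).Holds M x X ↔ ∀ A, slen A ≤ t.eval M x X → φ.Holds M x (Fin.cons A X) := by
  simp only [allSLe, Holds, holds_imp, eval_wkS]; rfl
@[simp] theorem Formula.holds_exSLe (t : Term L .num n m) (φ : Formula L true n (m + 1)) :
    (exSLe t φ).Holds M x X ↔ ∃ A, slen A ≤ t.eval M x X ∧ φ.Holds M x (Fin.cons A X) := by
  simp only [exSLe, Holds, eval_wkS]; rfl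

end Notation

/-- Extension of an assignment to a new variable. -/
def ocons {I α : Type} (a : α) (ω : I → α) (o : Option I) : α := o.elim a ω

@[simp] theorem ocons_none {I α : Type} (a : α) (ω : I → α) : ocons a ω none = a := rfl
@[simp] theorem ocons_some {I α : Type} (a : α) (ω : I → α) (i : I) :
    ocons a ω (some i) = ω i := rfl

theorem ocons_eta {I α : Type} (v : Option I → α) : ocons (v none) (fun i => v (some i)) = v := by
  funext o; cases o <;> rfl

section Definable

variable {L : Vocab} (M : Struc L)

/-- Polynomial functions on `M`, in variables indexed by `I`. -/
inductive SN : (I : Type) → ((I → M.Dom .num) → M.Dom .num) → Prop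
  | var {I : Type} (i : I) : SN I (fun ω => ω i)
  | const {I : Type} (a : M.Dom .num) : SN I (fun _ => a)
  | add {I : Type} {f g : (I → M.Dom .num) → M.Dom .num} :
      SN I f → SN I g → SN I (fun ω => f ω + g ω)
  | mul {I : Type} {f g : (I → M.Dom .num) → M.Dom .num} :
      SN I f → SN I g → SN I (fun ω => f ω * g ω)

/-- Relations on the numbers of `M` that are `Σ₀ᴮ`-definable with parameters in the base
vocabulary, in variables indexed by `I`. -/
inductive SP : (I : Type) → ((I → M.Dom .num) → Prop) → Prop
  | le {I : Type} {f g : (I → M.Dom .num) → M.Dom .num} :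
      SN M I f → SN M I g → SP I (fun ω => f ω ≤ g ω)
  | eq {I : Type} {f g : (I → M.Dom .num) → M.Dom .num} :
      SN M I f → SN M I g → SP I (fun ω => f ω = g ω)
  | mem {I : Type} {f : (I → M.Dom .num) → M.Dom .num} (A : M.Dom .str) :
      SN M I f → SP I (fun ω => f ω ∈ A)
  | not {I : Type} {P : (I → M.Dom .num) → Prop} : SP I P → SP I (fun ω => ¬ P ω)
  | and {I : Type} {P Q : (I → M.Dom .num) → Prop} : SP I P → SP I Q → SP I (fun ω => P ω ∧ Q ω)
  | exLe {I : Type} {f : (I → M.Dom .num) → M.Dom .num}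
      {P : (I → M.Dom .num) → M.Dom .num → Prop} : SN M I f →
      SP (Option I) (fun ω => P (fun i => ω (some i)) (ω none)) →
      SP I (fun ω => ∃ x ≤ f ω, P ω x)

variable {M} {I : Type}

theorem SP.or {P Q : (I → M.Dom .num) → Prop} (hP : SP M I P) (hQ : SP M I Q) :
    SP M I (fun ω => P ω ∨ Q ω) := by
  simpa only [not_and_or, not_not] using (hP.not.and hQ.not).not

theorem SP.imp {P Q : (I → M.Dom .num) → Prop} (hP : SP M I P) (hQ : SP M I Q) :
    SP M I (fun ω => P ω → Q ω) := by
  simpa only [imp_iff_not_or] using hP.not.or hQ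

theorem SP.lt {f g : (I → M.Dom .num) → M.Dom .num} (hf : SN M I f) (hg : SN M I g) :
    SP M I (fun ω => f ω < g ω) := (SP.le hf hg).and (SP.eq hf hg).not

theorem SP.allLe {f : (I → M.Dom .num) → M.Dom .num} {P : (I → M.Dom .num) → M.Dom .num → Prop}
    (hf : SN M I f) (hP : SP M (Option I) (fun ω => P (fun i => ω (some i)) (ω none))) :
    SP M I (fun ω => ∀ x ≤ f ω, P ω x) := by
  have := (SP.exLe (P := fun ω x => ¬ P ω x) hf hP.not).not
  simpa only [not_exists, not_and, not_not] using this

theorem SN.wk {f : (I → M.Dom .num) → M.Dom .num} (hf : SN M I f) {J : Type} (e : I → J) :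
    SN M J (fun ω => f (fun i => ω (e i))) := by
  induction hf with
  | var i => exact .var _
  | const a => exact .const a
  | add _ _ h h' => exact .add h h'
  | mul _ _ h h' => exact .mul h h'

theorem SP.wk {P : (I → M.Dom .num) → Prop} (hP : SP M I P) :
    ∀ {J : Type} (e : I → J), SP M J (fun ω => P (fun i => ω (e i))) := by
  induction hP with
  | le hf hg => exact fun e => .le (hf.wk e) (hg.wk e)
  | eq hf hg => exact fun e => .eq (hf.wk e) (hg.wk e)
  | mem A hf => exact fun e => .mem A (hf.wk e)
  | not _ h => exact fun e => (h e).not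
  | and _ _ h h' => exact fun e => (h e).and (h' e)
  | exLe hf _ h =>
    exact fun e => .exLe (hf.wk e) (h (Option.map e))

end Definable

/-- A model of `V⁰`, over any vocabulary. -/
class V0 {L : Vocab} (M : Struc L) : Prop where
  add_one_ne_zero (x : M.Dom .num) : x + 1 ≠ 0
  add_one_inj (x y : M.Dom .num) : x + 1 = y + 1 → x = y
  add_zero (x : M.Dom .num) : x + 0 = x
  add_add_one (x y : M.Dom .num) : x + (y + 1) = x + y + 1
  mul_zero (x : M.Dom .num) : x * 0 = 0
  mul_add_one (x y : M.Dom .num) : x * (y + 1) = x * y + x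
  le_antisymm (x y : M.Dom .num) : x ≤ y → y ≤ x → x = y
  zero_le (x : M.Dom .num) : 0 ≤ x
  le_trans (x y z : M.Dom .num) : x ≤ y → y ≤ z → x ≤ z
  le_total (x y : M.Dom .num) : x ≤ y ∨ y ≤ x
  le_iff_lt_add_one (x y : M.Dom .num) : x ≤ y ↔ x < y + 1
  exists_add_one (x : M.Dom .num) : x ≠ 0 → ∃ y, y + 1 = x
  lt_len (y : M.Dom .num) (X : M.Dom .str) : y ∈ X → y < slen X
  mem_of_len (y : M.Dom .num) (X : M.Dom .str) : y + 1 = slen X → y ∈ X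
  ext (X Y : M.Dom .str) : slen X = slen Y → (∀ z < slen X, z ∈ X ↔ z ∈ Y) → X = Y
  comp {I : Type} (P : (Option I → M.Dom .num) → Prop) (hP : SP M (Option I) P)
    (ω : I → M.Dom .num) (a : M.Dom .num) :
    ∃ X : M.Dom .str, ∀ z, z ∈ X ↔ z < a ∧ P (ocons z ω)

namespace V0

variable {L : Vocab} {M : Struc L} [hM : V0 M] {I : Type}

noncomputable instance : LinearOrder (M.Dom .num) where
  le_refl x := (hM.le_total x x).elim id id
  le_trans := hM.le_trans
  le_antisymm := hM.le_antisymm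
  le_total := hM.le_total
  lt_iff_le_not_ge x y :=
    ⟨fun h => ⟨h.1, fun h' => h.2 (hM.le_antisymm _ _ h.1 h')⟩, fun h => ⟨h.1, by
      rintro rfl; exact h.2 h.1⟩⟩
  toDecidableLE := Classical.decRel _
  toDecidableEq := Classical.decRel _
  toDecidableLT := Classical.decRel _

theorem lt_add_one (x : M.Dom .num) : x < x + 1 := (hM.le_iff_lt_add_one _ _).1 le_rfl

theorem add_one_le_iff {x y : M.Dom .num} : x + 1 ≤ y ↔ x < y := by
  rw [← not_lt, ← hM.le_iff_lt_add_one, not_le]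

theorem induction_fiber {P : (Option I → M.Dom .num) → Prop} (hP : SP M (Option I) P)
    (ω : I → M.Dom .num) (h0 : P (ocons 0 ω))
    (hs : ∀ x, P (ocons x ω) → P (ocons (x + 1) ω)) (a : M.Dom .num) : P (ocons a ω) := by
  by_contra ha
  obtain ⟨X, hX⟩ := hM.comp (fun v => ∀ i ≤ v none, P (ocons i fun j => v (some j)))
    (.allLe (.var _) (by
      convert hP.wk (Option.elim · (none : Option (Option I)) fun j => some (some j)) with v
      rename_i o; cases o <;> rfl)) ω (a + 1)
  have key : ∀ z, z ∈ X ↔ z ≤ a ∧ ∀ i ≤ z, P (ocons i ω) := by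
    intro z; exact (hX z).trans (and_congr_left' (hM.le_iff_lt_add_one _ _).symm)
  have h0X : 0 ∈ X := (key 0).2 ⟨hM.zero_le _, fun i hi => by
    rwa [hi.antisymm (hM.zero_le _)]⟩
  obtain ⟨y, hy⟩ := hM.exists_add_one (slen X) (fun h => by
    have := hM.lt_len _ _ h0X
    rw [h] at this
    exact lt_irrefl _ this)
  have hyX := (key y).1 (hM.mem_of_len y X hy)
  have hy1 : ∀ i ≤ y + 1, P (ocons i ω) := fun i hi => by
    rcases hi.lt_or_eq with h | rfl
    · exact hyX.2 _ ((hM.le_iff_lt_add_one _ _).2 h)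
    · exact hs _ (hyX.2 _ le_rfl)
  rcases hyX.1.lt_or_eq with h | rfl
  · have := hM.lt_len _ _ ((key (y + 1)).2 ⟨add_one_le_iff.2 h, hy1⟩)
    rw [hy] at this
    exact lt_irrefl _ this
  · exact ha (hyX.2 _ le_rfl)

theorem induction {P : M.Dom .num → Prop} (hP : SP M (Option Empty) fun v => P (v none))
    (h0 : P 0) (hs : ∀ x, P x → P (x + 1)) (a : M.Dom .num) : P a :=
  induction_fiber hP Empty.elim h0 hs a

theorem zero_add (x : M.Dom .num) : 0 + x = x :=
  induction (P := fun x => 0 + x = x) (.eq (.add (.const _) (.var _)) (.var _)) (hM.add_zero _)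
    (fun x h => by rw [hM.add_add_one, h]) x

theorem add_one_add (x y : M.Dom .num) : x + 1 + y = x + y + 1 :=
  induction (P := fun y => x + 1 + y = x + y + 1)
    (.eq (.add (.const _) (.var _)) (.add (.add (.const _) (.var _)) (.const _)))
    (by rw [hM.add_zero, hM.add_zero]) (fun y h => by rw [hM.add_add_one, h, hM.add_add_one]) y

theorem add_comm (x y : M.Dom .num) : x + y = y + x :=
  induction (P := fun y => x + y = y + x)
    (.eq (.add (.const _) (.var _)) (.add (.var _) (.const _)))
    (by rw [hM.add_zero, zero_add]) (fun y h => by rw [hM.add_add_one, h, add_one_add]) y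

theorem add_assoc (x y z : M.Dom .num) : x + y + z = x + (y + z) :=
  induction (P := fun z => x + y + z = x + (y + z))
    (.eq (.add (.const _) (.var _)) (.add (.const _) (.add (.const _) (.var _))))
    (by rw [hM.add_zero, hM.add_zero])
    (fun z h => by rw [hM.add_add_one, h, hM.add_add_one, hM.add_add_one]) z

theorem zero_mul (x : M.Dom .num) : 0 * x = 0 :=
  induction (P := fun x => 0 * x = 0) (.eq (.mul (.const _) (.var _)) (.const _)) (hM.mul_zero _)
    (fun x h => by rw [hM.mul_add_one, h, hM.add_zero]) x

theorem add_one_mul (x y : M.Dom .num) : (x + 1) * y = x * y + y :=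
  induction (P := fun y => (x + 1) * y = x * y + y)
    (.eq (.mul (.const _) (.var _)) (.add (.mul (.const _) (.var _)) (.var _)))
    (by rw [hM.mul_zero, hM.mul_zero, hM.add_zero])
    (fun y h => by
      rw [hM.mul_add_one, h, hM.mul_add_one, hM.add_add_one, hM.add_add_one,
        add_assoc (x * y) y x, add_comm y x, add_assoc (x * y) x y]) y

theorem mul_comm (x y : M.Dom .num) : x * y = y * x :=
  induction (P := fun y => x * y = y * x)
    (.eq (.mul (.const _) (.var _)) (.mul (.var _) (.const _)))
    (by rw [hM.mul_zero, zero_mul]) (fun y h => by rw [hM.mul_add_one, h, add_one_mul]) y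

theorem mul_add (x y z : M.Dom .num) : x * (y + z) = x * y + x * z :=
  induction (P := fun z => x * (y + z) = x * y + x * z)
    (.eq (.mul (.const _) (.add (.const _) (.var _)))
      (.add (.const _) (.mul (.const _) (.var _))))
    (by rw [hM.add_zero, hM.mul_zero, hM.add_zero])
    (fun z h => by rw [hM.add_add_one, hM.mul_add_one, h, hM.mul_add_one, add_assoc]) z

theorem mul_assoc (x y z : M.Dom .num) : x * y * z = x * (y * z) :=
  induction (P := fun z => x * y * z = x * (y * z))
    (.eq (.mul (.const _) (.var _)) (.mul (.const _) (.mul (.const _) (.var _))))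
    (by rw [hM.mul_zero, hM.mul_zero, hM.mul_zero])
    (fun z h => by rw [hM.mul_add_one, h, hM.mul_add_one, mul_add]) z

instance : CommSemiring (M.Dom .num) where
  add_assoc := add_assoc
  zero_add := zero_add
  add_zero := hM.add_zero
  add_comm := add_comm
  left_distrib := mul_add
  right_distrib x y z := by rw [mul_comm, mul_add, mul_comm z, mul_comm z]
  zero_mul := zero_mul
  mul_zero := hM.mul_zero
  mul_assoc := mul_assoc
  one_mul x := by rw [← zero_add 1, add_one_mul, zero_mul, zero_add]
  mul_one x := by rw [← zero_add 1, hM.mul_add_one, hM.mul_zero, zero_add]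
  mul_comm := mul_comm
  nsmul := nsmulRec

theorem le_self_add (x y : M.Dom .num) : x ≤ x + y :=
  induction (P := fun y => x ≤ x + y) (.le (.const _) (.add (.const _) (.var _)))
    (_root_.add_zero x).ge
    (fun y h => by rw [hM.add_add_one]; exact h.trans (lt_add_one _).le) y

theorem exists_add_of_le {x y : M.Dom .num} (h : x ≤ y) : ∃ d, y = x + d := by
  have := induction (P := fun y => x ≤ y → ∃ d ≤ y, y = x + d)
    (.imp (.le (.const _) (.var _))
      (.exLe (.var _) (.eq (.var _) (.add (.const _) (.var _)))))
    (fun h => ⟨0, le_rfl, by rw [hM.add_zero]; exact (hM.zero_le _).antisymm h⟩)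
    (fun y ih h => by
      rcases h.lt_or_eq with h | rfl
      · obtain ⟨d, hd, e⟩ := ih ((hM.le_iff_lt_add_one _ _).2 h)
        refine ⟨d + 1, ?_, by rw [hM.add_add_one, ← e]⟩
        exact add_one_le_iff.2 (hd.trans_lt (lt_add_one _))
      · exact ⟨0, hM.zero_le _, (hM.add_zero _).symm⟩) y h
  obtain ⟨d, -, e⟩ := this
  exact ⟨d, e⟩

theorem add_right_cancel' {x y z : M.Dom .num} : x + z = y + z → x = y :=
  induction (P := fun z => x + z = y + z → x = y)
    (.imp (.eq (.add (.const _) (.var _)) (.add (.const _) (.var _))) (.eq (.const _) (.const _)))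
    (by rw [hM.add_zero, hM.add_zero]; exact id)
    (fun z ih h => ih (hM.add_one_inj _ _ (by rwa [hM.add_add_one, hM.add_add_one] at h))) z

theorem mul_lt_mul_left' {a b c : M.Dom .num} (hc : 0 < c) (h : a < b) : c * a < c * b := by
  obtain ⟨d, rfl⟩ := exists_add_of_le (add_one_le_iff.2 h)
  obtain ⟨e, rfl⟩ := exists_add_of_le (add_one_le_iff.2 hc)
  have : (0 + 1 + e) * (a + 1 + d) = (0 + 1 + e) * a + 1 + (e + (0 + 1 + e) * d) := by ring
  rw [this, ← add_one_le_iff]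
  exact le_self_add _ _

instance : IsStrictOrderedRing (M.Dom .num) where
  add_le_add_left a b h c := by
    obtain ⟨d, rfl⟩ := exists_add_of_le h
    rw [add_right_comm]
    exact le_self_add _ _
  zero_le_one := hM.zero_le _
  exists_pair_ne := ⟨0, 1, fun h => hM.add_one_ne_zero 0 (by rw [zero_add, h])⟩
  le_of_add_le_add_left a b c h := by
    by_contra hc
    obtain ⟨d, hd⟩ := exists_add_of_le h
    obtain ⟨e, rfl⟩ := exists_add_of_le (add_one_le_iff.2 (not_le.1 hc))
    have : (c + 1 + (e + d)) = c := add_right_cancel' (z := a) (by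
      rw [add_comm c a, hd]; ring)
    exact absurd ((le_self_add (c + 1) (e + d)).trans this.le) (not_le.2 (lt_add_one _))
  mul_lt_mul_of_pos_left a ha b c h := mul_lt_mul_left' ha h
  mul_lt_mul_of_pos_right a ha b c h := by
    simp only [mul_comm _ a]; exact mul_lt_mul_left' ha h

instance : CanonicallyOrderedAdd (M.Dom .num) where
  exists_add_of_le := exists_add_of_le
  le_add_self a b := by rw [add_comm]; exact le_self_add _ _
  le_self_add := le_self_add

theorem lt_add_one_iff {x y : M.Dom .num} : x < y + 1 ↔ x ≤ y := (hM.le_iff_lt_add_one _ _).symm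

theorem slen_le {X : M.Dom .str} {a : M.Dom .num} (h : ∀ z ∈ X, z < a) : slen X ≤ a := by
  by_cases h0 : slen X = 0
  · rw [h0]; exact hM.zero_le _
  · obtain ⟨y, hy⟩ := hM.exists_add_one _ h0
    rw [← hy]
    exact add_one_le_iff.2 (h y (hM.mem_of_len _ _ hy))

theorem str_ext {X Y : M.Dom .str} (h : ∀ z, z ∈ X ↔ z ∈ Y) : X = Y :=
  hM.ext X Y ((slen_le fun z hz => hM.lt_len _ _ ((h z).1 hz)).antisymm
    (slen_le fun z hz => hM.lt_len _ _ ((h z).2 hz))) fun z _ => h z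

theorem exists_least_fiber {P : (Option I → M.Dom .num) → Prop} (hP : SP M (Option I) P)
    (ω : I → M.Dom .num) {a : M.Dom .num} (ha : P (ocons a ω)) :
    ∃ b ≤ a, P (ocons b ω) ∧ ∀ c < b, ¬ P (ocons c ω) := by
  by_contra! h
  refine induction_fiber (P := fun v => ∀ i ≤ v none, i ≤ a → ¬ P (ocons i fun j => v (some j)))
    (.allLe (.var _) (.imp (.le (.var _) (.const _)) ?_)) ω ?_ ?_ a a le_rfl le_rfl ha
  · refine SP.not ?_
    convert hP.wk (Option.elim · (none : Option (Option I)) fun j => some (some j)) with v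
    rename_i o; cases o <;> rfl
  · intro i hi hia hPi
    obtain ⟨c, hc, -⟩ := h i hia hPi
    exact (hM.zero_le c).not_gt (hc.trans_le hi)
  · intro x hx i hi hia hPi
    obtain ⟨c, hc, hPc⟩ := h i hia hPi
    exact hx c (lt_add_one_iff.1 (hc.trans_le hi)) (hc.le.trans hia) hPc

end V0

section Pairing

variable {L : Vocab} {M : Struc L}

/-- The pairing function `⟨x, y⟩ = (x + y)(x + y + 1) + 2y`. -/
def pr (x y : M.Dom .num) : M.Dom .num := (x + y) * (x + y + 1) + (1 + 1) * y

@[simp] theorem Term.eval_pair {n m : ℕ} (x : Fin n → M.Dom .num) (X : Fin m → M.Dom .str)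
    (s t : Term L .num n m) : (pair s t).eval M x X = pr (s.eval M x X) (t.eval M x X) := rfl

theorem SN.pr {I : Type} {f g : (I → M.Dom .num) → M.Dom .num} (hf : SN M I f) (hg : SN M I g) :
    SN M I (fun ω => pr (f ω) (g ω)) :=
  .add (.mul (.add hf hg) (.add (.add hf hg) (.const _))) (.mul (.add (.const _) (.const _)) hg)

variable [V0 M]

theorem pr_lt_pr {x x' y y' : M.Dom .num} (h : x ≤ x') (h' : y < y') : pr x y < pr x' y' := by
  unfold pr
  refine add_lt_add_of_le_of_lt (by gcongr) (mul_lt_mul_of_pos_left h' ?_)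
  exact add_pos one_pos one_pos

theorem pr_le_pr {x x' y y' : M.Dom .num} (h : x ≤ x') (h' : y ≤ y') : pr x y ≤ pr x' y' := by
  unfold pr
  gcongr

theorem left_le_pr (x y : M.Dom .num) : x ≤ pr x y := by
  have : pr x y = x + ((x + y) * (x + y) + (1 + 1 + 1) * y) := by unfold pr; ring
  rw [this]; exact le_self_add

theorem right_le_pr (x y : M.Dom .num) : y ≤ pr x y := by
  have : pr x y = y + ((x + y) * (x + y) + x + (1 + 1) * y) := by unfold pr; ring
  rw [this]; exact le_self_add

theorem pr_sum_le {x x' y y' : M.Dom .num} (h : pr x y = pr x' y') : x' + y' ≤ x + y := by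
  by_contra! hlt
  obtain ⟨d, hd⟩ := exists_add_of_le (V0.add_one_le_iff.2 hlt)
  have : pr x' y' = pr x y + 1 + (1 + (1 + 1) * x + d * d + d * (2 * (x + y) + 3) + 2 * y') := by
    unfold pr; rw [hd]; ring
  rw [h] at this
  exact (lt_of_lt_of_le (V0.lt_add_one _) le_self_add).ne this

theorem pr_inj {x x' y y' : M.Dom .num} : pr x y = pr x' y' ↔ x = x' ∧ y = y' := by
  refine ⟨fun h => ?_, by rintro ⟨rfl, rfl⟩; rfl⟩
  have hs : x + y = x' + y' := (pr_sum_le h.symm).antisymm (pr_sum_le h)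
  have hy : y = y' := by
    unfold pr at h
    rw [hs] at h
    have h2 := add_left_cancel h
    exact mul_left_cancel₀ (by simp) h2
  subst hy
  exact ⟨add_right_cancel hs, rfl⟩

end Pairing


/-! ### Functions and relations definable by terms and formulas with parameters -/

section Env

variable {L : Vocab} (M : Struc L) (I : Type)

/-- An assignment of parameters and of variables from `I` to finitely many formal variables. -/
structure Env where
  n : ℕ
  m : ℕ
  c : Fin n → I ⊕ M.Dom .num
  A : Fin m → M.Dom .str

variable {M I}

/-- The numbers assigned to the formal number variables. -/
def Env.val (E : Env M I) (ω : I → M.Dom .num) (j : Fin E.n) : M.Dom .num :=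
  Sum.elim ω id (E.c j)

instance : Preorder (Env M I) where
  le E E' := ∃ (r : Fin E.n → Fin E'.n) (r' : Fin E.m → Fin E'.m),
    (∀ j, E'.c (r j) = E.c j) ∧ ∀ j, E'.A (r' j) = E.A j
  le_refl E := ⟨id, id, fun _ => rfl, fun _ => rfl⟩
  le_trans := by
    rintro E E' E'' ⟨r, r', h, h'⟩ ⟨s, s', k, k'⟩
    exact ⟨s ∘ r, s' ∘ r', fun j => (k _).trans (h j), fun j => (k' _).trans (h' j)⟩

instance : IsDirectedOrder (Env M I) where
  directed E E' := ⟨⟨E.n + E'.n, E.m + E'.m, Fin.append E.c E'.c, Fin.append E.A E'.A⟩,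
    ⟨Fin.castAdd _, Fin.castAdd _, by simp, by simp⟩, ⟨Fin.natAdd _, Fin.natAdd _, by simp, by simp⟩⟩

instance : Nonempty (Env M I) := ⟨⟨0, 0, Fin.elim0, Fin.elim0⟩⟩

/-- The function is given by a term in the formal variables of `E`. -/
def Env.DefT (E : Env M I) {s : Srt} (f : (I → M.Dom .num) → M.Dom s) : Prop :=
  ∃ t : Term L s E.n E.m, ∀ ω, f ω = t.eval M (E.val ω) E.A

theorem Env.DefT.mono {E E' : Env M I} (h : E ≤ E') {s : Srt} {f : (I → M.Dom .num) → M.Dom s}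
    (hf : E.DefT f) : E'.DefT f := by
  obtain ⟨r, r', h, h'⟩ := h
  obtain ⟨t, ht⟩ := hf
  refine ⟨t.subst (fun j => nvar (r j)) (fun j => svar (r' j)), fun ω => ?_⟩
  simp [Term.eval_subst, ht, Env.val, h, h']; rfl

/-- The relation is given by an open formula in the formal variables of `E`. -/
def Env.DefP (E : Env M I) (P : (I → M.Dom .num) → Prop) : Prop :=
  ∃ φ : Formula L true E.n E.m, φ.IsQF ∧ ∀ ω, P ω ↔ φ.Holds M (E.val ω) E.A

theorem Env.DefP.mono {E E' : Env M I} (h : E ≤ E') {P : (I → M.Dom .num) → Prop}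
    (hP : E.DefP P) : E'.DefP P := by
  obtain ⟨r, r', h, h'⟩ := h
  obtain ⟨φ, ho, hφ⟩ := hP
  refine ⟨φ.subst (fun j => nvar (r j)) (fun j => svar (r' j)), ho.subst _ _, fun ω => ?_⟩
  simp [Formula.holds_subst, hφ, Env.val, h, h']; rfl

/-- Functions given by terms with parameters. -/
def DefT (M : Struc L) (I : Type) {s : Srt} (f : (I → M.Dom .num) → M.Dom s) : Prop :=
  ∃ E : Env M I, E.DefT f

/-- Relations given by open formulas with parameters. -/
def DefP (M : Struc L) (I : Type) (P : (I → M.Dom .num) → Prop) : Prop :=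
  ∃ E : Env M I, E.DefP P

theorem DefT.exists_env {s : Srt} {k : ℕ} {f : Fin k → (I → M.Dom .num) → M.Dom s}
    (h : ∀ i, DefT M I (f i)) : ∃ E : Env M I, ∀ i, E.DefT (f i) := by
  choose E hE using h
  obtain ⟨E', h'⟩ := Finite.exists_le E
  exact ⟨E', fun i => (hE i).mono (h' i)⟩

theorem DefT.exists_env₂ {n m : ℕ} {u : Fin n → (I → M.Dom .num) → M.Dom .num}
    {U : Fin m → (I → M.Dom .num) → M.Dom .str} (h : ∀ i, DefT M I (u i))
    (h' : ∀ i, DefT M I (U i)) :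
    ∃ E : Env M I, (∀ i, E.DefT (u i)) ∧ ∀ i, E.DefT (U i) := by
  obtain ⟨E, hE⟩ := exists_env h
  obtain ⟨E', hE'⟩ := exists_env h'
  obtain ⟨F, h1, h2⟩ := exists_ge_ge E E'
  exact ⟨F, fun i => (hE i).mono h1, fun i => (hE' i).mono h2⟩

theorem DefT.eval {n m : ℕ} {s : Srt} (t : Term L s n m)
    {u : Fin n → (I → M.Dom .num) → M.Dom .num} {U : Fin m → (I → M.Dom .num) → M.Dom .str}
    (h : ∀ i, DefT M I (u i)) (h' : ∀ i, DefT M I (U i)) :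
    DefT M I (fun ω => t.eval M (fun i => u i ω) (fun i => U i ω)) := by
  obtain ⟨E, hE, hE'⟩ := exists_env₂ h h'
  choose σ hσ using hE
  choose τ hτ using hE'
  exact ⟨E, t.subst σ τ, fun ω => by simp [Term.eval_subst, hσ, hτ]⟩

theorem DefP.holds {n m : ℕ} {q : Bool} {φ : Formula L q n m} (ho : φ.IsQF)
    {u : Fin n → (I → M.Dom .num) → M.Dom .num} {U : Fin m → (I → M.Dom .num) → M.Dom .str}
    (h : ∀ i, DefT M I (u i)) (h' : ∀ i, DefT M I (U i)) :
    DefP M I (fun ω => φ.Holds M (fun i => u i ω) (fun i => U i ω)) := by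
  obtain ⟨α, hα⟩ := ho.exists_forget
  obtain ⟨E, hE, hE'⟩ := DefT.exists_env₂ h h'
  choose σ hσ using hE
  choose τ hτ using hE'
  refine ⟨E, α.forget.subst σ τ, (isQF_forget α).subst _ _, fun ω => ?_⟩
  rw [hα]
  simp [Formula.holds_subst, hσ, hτ]

theorem DefT.var (i : I) : DefT M I (fun ω => ω i) :=
  ⟨⟨1, 0, fun _ => .inl i, Fin.elim0⟩, nvar 0, fun _ => rfl⟩

theorem DefT.const {s : Srt} (a : M.Dom s) : DefT M I (fun _ => a) := by
  cases s with
  | num => exact ⟨⟨1, 0, fun _ => .inr a, Fin.elim0⟩, nvar 0, fun _ => rfl⟩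
  | str => exact ⟨⟨0, 1, Fin.elim0, fun _ => a⟩, svar 0, fun _ => rfl⟩

section Closure

variable {f g : (I → M.Dom .num) → M.Dom .num} {F G : (I → M.Dom .num) → M.Dom .str}
  {P Q : (I → M.Dom .num) → Prop}

theorem DefT.add (hf : DefT M I f) (hg : DefT M I g) : DefT M I (fun ω => f ω + g ω) :=
  eval (M := M) (n := 2) (m := 0) (u := ![f, g]) (U := ![]) (.add (nvar 0) (nvar 1))
    (by simp [Fin.forall_fin_two, hf, hg]) (fun i => i.elim0)

theorem DefT.mul (hf : DefT M I f) (hg : DefT M I g) : DefT M I (fun ω => f ω * g ω) :=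
  eval (M := M) (n := 2) (m := 0) (u := ![f, g]) (U := ![]) (.mul (nvar 0) (nvar 1))
    (by simp [Fin.forall_fin_two, hf, hg]) (fun i => i.elim0)

theorem DefT.len (hF : DefT M I F) : DefT M I (fun ω => slen (F ω)) :=
  eval (M := M) (n := 0) (m := 1) (u := ![]) (U := ![F]) (.len (svar 0))
    (fun i => i.elim0) (by simp [hF])

theorem DefT.pr (hf : DefT M I f) (hg : DefT M I g) : DefT M I (fun ω => pr (f ω) (g ω)) :=
  .add (.mul (.add hf hg) (.add (.add hf hg) (.const _))) (.mul (.add (.const _) (.const _)) hg)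

theorem DefP.le (hf : DefT M I f) (hg : DefT M I g) : DefP M I (fun ω => f ω ≤ g ω) :=
  holds (M := M) (n := 2) (m := 0) (φ := (.le (nvar 0) (nvar 1) : Formula L true 2 0)) trivial
    (u := ![f, g]) (U := ![]) (by simp [Fin.forall_fin_two, hf, hg]) (fun i => i.elim0)

theorem DefP.eq (hf : DefT M I f) (hg : DefT M I g) : DefP M I (fun ω => f ω = g ω) :=
  holds (M := M) (n := 2) (m := 0) (φ := (.eqN (nvar 0) (nvar 1) : Formula L true 2 0)) trivial
    (u := ![f, g]) (U := ![]) (by simp [Fin.forall_fin_two, hf, hg]) (fun i => i.elim0)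

theorem DefP.mem (hf : DefT M I f) (hF : DefT M I F) : DefP M I (fun ω => f ω ∈ F ω) :=
  holds (M := M) (n := 1) (m := 1) (φ := (.mem (nvar 0) (svar 0) : Formula L true 1 1)) trivial
    (u := ![f]) (U := ![F]) (by simp [hf]) (by simp [hF])

theorem DefP.not (hP : DefP M I P) : DefP M I (fun ω => ¬ P ω) := by
  obtain ⟨E, φ, ho, hφ⟩ := hP
  exact ⟨E, .not φ, ho, fun ω => by simp [hφ]⟩

theorem DefP.and (hP : DefP M I P) (hQ : DefP M I Q) : DefP M I (fun ω => P ω ∧ Q ω) := by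
  obtain ⟨E, hP⟩ := hP
  obtain ⟨E', hQ⟩ := hQ
  obtain ⟨F, h1, h2⟩ := exists_ge_ge E E'
  obtain ⟨φ, ho, hφ⟩ := hP.mono h1
  obtain ⟨ψ, ho', hψ⟩ := hQ.mono h2
  exact ⟨F, .and φ ψ, ⟨ho, ho'⟩, fun ω => by simp [hφ, hψ]⟩

theorem DefP.or (hP : DefP M I P) (hQ : DefP M I Q) : DefP M I (fun ω => P ω ∨ Q ω) := by
  simpa only [not_and_or, not_not] using (hP.not.and hQ.not).not

theorem DefP.lt (hf : DefT M I f) (hg : DefT M I g) : DefP M I (fun ω => f ω < g ω) :=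
  (DefP.le hf hg).and (DefP.eq hf hg).not

theorem DefT.subst {J : Type} {s : Srt} {h : (I → M.Dom .num) → M.Dom s} (hh : DefT M I h)
    {u : I → (J → M.Dom .num) → M.Dom .num} (hu : ∀ i, DefT M J (u i)) :
    DefT M J (fun ω => h (fun i => u i ω)) := by
  obtain ⟨E, t, ht⟩ := hh
  simp only [ht]
  refine DefT.eval t (fun j => ?_) (fun j => .const _)
  unfold Env.val
  cases E.c j with
  | inl i => exact hu i
  | inr a => exact .const a

theorem DefP.subst {J : Type} (hP : DefP M I P)
    {u : I → (J → M.Dom .num) → M.Dom .num} (hu : ∀ i, DefT M J (u i)) :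
    DefP M J (fun ω => P (fun i => u i ω)) := by
  obtain ⟨E, φ, ho, hφ⟩ := hP
  simp only [hφ]
  refine DefP.holds ho (fun j => ?_) (fun j => .const _)
  unfold Env.val
  cases E.c j with
  | inl i => exact hu i
  | inr a => exact .const a

theorem SN.defT (hf : SN M I f) : DefT M I f := by
  induction hf with
  | var i => exact .var i
  | const a => exact .const a
  | add _ _ h h' => exact .add h h'
  | mul _ _ h h' => exact .mul h h'

end Closure

end Env


/-! ### Models of the universal theory -/

/-- Models of `VTC⁰-bar`. -/
class TB (M : Struc LFTC0) : Prop where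
  models (n m : ℕ) (φ : Formula LFTC0 true n m) : VTC0bar n m φ → M.Models φ

namespace TB

variable {M : Struc LFTC0} [hM : TB M]

section Functions

variable {n m : ℕ} (α : Formula LFTC0 false (n + 1) m) (t : Term L2A .num n m)
  (x : Fin n → M.Dom .num) (X : Fin m → M.Dom .str)

theorem mem_F (z : M.Dom .num) : z ∈ M.fn (.F α t) x X ↔
    z < t.ofBase.eval M x X ∧ α.Holds M (Fin.cons z x) X := by
  have := hM.models _ _ _ (.defF α t) (Fin.cons z x) X
  simpa [FT] using this

theorem f_le : M.fn (.f α t) x X ≤ t.ofBase.eval M x X := by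
  have := hM.models _ _ _ (.deff1 α t) x X
  simpa [fT] using this

theorem holds_f (h : M.fn (.f α t) x X < t.ofBase.eval M x X) :
    α.Holds M (Fin.cons (M.fn (.f α t) x X) x) X := by
  have := hM.models _ _ _ (.deff2 α t) x X
  have e : (fun i => Term.eval M x X ((Fin.cons (fT α t) nvar : Fin (n + 1) → _) i))
      = Fin.cons (M.fn (.f α t) x X) x := by
    funext i
    refine Fin.cases ?_ (fun i => ?_) i <;> simp [fT]
  simp only [holds_imp, holds_subst, holds_forget, holds_lt, e] at this
  exact this h

theorem not_holds_of_lt_f (z : M.Dom .num) (h : z < M.fn (.f α t) x X) :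
    ¬ α.Holds M (Fin.cons z x) X := by
  have := hM.models _ _ _ (.deff3 α t) (Fin.cons z x) X
  simp only [holds_imp, holds_not, holds_forget, holds_lt, eval_wkN] at this
  exact this h

theorem f_lt_iff : M.fn (.f α t) x X < t.ofBase.eval M x X ↔
    ∃ z < t.ofBase.eval M x X, α.Holds M (Fin.cons z x) X := by
  refine ⟨fun h => ⟨_, h, holds_f α t x X h⟩, fun ⟨z, hz, h⟩ => ⟨f_le α t x X, fun e => ?_⟩⟩
  rw [← e] at hz
  exact not_holds_of_lt_f α t x X z hz h

end Functions

theorem le_iff_lt_add_one (x y : M.Dom .num) : x ≤ y ↔ x < y + 1 := by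
  simpa using hM.models _ _ _ (.basic .B11) ![x, y] ![]

section Definable

variable {I : Type}

omit hM in
theorem exists_formula {P : (I → M.Dom .num) → M.Dom .num → Prop}
    (hP : DefP M (Option I) (fun ω => P (fun i => ω (some i)) (ω none)))
    {b : (I → M.Dom .num) → M.Dom .num} (hb : DefT M I b) :
    ∃ (n m : ℕ) (α : Formula LFTC0 false (n + 2) m)
      (u : Fin (n + 1) → (I → M.Dom .num) → M.Dom .num) (A : Fin m → M.Dom .str),
      (∀ i, DefT M I (u i)) ∧ (∀ ω, u 0 ω = b ω) ∧
      ∀ ω z, P ω z ↔ α.Holds M (Fin.cons z fun i => u i ω) A := by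
  obtain ⟨E, φ, ho, hφ⟩ := hP
  let σ : Fin E.n → Term LFTC0 .num (E.n + 2) E.m := fun j =>
    match E.c j with
    | .inl none => nvar 0
    | _ => nvar j.succ.succ
  let v : Fin E.n → (I → M.Dom .num) → M.Dom .num := fun j ω =>
    match E.c j with
    | .inl none => 0
    | .inl (some i) => ω i
    | .inr a => a
  obtain ⟨α, hα⟩ := (ho.subst σ svar).exists_forget
  refine ⟨E.n, E.m, α, Fin.cons b v, E.A, fun i => ?_, fun ω => rfl, fun ω z => ?_⟩
  · refine Fin.cases hb (fun j => ?_) i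
    simp only [Fin.cons_succ, v]
    rcases E.c j with (_ | i) | a
    · exact .const _
    · exact .var i
    · exact .const _
  · rw [← holds_forget, hα, holds_forget, holds_subst]
    refine (hφ (ocons z ω)).trans (iff_of_eq ?_)
    congr 1
    funext j
    simp only [Env.val, σ, v]
    rcases h : E.c j with (_ | i) | a
    · simp
    · simp [h]
    · simp [h]

theorem _root_.TwoSorted.DefT.comp {P : (I → M.Dom .num) → M.Dom .num → Prop}
    (hP : DefP M (Option I) (fun ω => P (fun i => ω (some i)) (ω none)))
    {b : (I → M.Dom .num) → M.Dom .num} (hb : DefT M I b) :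
    ∃ F : (I → M.Dom .num) → M.Dom .str, DefT M I F ∧ ∀ ω z, z ∈ F ω ↔ z < b ω ∧ P ω z := by
  obtain ⟨n, m, α, u, A, hu, h0, h⟩ := exists_formula hP hb
  refine ⟨fun ω => M.fn (.F α (nvar 0)) (fun i => u i ω) A, ?_, fun ω z => ?_⟩
  · exact DefT.eval (.app (.F α (nvar 0)) nvar svar) hu fun j => .const (A j)
  · rw [mem_F, h, ← h0]; rfl

theorem _root_.TwoSorted.DefT.least {P : (I → M.Dom .num) → M.Dom .num → Prop}
    (hP : DefP M (Option I) (fun ω => P (fun i => ω (some i)) (ω none)))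
    {b : (I → M.Dom .num) → M.Dom .num} (hb : DefT M I b) :
    ∃ f : (I → M.Dom .num) → M.Dom .num, DefT M I f ∧ (∀ ω, f ω < b ω → P ω (f ω)) ∧
      ∀ ω, f ω < b ω ↔ ∃ z < b ω, P ω z := by
  obtain ⟨n, m, α, u, A, hu, h0, h⟩ := exists_formula hP hb
  refine ⟨fun ω => M.fn (.f α (nvar 0)) (fun i => u i ω) A, ?_, fun ω hlt => ?_, fun ω => ?_⟩
  · exact DefT.eval (.app (.f α (nvar 0)) nvar svar) hu fun j => .const (A j)
  · rw [h]
    exact holds_f α (nvar 0) _ _ (by rw [← h0] at hlt; exact hlt)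
  · simp only [h, ← h0]
    exact f_lt_iff α (nvar 0) _ _

theorem _root_.TwoSorted.DefP.exLt {P : (I → M.Dom .num) → M.Dom .num → Prop}
    {b : (I → M.Dom .num) → M.Dom .num} (hb : DefT M I b)
    (hP : DefP M (Option I) (fun ω => P (fun i => ω (some i)) (ω none))) :
    DefP M I (fun ω => ∃ z < b ω, P ω z) := by
  obtain ⟨f, hf, -, h⟩ := DefT.least hP hb
  simp only [← h]
  exact .lt hf hb

theorem _root_.TwoSorted.DefP.exLe {P : (I → M.Dom .num) → M.Dom .num → Prop}
    {b : (I → M.Dom .num) → M.Dom .num} (hb : DefT M I b)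
    (hP : DefP M (Option I) (fun ω => P (fun i => ω (some i)) (ω none))) :
    DefP M I (fun ω => ∃ z ≤ b ω, P ω z) := by
  simp only [le_iff_lt_add_one]
  exact .exLt (.add hb (.const _)) hP

theorem _root_.TwoSorted.SP.defP {P : (I → M.Dom .num) → Prop} (hP : SP M I P) : DefP M I P := by
  induction hP with
  | le hf hg => exact .le hf.defT hg.defT
  | eq hf hg => exact .eq hf.defT hg.defT
  | mem A hf => exact .mem hf.defT (.const A)
  | not _ h => exact h.not
  | and _ _ h h' => exact h.and h'
  | exLe hf _ h => exact .exLe hf.defT h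

end Definable

instance : V0 M where
  add_one_ne_zero x := by simpa using hM.models _ _ _ (.basic .B1) ![x] ![]
  add_one_inj x y := by simpa using hM.models _ _ _ (.basic .B2) ![x, y] ![]
  add_zero x := by simpa using hM.models _ _ _ (.basic .B3) ![x] ![]
  add_add_one x y := by simpa using hM.models _ _ _ (.basic .B4) ![x, y] ![]
  mul_zero x := by simpa using hM.models _ _ _ (.basic .B5) ![x] ![]
  mul_add_one x y := by simpa using hM.models _ _ _ (.basic .B6) ![x, y] ![]
  le_antisymm x y := by simpa using hM.models _ _ _ (.basic .B7) ![x, y] ![]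
  zero_le x := by simpa using hM.models _ _ _ (.basic .B8) ![x] ![]
  le_trans x y z := by simpa using hM.models _ _ _ (.basic .B9) ![x, y, z] ![]
  le_total x y := by simpa using hM.models _ _ _ (.basic .B10) ![x, y] ![]
  le_iff_lt_add_one := le_iff_lt_add_one
  exists_add_one x h := by
    have := hM.models _ _ _ .B12'' ![x] ![]
    simp only [holds_imp, holds_not, holds_eqN, eval_nvar, eval_add] at this
    exact ⟨_, this h⟩
  lt_len y X := by simpa using hM.models _ _ _ (.basic .L1) ![y] ![X]
  mem_of_len y X := by simpa using hM.models _ _ _ (.basic .L2) ![y] ![X]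
  ext X Y h h' := by
    have h1 := hM.models _ _ _ .fSE1 ![] ![X, Y]
    have h2 := hM.models _ _ _ .fSE2 ![] ![X, Y]
    have h3 := hM.models _ _ _ .SE'' ![] ![X, Y]
    simp only [holds_imp, holds_not, holds_lt, holds_le, holds_iff, holds_mem, holds_and, holds_eqN,
      holds_eqS, eval_len, eval_svar] at h1 h2 h3
    refine h3 ⟨h, by_contra fun hne => ?_⟩
    exact h2 ⟨h1, hne⟩ (h' _ ⟨h1, hne⟩)
  comp P hP ω a := by
    obtain ⟨F, -, hF⟩ := DefT.comp (P := fun ω z => P (ocons z ω)) (b := fun _ => a) (by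
      simpa only [ocons_eta] using hP.defP) (.const a)
    exact ⟨F ω, hF ω⟩

end TB

/-- Every `Σ₀ᴮ` formula is equivalent in `VTC⁰-bar` to an open one. -/
theorem Formula.IsSigma0B.exists_open {n m : ℕ} {φ : Formula LFTC0 true n m} (h : φ.IsSigma0B) :
    ∃ α : Formula LFTC0 false n m, ∀ (M : Struc LFTC0) [TB M] (x : Fin n → M.Dom .num)
      (X : Fin m → M.Dom .str), φ.Holds M x X ↔ α.Holds M x X := by
  induction h with
  | ofOpen α => exact ⟨α, fun M _ x X => by simp⟩
  | not _ ih =>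
    obtain ⟨α, h⟩ := ih
    exact ⟨.not α, fun M _ x X => by simp [h]⟩
  | and _ _ ih ih' =>
    obtain ⟨α, h⟩ := ih
    obtain ⟨β, h'⟩ := ih'
    exact ⟨.and α β, fun M _ x X => by simp [h, h']⟩
  | or _ _ ih ih' =>
    obtain ⟨α, h⟩ := ih
    obtain ⟨β, h'⟩ := ih'
    exact ⟨.or α β, fun M _ x X => by simp [h, h']⟩
  | allLe t _ ih =>
    obtain ⟨α, h⟩ := ih
    refine ⟨.not (.lt (fT (.not α) (.add t .one)) (Term.ofBase (.add t .one))), fun M _ x X => ?_⟩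
    rw [holds_not, holds_lt]
    refine .trans ?_ (not_congr (TB.f_lt_iff (.not α) (.add t .one) x X).symm)
    simp [Term.ofBase, h, ← TB.le_iff_lt_add_one]
  | exLe t _ ih =>
    obtain ⟨α, h⟩ := ih
    refine ⟨.lt (fT α (.add t .one)) (Term.ofBase (.add t .one)), fun M _ x X => ?_⟩
    rw [holds_lt]
    refine .trans ?_ (TB.f_lt_iff α (.add t .one) x X).symm
    simp [Term.ofBase, h, ← TB.le_iff_lt_add_one]
  | allLt t _ ih =>
    obtain ⟨α, h⟩ := ih
    refine ⟨.not (.lt (fT (.not α) t) (Term.ofBase t)), fun M _ x X => ?_⟩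
    rw [holds_not, holds_lt]
    refine .trans ?_ (not_congr (TB.f_lt_iff (.not α) t x X).symm)
    simp [h]
  | exLt t _ ih =>
    obtain ⟨α, h⟩ := ih
    refine ⟨.lt (fT α t) (Term.ofBase t), fun M _ x X => ?_⟩
    rw [holds_lt]
    refine .trans ?_ (TB.f_lt_iff α t x X).symm
    simp [h]


/-! ### The base reduct of a model of the universal theory -/

theorem holds_phiNumones (M : Struc L2A) (x : Fin 0 → M.Dom .num) (X Y : M.Dom .str) :
    phiNumones.Holds M x ![Y, X] ↔
      ((∀ z ≤ slen X, ∃ y ≤ slen X, pr z y ∈ Y ∧ ∀ y' ≤ slen X, pr z y' ∈ Y → y' = y) ∧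
        pr 0 0 ∈ Y) ∧ ∀ z < slen X, ∀ y ≤ slen X, pr z y ∈ Y →
          (z ∈ X → pr (z + 1) (y + 1) ∈ Y) ∧ (z ∉ X → pr (z + 1) y ∈ Y) := by
  simp only [phiNumones, holds_and, holds_allLe, holds_exLe, holds_mem, holds_imp, holds_eqN,
    holds_allLt, holds_not, eval_pair, eval_len, eval_add, eval_one, eval_zero, eval_nvar,
    eval_svar]
  rfl

namespace TB

variable {M : Struc LFTC0} [hM : TB M]

theorem induction {P : M.Dom .num → Prop} (hP : DefP M (Option Empty) fun v => P (v none))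
    (h0 : P 0) (hs : ∀ x, P x → P (x + 1)) (a : M.Dom .num) : P a := by
  obtain ⟨F, -, hF⟩ := DefT.comp (P := fun _ => P) (b := fun _ => a + 1) hP (.const _)
  have key := V0.induction (P := fun z => z ≤ a → z ∈ F Empty.elim)
    (.imp (.le (.var _) (.const _)) (.mem _ (.var _)))
    (fun h => (hF _ _).2 ⟨V0.lt_add_one_iff.2 h, h0⟩)
    (fun x ih h => (hF _ _).2 ⟨V0.lt_add_one_iff.2 h, hs _ ((hF _ _).1
      (ih ((V0.lt_add_one x).le.trans h))).2⟩) a le_rfl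
  exact ((hF _ _).1 key).2

/-- The number of elements of `X` below `x`. -/
def nm (x : M.Dom .num) (X : M.Dom .str) : M.Dom .num := M.fn .numones ![x] ![X]

omit hM in
theorem eval_numonesT {n m : ℕ} (x : Fin n → M.Dom .num) (X : Fin m → M.Dom .str)
    (s : Term LFTC0 .num n m) (T : Term LFTC0 .str n m) :
    (numonesT s T).eval M x X = nm (s.eval M x X) (T.eval M x X) := by
  simp only [numonesT, eval_app, nm]
  congr 1 <;> funext i <;> rw [Fin.eq_zero i] <;> rfl

omit hM in
theorem defT_nm {I : Type} {f : (I → M.Dom .num) → M.Dom .num} (hf : DefT M I f)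
    (X : M.Dom .str) : DefT M I (fun ω => nm (f ω) X) := by
  have := DefT.eval (M := M) (n := 1) (m := 1) (u := ![f]) (U := ![fun _ => X])
    (numonesT (nvar 0) (svar 0)) (by simp [hf]) (by simp [DefT.const X])
  simp only [eval_numonesT, eval_nvar, eval_svar] at this
  exact this

theorem nm_zero (X : M.Dom .str) : nm 0 X = 0 := by
  simpa [eval_numonesT] using hM.models _ _ _ .numones1 ![] ![X]

theorem nm_add_one_of_mem {z : M.Dom .num} {X : M.Dom .str} (h : z ∈ X) :
    nm (z + 1) X = nm z X + 1 := by
  simpa [eval_numonesT, h] using hM.models _ _ _ .numones2 ![z] ![X]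

theorem nm_add_one_of_notMem {z : M.Dom .num} {X : M.Dom .str} (h : z ∉ X) :
    nm (z + 1) X = nm z X := by
  simpa [eval_numonesT, h] using hM.models _ _ _ .numones3 ![z] ![X]

theorem nm_le (x : M.Dom .num) (X : M.Dom .str) : nm x X ≤ x := by
  refine induction (P := fun x => nm x X ≤ x) (.le (defT_nm (.var _) X) (.var _)) (nm_zero X).le
    (fun x h => ?_) x
  by_cases hx : x ∈ X
  · rw [nm_add_one_of_mem hx]; gcongr
  · rw [nm_add_one_of_notMem hx]; exact h.trans (V0.lt_add_one _).le

theorem exists_numones (X : M.Dom .str) : ∃ Y : M.Dom .str,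
    ((∀ z ≤ slen X, ∃ y ≤ slen X, pr z y ∈ Y ∧ ∀ y' ≤ slen X, pr z y' ∈ Y → y' = y) ∧
        pr 0 0 ∈ Y) ∧ ∀ z < slen X, ∀ y ≤ slen X, pr z y ∈ Y →
          (z ∈ X → pr (z + 1) (y + 1) ∈ Y) ∧ (z ∉ X → pr (z + 1) y ∈ Y) := by
  obtain ⟨F, -, hF⟩ := DefT.comp (M := M) (I := Empty)
    (P := fun _ u => ∃ z ≤ slen X, u = pr z (nm z X)) (b := fun _ => pr (slen X) (slen X) + 1)
    (.exLe (.const _) (.eq (.var _) (.pr (.var _) (defT_nm (.var _) X)))) (.const _)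
  have key : ∀ z y, pr z y ∈ F Empty.elim ↔ z ≤ slen X ∧ y = nm z X := by
    intro z y
    rw [hF]
    constructor
    · rintro ⟨-, z', hz', e⟩
      obtain ⟨rfl, rfl⟩ := pr_inj.1 e
      exact ⟨hz', rfl⟩
    · rintro ⟨hz, rfl⟩
      exact ⟨V0.lt_add_one_iff.2 (pr_le_pr hz ((nm_le _ _).trans hz)), z, hz, rfl⟩
  refine ⟨F Empty.elim, ⟨fun z hz => ⟨nm z X, (nm_le _ _).trans hz, (key _ _).2 ⟨hz, rfl⟩,
    fun y' _ h => ((key _ _).1 h).2⟩, (key _ _).2 ⟨zero_le, (nm_zero X).symm⟩⟩,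
    fun z hz y _ h => ?_⟩
  obtain ⟨-, rfl⟩ := (key _ _).1 h
  have hz' := V0.add_one_le_iff.2 hz
  exact ⟨fun h => (key _ _).2 ⟨hz', (nm_add_one_of_mem h).symm⟩,
    fun h => (key _ _).2 ⟨hz', (nm_add_one_of_notMem h).symm⟩⟩

theorem models_reduct {n m : ℕ} {φ : Formula L2A true n m} (h : VTC0 n m φ) :
    M.reduct.Models φ := by
  intro x X
  cases h with
  | basic h =>
    refine (holds_reduct M _ x X).2 (hM.models _ _ _ (.basic ?_) x X)
    cases h
    · exact .B1
    · exact .B2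
    · exact .B3
    · exact .B4
    · exact .B5
    · exact .B6
    · exact .B7
    · exact .B8
    · exact .B9
    · exact .B10
    · exact .B11
    · exact .L1
    · exact .L2
  | B12 =>
    simp only [holds_imp, holds_not, holds_exLt, holds_eqN, eval_nvar, eval_add]
    intro h
    obtain ⟨y, hy⟩ := V0.exists_add_one (M := M) (x 0) h
    exact ⟨y, (V0.lt_add_one y).trans_eq hy, hy⟩
  | SE =>
    simp only [holds_iff, holds_and, holds_eqS, holds_eqN, holds_allLt, holds_mem, eval_len,
      eval_svar]
    constructor
    · intro h
      rw [h]
      exact ⟨rfl, fun z _ => Iff.rfl⟩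
    · exact fun h => V0.ext (M := M) _ _ h.1 h.2
  | comp a φ hφ =>
    obtain ⟨α, hα⟩ := (hφ.ofBase (L := LFTC0)).exists_open
    simp only [holds_exSLe, holds_allLt, holds_iff, holds_mem, eval_nvar, eval_svar, holds_wkS]
    have key := mem_F (M := M) α (nvar a) x X
    refine ⟨M.fn (.F α (nvar a)) x X, V0.slen_le (M := M) fun z hz => ((key z).1 hz).1,
      fun z hz => ?_⟩
    refine (key z).trans ((and_iff_right hz).trans ?_)
    exact (hα M _ _).symm.trans (holds_reduct M φ (Fin.cons z x) X).symm
  | numones =>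
    intro A
    obtain ⟨Y, hY⟩ := exists_numones A
    refine ⟨Y, ?_⟩
    have := (holds_phiNumones M.reduct x A Y).2 hY
    convert this using 1
    funext i
    fin_cases i <;> rfl

end TB


/-! ### Rows of two-dimensional arrays -/

/-- The open formula `V(⟨z, y⟩)`, with `y` the number variable `0` and `z` the number variable
`1`. -/
def rowFormula : Formula LFTC0 false 2 1 := .mem (pair (nvar 1) (nvar 0)) (svar 0)

/-- The term for the row `{y | V(⟨z, y⟩)}` of the array `V` with index `z`. -/
def rowT {n m : ℕ} (s : Term LFTC0 .num n m) (T : Term LFTC0 .str n m) : Term LFTC0 .str n m :=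
  .app (.F rowFormula (len (svar 0))) ![s] ![T]

section Row

variable {M : Struc LFTC0}

/-- The row of the array `V` with index `z`. -/
def row (z : M.Dom .num) (V : M.Dom .str) : M.Dom .str :=
  M.fn (.F rowFormula (len (svar 0))) ![z] ![V]

@[simp] theorem eval_rowT {n m : ℕ} (x : Fin n → M.Dom .num) (X : Fin m → M.Dom .str)
    (s : Term LFTC0 .num n m) (T : Term LFTC0 .str n m) :
    (rowT s T).eval M x X = row (s.eval M x X) (T.eval M x X) := by
  simp only [rowT, eval_app, row]
  congr 1 <;> funext i <;> rw [Fin.eq_zero i] <;> rfl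

theorem mem_row [TB M] {y z : M.Dom .num} {V : M.Dom .str} : y ∈ row z V ↔ pr z y ∈ V := by
  refine (TB.mem_F _ _ _ _ _).trans ⟨fun h => h.2, fun h => ⟨?_, h⟩⟩
  exact (right_le_pr z y).trans_lt (V0.lt_len _ _ h)

theorem DefT.row {I : Type} {f : (I → M.Dom .num) → M.Dom .num}
    {F : (I → M.Dom .num) → M.Dom .str} (hf : DefT M I f) (hF : DefT M I F) :
    DefT M I (fun ω => row (f ω) (F ω)) := by
  have := DefT.eval (M := M) (n := 1) (m := 1) (u := ![f]) (U := ![F])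
    (rowT (nvar 0) (svar 0)) (by simp [hf]) (by simp [hF])
  simp only [eval_rowT, eval_nvar, eval_svar] at this
  exact this

theorem DefT.ite [TB M] {I : Type} {P : (I → M.Dom .num) → Prop} [DecidablePred P]
    {F G : (I → M.Dom .num) → M.Dom .str} (hP : DefP M I P) (hF : DefT M I F) (hG : DefT M I G) :
    DefT M I (fun ω => if P ω then F ω else G ω) := by
  obtain ⟨H, hH, h⟩ := DefT.comp (P := fun ω y => (P ω ∧ y ∈ F ω) ∨ (¬ P ω ∧ y ∈ G ω))
    (b := fun ω => slen (F ω) + slen (G ω))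
    (((hP.subst fun i => .var (some i)).and
      (.mem (.var _) (hF.subst fun i => .var (some i)))).or
      ((hP.subst fun i => .var (some i)).not.and
      (.mem (.var _) (hG.subst fun i => .var (some i))))) (.add hF.len hG.len)
  convert hH with ω
  refine V0.str_ext fun z => ?_
  rw [h]
  by_cases hω : P ω
  · simp only [hω, if_true, true_and, not_true, false_and, or_false]
    exact ⟨fun hz => ⟨(V0.lt_len _ _ hz).trans_le le_self_add, hz⟩, fun hz => hz.2⟩
  · simp only [hω, if_false, true_and, not_false_eq_true, false_and, false_or]
    exact ⟨fun hz => ⟨(V0.lt_len _ _ hz).trans_le le_add_self, hz⟩, fun hz => hz.2⟩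

end Row

/-! ### A generic extension satisfying replacement -/

/-- Names for the generic numbers to be adjoined to a structure with domains `D` and `S`.  The
number `mk n cs b c Θ` is meant to be a `z < b` such that no string `W` satisfies `Θ z W`, where
`b` and `Θ` depend on the previously adjoined numbers `cs`. -/
inductive GName (D S : Type) : Type
  | mk (n : ℕ) (cs : Fin n → GName D S) (b c : (Fin n → D) → D)
      (Θ : (Fin n → D) → D → S → Prop) : GName D S

namespace GName

variable {D S : Type}

/-- The depth of a name. -/
def rank : GName D S → ℕ
  | mk _ cs _ _ _ => (Finset.univ.sup fun i => (cs i).rank) + 1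

/-- A well-ordering in which a name comes after those that occur in it. -/
noncomputable instance : LinearOrder (GName D S) :=
  haveI : IsStrictTotalOrder (GName D S)
      (fun p q => Prod.Lex (· < ·) WellOrderingRel (p.rank, p) (q.rank, q)) :=
    { trichotomous := fun p q h h' => by
        simp only [Prod.lex_def] at h h'
        push Not at h h'
        have e : p.rank = q.rank := le_antisymm h'.1 h.1
        exact (trichotomous_of WellOrderingRel p q).elim (fun k => absurd k (h.2 e))
          (Or.elim · id fun k => absurd k (h'.2 e.symm))
      irrefl := fun p => irrefl_of (Prod.Lex (· < ·) WellOrderingRel) _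
      trans := fun p q r => trans_of (Prod.Lex (· < ·) WellOrderingRel) }
  haveI := Classical.decRel (fun p q : GName D S =>
    Prod.Lex (· < ·) WellOrderingRel (p.rank, p) (q.rank, q))
  linearOrderOfSTO (fun p q => Prod.Lex (· < ·) WellOrderingRel (p.rank, p) (q.rank, q))

theorem lt_def {p q : GName D S} :
    p < q ↔ Prod.Lex (· < ·) WellOrderingRel (p.rank, p) (q.rank, q) := Iff.rfl

theorem wf : WellFounded ((· < ·) : GName D S → GName D S → Prop) :=
  InvImage.wf (fun p : GName D S => (p.rank, p))
    (WellFounded.prod_lex wellFounded_lt WellOrderingRel.isWellOrder.wf)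

/-- The number of names occurring in a name. -/
def arity : GName D S → ℕ
  | mk n _ _ _ _ => n

/-- The names occurring in a name. -/
def cs : (p : GName D S) → Fin p.arity → GName D S
  | mk _ cs _ _ _ => cs

/-- The upper bound for the number with the given name. -/
def b : (p : GName D S) → (Fin p.arity → D) → D
  | mk _ _ b _ _ => b

/-- The upper bound for the lengths of the strings considered. -/
def c : (p : GName D S) → (Fin p.arity → D) → D
  | mk _ _ _ c _ => c

/-- The relation to be avoided. -/
def Θ : (p : GName D S) → (Fin p.arity → D) → D → S → Prop
  | mk _ _ _ _ Θ => Θ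

theorem cs_lt (p : GName D S) (i : Fin p.arity) : p.cs i < p := by
  cases p
  exact lt_def.2 (.left _ _ (Nat.lt_succ_of_le
    (Finset.le_sup (f := fun i => (cs _ i).rank) (Finset.mem_univ i))))

end GName

section Generic

variable (M : Struc LFTC0)

/-- Names for generic numbers over `M`. -/
abbrev Name := GName (M.Dom .num) (M.Dom .str)

/-- Assignments of numbers to the names. -/
abbrev Val := Name M → M.Dom .num

variable {M}

/-- The assignment `ω` is as intended for the name `p`, as far as the string `W` is concerned. -/
def Good (p : Name M) (W : Val M → M.Dom .str) (ω : Val M) : Prop :=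
  ω p < p.b (fun i => ω (p.cs i)) ∧ ¬ p.Θ (fun i => ω (p.cs i)) (ω p) (W ω)

/-- The data of a name are definable. -/
structure Valid (p : Name M) : Prop where
  b : DefT M _ p.b
  c : DefT M _ p.c
  Θ {I : Type} {v : Fin p.arity → (I → M.Dom .num) → M.Dom .num}
    {u : (I → M.Dom .num) → M.Dom .num} {W : (I → M.Dom .num) → M.Dom .str} :
    (∀ i, DefT M I (v i)) → DefT M I u → DefT M I W →
      DefP M I (fun ω => p.Θ (fun i => v i ω) (u ω) (W ω))
  bound {v : Fin p.arity → M.Dom .num} {z : M.Dom .num} {W : M.Dom .str} :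
    p.Θ v z W → slen W ≤ p.c v

/-- The name can be realised generically, given the choices made for the preceding names. -/
def Realized : Name M → Prop :=
  GName.wf.fix fun p R => Valid p ∧ ∀ (s : Finset (Name M)) (_ : ∀ q ∈ s, ∃ h : q < p, R q h)
    (W : Name M → Val M → M.Dom .str) (_ : ∀ q, DefT M (Name M) (W q)),
    ∃ ω, Good p (W p) ω ∧ ∀ q ∈ s, Good q (W q) ω

theorem realized_iff (p : Name M) : Realized p ↔ Valid p ∧ ∀ (s : Finset (Name M))
    (_ : ∀ q ∈ s, q < p ∧ Realized q) (W : Name M → Val M → M.Dom .str)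
    (_ : ∀ q, DefT M (Name M) (W q)), ∃ ω, Good p (W p) ω ∧ ∀ q ∈ s, Good q (W q) ω := by
  rw [Realized, WellFounded.fix_eq]
  simp only [exists_prop]

theorem exists_good {s : Finset (Name M)} (hs : ∀ q ∈ s, Realized q)
    {W : Name M → Val M → M.Dom .str} (hW : ∀ q, DefT M (Name M) (W q)) :
    ∃ ω, ∀ q ∈ s, Good q (W q) ω := by
  rcases s.eq_empty_or_nonempty with rfl | h
  · exact ⟨fun _ => 0, by simp⟩
  · have hp := Finset.max'_mem s h
    obtain ⟨ω, h1, h2⟩ := ((realized_iff _).1 (hs _ hp)).2 (s.erase (s.max' h))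
      (fun q hq => ⟨Finset.lt_max'_of_mem_erase_max' _ _ hq, hs _ (Finset.mem_of_mem_erase hq)⟩)
      W hW
    refine ⟨ω, fun q hq => ?_⟩
    rcases eq_or_ne q (s.max' h) with e | e
    · rw [e]; exact h1
    · exact h2 q (Finset.mem_erase.2 ⟨e, hq⟩)

variable [TB M]

open Classical in
theorem exists_good_simultaneous (T : Finset (Name M × (Val M → M.Dom .str)))
    (hT : ∀ x ∈ T, Valid x.1 ∧ DefT M (Name M) x.2) :
    ∃ W : Name M → Val M → M.Dom .str, (∀ q, DefT M (Name M) (W q)) ∧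
      ∀ ω, (∀ q ∈ T.image Prod.fst, Good q (W q) ω) → ∀ x ∈ T, Good x.1 x.2 ω := by
  induction T using Finset.induction_on with
  | empty => exact ⟨fun _ _ => M.nonemptyStr.some, fun _ => .const _, by simp⟩
  | insert x T _ ih =>
    obtain ⟨W, hW, h⟩ := ih fun y hy => hT y (Finset.mem_insert_of_mem hy)
    obtain ⟨hv, hx⟩ := hT x (Finset.mem_insert_self _ _)
    let P : Val M → Prop := fun ω => x.1.Θ (fun i => ω (x.1.cs i)) (ω x.1) (x.2 ω)
    refine ⟨Function.update W x.1 fun ω => if P ω then x.2 ω else W x.1 ω, fun q => ?_,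
      fun ω hω => ?_⟩
    · rcases eq_or_ne q x.1 with rfl | e
      · rw [Function.update_self]
        exact .ite (hv.Θ (fun i => .var _) (.var _) hx) hx (hW _)
      · rw [Function.update_of_ne e]
        exact hW q
    · have h1 := hω x.1 (by simp)
      rw [Function.update_self] at h1
      have h2 : ¬ P ω := fun hP => h1.2 (by
        simp only [if_pos hP]; exact hP)
      have h3 : Good x.1 (W x.1) ω := by simpa [Good, h2] using h1
      have h4 : ∀ q ∈ T.image Prod.fst, Good q (W q) ω := fun q hq => by
        rcases eq_or_ne q x.1 with rfl | e
        · exact h3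
        · have := hω q (by simp only [Finset.image_insert]; exact Finset.mem_insert_of_mem hq)
          rwa [Function.update_of_ne e] at this
      intro y hy
      rcases Finset.mem_insert.1 hy with rfl | hy
      · exact ⟨h1.1, h2⟩
      · exact h ω h4 y hy

theorem exists_ultrafilter (M : Struc LFTC0) [TB M] : ∃ U : Ultrafilter (Val M), ∀ p : Name M,
    Realized p → ∀ W, DefT M (Name M) W → ∀ᶠ ω in U, Good p W ω := by
  classical
  obtain ⟨U, hU⟩ := Ultrafilter.exists_ultrafilter_of_finite_inter_nonempty
    {A : Set (Val M) | ∃ x : Name M × (Val M → M.Dom .str),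
      (Realized x.1 ∧ DefT M (Name M) x.2) ∧ {ω | Good x.1 x.2 ω} = A} (by
    intro T hT
    obtain ⟨T', hT', rfl⟩ := Finset.subset_set_image_iff.1
      (show (T : Set (Set (Val M))) ⊆ (fun x => {ω | Good x.1 x.2 ω}) ''
        {x : Name M × (Val M → M.Dom .str) | Realized x.1 ∧ DefT M (Name M) x.2} from hT)
    obtain ⟨W, hW, h⟩ := exists_good_simultaneous T'
      fun x hx => ⟨((realized_iff _).1 (hT' hx).1).1, (hT' hx).2⟩
    obtain ⟨ω, hω⟩ := exists_good (s := T'.image Prod.fst) (by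
      simp only [Finset.mem_image]
      rintro q ⟨x, hx, rfl⟩
      exact (hT' hx).1) hW
    refine ⟨ω, ?_⟩
    simp only [Set.mem_sInter, Finset.coe_image, Set.forall_mem_image]
    exact fun x hx => h ω hω x hx)
  exact ⟨U, fun p hp W hW => hU ⟨(p, W), ⟨hp, hW⟩, rfl⟩⟩

/-- A relation that is not made to fail generically has its witnesses collected in an array. -/
theorem exists_array_of_not_realized {U : Ultrafilter (Val M)} (hU : ∀ p : Name M,
    Realized p → ∀ W, DefT M (Name M) W → ∀ᶠ ω in U, Good p W ω) {p : Name M} (hv : Valid p)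
    (hp : ¬ Realized p) : ∃ V : Val M → M.Dom .str, DefT M (Name M) V ∧
      (∀ ω, slen (V ω) ≤ pr (p.b fun i => ω (p.cs i)) (p.c fun i => ω (p.cs i))) ∧
      ∀ᶠ ω in U, ∀ z < p.b (fun i => ω (p.cs i)),
        p.Θ (fun i => ω (p.cs i)) z (row z (V ω)) := by
  classical
  rw [realized_iff] at hp
  push Not at hp
  obtain ⟨s, hs, W, hW, h⟩ := hp hv
  let upd : Val M → M.Dom .num → Val M := fun ω z => Function.update ω p z
  have hupd : ∀ {G : Val M → M.Dom .str}, DefT M _ G →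
      DefT M (Option (Name M)) (fun ω => G (upd (fun i => ω (some i)) (ω none))) := by
    intro G hG
    refine hG.subst (u := fun i ω => upd (fun i => ω (some i)) (ω none) i) fun i => ?_
    simp only [upd]
    rcases eq_or_ne i p with rfl | e
    · simp only [Function.update_self]; exact .var _
    · simp only [Function.update_of_ne e]; exact .var _
  have hupdcs : ∀ q ≤ p, ∀ ω z, (fun i => upd ω z (q.cs i)) = fun i => ω (q.cs i) :=
    fun q hq ω z => funext fun i => Function.update_of_ne ((q.cs_lt i).trans_le hq).ne _ _
  have hb : DefT M (Name M) (fun ω => p.b fun i => ω (p.cs i)) := hv.b.subst fun i => .var _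
  have hc : DefT M (Name M) (fun ω => p.c fun i => ω (p.cs i)) := hv.c.subst fun i => .var _
  have key : ∀ᶠ ω in U, ∀ q ∈ s, ∀ z < p.b (fun i => ω (p.cs i)), Good q (W q) (upd ω z) := by
    rw [Filter.eventually_all_finset]
    intro q hq
    obtain ⟨hqp, hqr⟩ := hs q hq
    have hqv := ((realized_iff _).1 hqr).1
    obtain ⟨f, hf, hf1, hf2⟩ := DefT.least
      (P := fun ω z => q.Θ (fun i => ω (q.cs i)) (ω q) (W q (upd ω z)))
      (hqv.Θ (fun i => .var _) (.var _) (hupd (hW q))) hb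
    filter_upwards [hU q hqr (fun ω => W q (upd ω (f ω))) ((hupd (hW q)).subst
      (u := fun o ω => ocons (f ω) ω o) fun o => by
        cases o with
        | none => exact hf
        | some i => exact .var i)] with ω hω z hz
    refine ⟨?_, ?_⟩
    · rw [hupdcs q hqp.le]
      simpa only [upd, Function.update_of_ne hqp.ne] using hω.1
    · rw [hupdcs q hqp.le]
      simp only [upd, Function.update_of_ne hqp.ne]
      exact fun hΘ => hω.2 (hf1 ω ((hf2 ω).2 ⟨z, hz, hΘ⟩))
  obtain ⟨V, hV, h'⟩ := DefT.comp
    (P := fun ω x => ∃ z ≤ x, ∃ y < p.c (fun i => ω (p.cs i)),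
      z < p.b (fun i => ω (p.cs i)) ∧ x = pr z y ∧ y ∈ W p (upd ω z))
    (b := fun ω => pr (p.b fun i => ω (p.cs i)) (p.c fun i => ω (p.cs i)))
    (.exLe (.var _) (.exLt (hv.c.subst fun i => .var _)
      ((DefP.lt (.var _) (hv.b.subst fun i => .var _)).and
      ((DefP.eq (.var _) (.pr (.var _) (.var _))).and
      (.mem (.var _) ((hupd (hW p)).subst
        (u := fun o ω => ocons (ω (some none)) (fun i => ω (some (some (some i)))) o) fun o => by
        cases o with
        | none => exact .var _
        | some i => exact .var _)))))) (.pr hb hc)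
  refine ⟨V, hV, fun ω => V0.slen_le fun z hz => ((h' _ _).1 hz).1, ?_⟩
  filter_upwards [key] with ω hω z hz
  have hΘ : p.Θ (fun i => ω (p.cs i)) z (W p (upd ω z)) := by
    by_contra hne
    obtain ⟨q, hq, hq'⟩ := h (upd ω z) ⟨by
      rw [hupdcs p le_rfl]
      simpa [upd] using hz, by
      rw [hupdcs p le_rfl]
      simpa [upd] using hne⟩
    exact hq' (hω q hq z hz)
  convert hΘ
  refine V0.str_ext fun y => ?_
  rw [mem_row, h']
  constructor
  · rintro ⟨-, z', -, y', -, -, e, hy'⟩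
    obtain ⟨rfl, rfl⟩ := pr_inj.1 e
    exact hy'
  · intro hy
    have hyc := (V0.lt_len _ _ hy).trans_le (hv.bound hΘ)
    exact ⟨pr_lt_pr hz.le hyc, z, left_le_pr _ _, y, hyc, hz, rfl, hy⟩

end Generic


section GenericModel

variable {M : Struc LFTC0} (U : Ultrafilter (Val M))

/-- Definable families of elements of a model. -/
abbrev Fam (M : Struc LFTC0) (s : Srt) : Type :=
  {f : Val M → M.Dom s // DefT M (Name M) f}

/-- Equality almost everywhere. -/
def famSetoid (s : Srt) : Setoid (Fam M s) where
  r f g := ∀ᶠ ω in U, f.1 ω = g.1 ω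
  iseqv := ⟨fun _ => .of_forall fun _ => rfl, fun h => h.mono fun _ => Eq.symm,
    fun h h' => (h.and h').mono fun _ k => k.1.trans k.2⟩

/-- The value of a term at families. -/
def Fam.eval {n m : ℕ} {s : Srt} (t : Term LFTC0 s n m) (x : Fin n → Fam M .num)
    (X : Fin m → Fam M .str) : Fam M s :=
  ⟨fun ω => t.eval M (fun i => (x i).1 ω) (fun j => (X j).1 ω),
    DefT.eval t (fun i => (x i).2) (fun j => (X j).2)⟩

/-- The structure of definable families, modulo equality almost everywhere. -/
noncomputable def generic : Struc LFTC0 where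
  Dom s := Quotient (famSetoid (M := M) U s)
  nonemptyStr := ⟨Quotient.mk _ ⟨fun _ => M.nonemptyStr.some, .const _⟩⟩
  zero := Quotient.mk _ (Fam.eval .zero ![] ![])
  one := Quotient.mk _ (Fam.eval .one ![] ![])
  add a b := Quotient.mk _ (Fam.eval (.add (nvar 0) (nvar 1)) ![a.out, b.out] ![])
  mul a b := Quotient.mk _ (Fam.eval (.mul (nvar 0) (nvar 1)) ![a.out, b.out] ![])
  len A := Quotient.mk _ (Fam.eval (.len (svar 0)) ![] ![A.out])
  le a b := ∀ᶠ ω in U, a.out.1 ω ≤ b.out.1 ω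
  mem a A := ∀ᶠ ω in U, a.out.1 ω ∈ A.out.1 ω
  fn f ts Ts := Quotient.mk _ (Fam.eval (.app f nvar svar) (fun i => (ts i).out)
    fun j => (Ts j).out)

/-- The element of the generic structure given by a family. -/
def Fam.mk {s : Srt} (f : Fam M s) : (generic U).Dom s := Quotient.mk (famSetoid U s) f

theorem Fam.mk_eq {s : Srt} {f g : Fam M s} : f.mk U = g.mk U ↔ ∀ᶠ ω in U, f.1 ω = g.1 ω :=
  Quotient.eq (r := famSetoid U s)

theorem Fam.exists_mk {s : Srt} (a : (generic U).Dom s) : ∃ f : Fam M s, f.mk U = a :=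
  Quotient.exists_rep (s := famSetoid U s) a

/-- A representative. -/
noncomputable def Fam.rep {s : Srt} (a : (generic U).Dom s) : Fam M s :=
  Quotient.out (s := famSetoid U s) a

theorem Fam.rep_mk {s : Srt} (f : Fam M s) :
    ∀ᶠ ω in U, (Fam.rep U (f.mk U)).1 ω = f.1 ω :=
  Quotient.mk_out (s := famSetoid U s) f

theorem eval_generic {n m : ℕ} {s : Srt} (t : Term LFTC0 s n m) (x : Fin n → Fam M .num)
    (X : Fin m → Fam M .str) :
    t.eval (generic U) (fun i => (x i).mk U) (fun j => (X j).mk U) = (Fam.eval t x X).mk U := by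
  induction t with
  | nvar | svar => rfl
  | zero | one => rfl
  | add s t ih ih' =>
    refine (congrArg₂ (generic U).add (ih x X) (ih' x X)).trans ((Fam.mk_eq U).2 ?_)
    filter_upwards [Fam.rep_mk U (Fam.eval s x X), Fam.rep_mk U (Fam.eval t x X)] with ω h h'
    exact congrArg₂ M.add h h'
  | mul s t ih ih' =>
    refine (congrArg₂ (generic U).mul (ih x X) (ih' x X)).trans ((Fam.mk_eq U).2 ?_)
    filter_upwards [Fam.rep_mk U (Fam.eval s x X), Fam.rep_mk U (Fam.eval t x X)] with ω h h'
    exact congrArg₂ M.mul h h'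
  | len T ih =>
    refine (congrArg (generic U).len (ih x X)).trans ((Fam.mk_eq U).2 ?_)
    filter_upwards [Fam.rep_mk U (Fam.eval T x X)] with ω h
    exact congrArg M.len h
  | app f ts Ts ih ih' =>
    refine (congrArg₂ ((generic U).fn f) (funext fun i => ih i x X)
      (funext fun i => ih' i x X)).trans ((Fam.mk_eq U).2 ?_)
    filter_upwards [Filter.eventually_all.2 fun i => Fam.rep_mk U (Fam.eval (ts i) x X),
      Filter.eventually_all.2 fun i => Fam.rep_mk U (Fam.eval (Ts i) x X)] with ω h h'
    exact congrArg₂ (M.fn f) (funext h) (funext h')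

theorem holds_generic {q : Bool} {n m : ℕ} {φ : Formula LFTC0 q n m} (ho : φ.IsQF)
    (x : Fin n → Fam M .num) (X : Fin m → Fam M .str) :
    φ.Holds (generic U) (fun i => (x i).mk U) (fun j => (X j).mk U) ↔
      ∀ᶠ ω in U, φ.Holds M (fun i => (x i).1 ω) (fun j => (X j).1 ω) := by
  induction φ with
  | top => simp
  | bot => simp [Filter.NeBot.ne]
  | eqN s t | eqS s t =>
    simp only [Holds, eval_generic]
    exact Fam.mk_eq U
  | le s t =>
    simp only [Holds, eval_generic]
    refine Filter.eventually_congr ?_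
    filter_upwards [Fam.rep_mk U (Fam.eval s x X), Fam.rep_mk U (Fam.eval t x X)] with ω h h'
    exact iff_of_eq (congrArg₂ M.le h h')
  | mem s t =>
    simp only [Holds, eval_generic]
    refine Filter.eventually_congr ?_
    filter_upwards [Fam.rep_mk U (Fam.eval s x X), Fam.rep_mk U (Fam.eval t x X)] with ω h h'
    exact iff_of_eq (congrArg₂ M.mem h h')
  | not φ ih => exact (not_congr (ih ho x X)).trans Ultrafilter.eventually_not.symm
  | and φ ψ ih ih' =>
    exact (and_congr (ih ho.1 x X) (ih' ho.2 x X)).trans Filter.eventually_and.symm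
  | or φ ψ ih ih' =>
    exact (or_congr (ih ho.1 x X) (ih' ho.2 x X)).trans Ultrafilter.eventually_or.symm
  | _ => exact ho.elim

end GenericModel

theorem VTC0bar.isQF {n m : ℕ} {φ : Formula LFTC0 true n m} (h : VTC0bar n m φ) : φ.IsQF := by
  cases h with
  | basic h => cases h <;> simp only [IsQF, imp, iff, lt, and_self]
  | deff2 α t => exact ⟨⟨trivial, trivial⟩, (isQF_forget α).subst _ _⟩
  | defF α t | deff3 α t => simp only [IsQF, imp, iff, lt, and_self, isQF_forget]
  | _ => simp only [IsQF, imp, iff, lt, and_self]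

section GenericModel

variable {M : Struc LFTC0} [TB M] (U : Ultrafilter (Val M))

instance : TB (generic U) where
  models n m φ h x X := by
    choose x' hx using fun i => Fam.exists_mk U (x i)
    choose X' hX using fun i => Fam.exists_mk U (X i)
    obtain rfl : (fun i => (x' i).mk U) = x := funext hx
    obtain rfl : (fun i => (X' i).mk U) = X := funext hX
    exact (holds_generic U h.isQF x' X').2 (.of_forall fun ω => TB.models n m φ h _ _)

end GenericModel

/-- Replacement for open formulas: witnesses for all `z < b` can be collected in an array. -/
def Replacement (N : Struc LFTC0) : Prop :=
  ∀ (n m : ℕ) (θ : Formula LFTC0 false (n + 1) (m + 1)) (x : Fin n → N.Dom .num)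
    (X : Fin m → N.Dom .str) (b c : N.Dom .num),
    (∀ z < b, ∃ W, slen W ≤ c ∧ θ.Holds N (Fin.cons z x) (Fin.cons W X)) →
    ∃ V, slen V ≤ pr b c ∧ ∀ z < b, θ.Holds N (Fin.cons z x) (Fin.cons (row z V) X)

section GenericModel

variable {M : Struc LFTC0} (U : Ultrafilter (Val M))

theorem comp_finCons {α β : Type*} {n : ℕ} (g : α → β) (a : α) (f : Fin n → α) :
    (fun i => g ((Fin.cons a f : Fin (n + 1) → α) i)) = Fin.cons (g a) (fun i => g (f i)) := by
  funext i
  refine Fin.cases rfl (fun i => rfl) i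

theorem holds_generic_cons {n m : ℕ} {θ : Formula LFTC0 false (n + 1) (m + 1)} (ho : θ.IsQF)
    (z : Fam M .num) (W : Fam M .str) (x : Fin n → Fam M .num) (X : Fin m → Fam M .str) :
    θ.Holds (generic U) (Fin.cons (z.mk U) fun i => (x i).mk U)
        (Fin.cons (W.mk U) fun j => (X j).mk U) ↔
      ∀ᶠ ω in U, θ.Holds M (Fin.cons (z.1 ω) fun i => (x i).1 ω)
        (Fin.cons (W.1 ω) fun j => (X j).1 ω) := by
  have := holds_generic U ho (Fin.cons z x) (Fin.cons W X)
  rw [comp_finCons (Fam.mk U), comp_finCons (Fam.mk U)] at this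
  refine this.trans (iff_of_eq ?_)
  congr! 3 with ω
  · exact comp_finCons (fun u : Fam M .num => u.1 ω) z x
  · exact comp_finCons (fun u : Fam M .str => u.1 ω) W X

theorem mk_lt_mk {f g : Fam M .num} : f.mk U < g.mk U ↔ ∀ᶠ ω in U, f.1 ω < g.1 ω := by
  have := holds_generic U (φ := (.lt (nvar 0) (nvar 1) : Formula LFTC0 true 2 0))
    ⟨trivial, trivial⟩ ![f, g] ![]
  simpa using this

theorem slen_mk_le {F : Fam M .str} {g : Fam M .num} :
    slen (F.mk U) ≤ g.mk U ↔ ∀ᶠ ω in U, slen (F.1 ω) ≤ g.1 ω := by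
  have := holds_generic U (φ := (.le (len (svar 0)) (nvar 0) : Formula LFTC0 true 1 1))
    trivial ![g] ![F]
  simpa using this

theorem row_mk {f : Fam M .num} {F : Fam M .str} :
    row (f.mk U) (F.mk U) = Fam.mk U ⟨fun ω => row (f.1 ω) (F.1 ω), .row f.2 F.2⟩ := by
  have := eval_generic U (rowT (nvar 0) (svar 0)) ![f] ![F]
  simp only [eval_rowT] at this
  refine this.trans ((Fam.mk_eq U).2 (.of_forall fun ω => ?_))
  simp [Fam.eval]

theorem pr_mk {f g : Fam M .num} :
    pr (f.mk U) (g.mk U) = Fam.mk U ⟨fun ω => pr (f.1 ω) (g.1 ω), .pr f.2 g.2⟩ :=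
  (eval_generic U (pair (nvar 0) (nvar 1)) ![f, g] ![] :)

theorem replacement_generic [TB M] {U : Ultrafilter (Val M)} (hU : ∀ p : Name M,
    Realized p → ∀ W, DefT M (Name M) W → ∀ᶠ ω in U, Good p W ω) : Replacement (generic U) := by
  intro n m θ x X b c h
  choose x' hx using fun i => Fam.exists_mk U (x i)
  choose X' hX using fun i => Fam.exists_mk U (X i)
  obtain rfl : (fun i => (x' i).mk U) = x := funext hx
  obtain rfl : (fun i => (X' i).mk U) = X := funext hX
  obtain ⟨b, rfl⟩ := Fam.exists_mk U b
  obtain ⟨c, rfl⟩ := Fam.exists_mk U c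
  obtain ⟨E, hE, hE'⟩ := DefT.exists_env₂
    (u := (Fin.cons b.1 (Fin.cons c.1 fun i => (x' i).1) : Fin (n + 2) → Val M → M.Dom .num))
    (U := fun i => (X' i).1)
    (Fin.cases b.2 (Fin.cases c.2 fun i => (x' i).2)) (fun i => (X' i).2)
  obtain ⟨tb, hb⟩ := hE 0
  obtain ⟨tc, hc⟩ := hE 1
  choose tx htx using fun i : Fin n => hE i.succ.succ
  choose tX htX using hE'
  have hb : ∀ ω, b.1 ω = tb.eval M (E.val ω) E.A := hb
  have hc : ∀ ω, c.1 ω = tc.eval M (E.val ω) E.A := hc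
  have htx : ∀ i ω, (x' i).1 ω = (tx i).eval M (E.val ω) E.A := htx
  let lo : (Fin E.n → M.Dom .num) → Fin E.n → M.Dom .num := fun v j =>
    Sum.elim (fun _ => v j) id (E.c j)
  have hlo : ∀ {I : Type} {v : Fin E.n → (I → M.Dom .num) → M.Dom .num},
      (∀ i, DefT M I (v i)) → ∀ j, DefT M I (fun ω => lo (fun i => v i ω) j) := by
    intro I v hv j
    simp only [lo]
    cases E.c j with
    | inl k => exact hv j
    | inr a => exact .const a
  let p : Name M := .mk E.n
    (fun j => Sum.elim id (fun _ => .mk 0 Fin.elim0 (fun _ => 0) (fun _ => 0) fun _ _ _ => True)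
      (E.c j))
    (fun v => tb.eval M (lo v) E.A) (fun v => tc.eval M (lo v) E.A)
    (fun v z W => slen W ≤ tc.eval M (lo v) E.A ∧
      θ.Holds M (Fin.cons z fun i => (tx i).eval M (lo v) E.A)
        (Fin.cons W fun i => (tX i).eval M (lo v) E.A))
  have hval : ∀ ω, lo (fun i => ω (p.cs i)) = E.val ω := by
    intro ω
    funext j
    simp only [lo, p, GName.cs, Env.val]
    cases E.c j <;> rfl
  have ho : θ.IsQF := θ.isQF
  have hv : Valid p := by
    refine ⟨DefT.eval tb (hlo fun i => .var i) fun j => .const _,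
      DefT.eval tc (hlo fun i => .var i) fun j => .const _, fun {I v u W} hv hu hW => ?_,
      fun h => h.1⟩
    have h1 := DefP.holds ho
      (u := Fin.cons u fun i ω => (tx i).eval M (lo fun i => v i ω) E.A)
      (U := Fin.cons W fun i ω => (tX i).eval M (lo fun i => v i ω) E.A)
      (Fin.cases hu fun i => DefT.eval _ (hlo hv) fun j => .const _)
      (Fin.cases hW fun i => DefT.eval _ (hlo hv) fun j => .const _)
    refine DefP.and (.le (.len hW) (DefT.eval tc (hlo hv) fun j => .const _)) ?_
    convert h1 using 3 with ω
    · exact (comp_finCons (fun g : (I → M.Dom .num) → M.Dom .num => g ω) u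
        fun i ω => (tx i).eval M (lo fun i => v i ω) E.A).symm
    · exact (comp_finCons (fun g : (I → M.Dom .num) → M.Dom .str => g ω) W
        fun i ω => (tX i).eval M (lo fun i => v i ω) E.A).symm
  have hpb : ∀ ω, p.b (fun i => ω (p.cs i)) = b.1 ω := fun ω => by
    rw [hb, ← hval]; rfl
  have hpc : ∀ ω, p.c (fun i => ω (p.cs i)) = c.1 ω := fun ω => by
    rw [hc, ← hval]; rfl
  have hpΘ : ∀ ω z W, p.Θ (fun i => ω (p.cs i)) z W ↔ slen W ≤ c.1 ω ∧
      θ.Holds M (Fin.cons z fun i => (x' i).1 ω) (Fin.cons W fun i => (X' i).1 ω) := by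
    intro ω z W
    simp only [hc, htx, htX, ← hval]
    rfl
  by_cases hp : Realized p
  · exfalso
    let z : Fam M .num := ⟨fun ω => ω p, .var p⟩
    obtain ⟨W, hW, hθ⟩ := h (z.mk U) ((mk_lt_mk U).2 (by
      filter_upwards [hU p hp _ (.const M.nonemptyStr.some)] with ω hω
      rw [← hpb]
      exact hω.1))
    obtain ⟨W, rfl⟩ := Fam.exists_mk U W
    rw [slen_mk_le] at hW
    rw [holds_generic_cons U ho] at hθ
    obtain ⟨ω, h1, h2, h3⟩ := (hW.and (hθ.and (hU p hp W.1 W.2))).exists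
    exact h3.2 ((hpΘ _ _ _).2 ⟨h1, h2⟩)
  · obtain ⟨V, hV, hVlen, hVrow⟩ := exists_array_of_not_realized hU hv hp
    refine ⟨Fam.mk U ⟨V, hV⟩, ?_, fun z hz => ?_⟩
    · rw [pr_mk, slen_mk_le]
      refine .of_forall fun ω => ?_
      have := hVlen ω
      rwa [hpb, hpc] at this
    · obtain ⟨z, rfl⟩ := Fam.exists_mk U z
      rw [mk_lt_mk] at hz
      rw [row_mk, holds_generic_cons U ho]
      filter_upwards [hz, hVrow] with ω h1 h2
      exact ((hpΘ _ _ _).1 (h2 (z.1 ω) (by rwa [hpb]))).2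

/-- Every model of `VTC⁰-bar` has an extension satisfying replacement in which no new existential
statements about old elements hold. -/
theorem exists_extension (M : Struc LFTC0) [TB M] :
    ∃ (N : Struc LFTC0) (_ : TB N) (e : ∀ s, M.Dom s → N.Dom s), Replacement N ∧
      (∀ {n m : ℕ} {s : Srt} (t : Term LFTC0 s n m) (x : Fin n → M.Dom .num)
        (X : Fin m → M.Dom .str), t.eval N (fun i => e _ (x i)) (fun j => e _ (X j))
          = e _ (t.eval M x X)) ∧
      ∀ {n m : ℕ} (φ : Formula LFTC0 false n (m + 1)) (x : Fin n → M.Dom .num)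
        (X : Fin m → M.Dom .str) (V : N.Dom .str),
        φ.Holds N (fun i => e _ (x i)) (Fin.cons V fun j => e _ (X j)) →
          ∃ V', φ.Holds M x (Fin.cons V' X) := by
  obtain ⟨U, hU⟩ := exists_ultrafilter M
  refine ⟨generic U, inferInstance, fun s a => Fam.mk U ⟨fun _ => a, .const a⟩,
    replacement_generic hU, fun t x X => ?_, fun φ x X V h => ?_⟩
  · exact eval_generic U t (fun i => ⟨fun _ => x i, .const _⟩) (fun i => ⟨fun _ => X i, .const _⟩)
  · obtain ⟨V, rfl⟩ := Fam.exists_mk U V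
    have := holds_generic U (isQF_forget φ) (fun i => ⟨fun _ => x i, .const _⟩)
      (Fin.cons V fun i => ⟨fun _ => X i, .const _⟩)
    rw [comp_finCons (Fam.mk U), holds_forget] at this
    obtain ⟨ω, hω⟩ := (this.1 h).exists
    refine ⟨V.1 ω, ?_⟩
    rw [comp_finCons (fun u : Fam M .str => u.1 ω), holds_forget] at hω
    exact hω

end GenericModel


/-! ### Witnessing of `gΣ₁ᴮ` formulas -/

theorem Term.exists_bound {L : Vocab} (N : Struc L) [V0 N] {n m : ℕ} (B : N.Dom .num) :
    (t : Term L2A .num n m) → ∃ C : N.Dom .num, ∀ (x : Fin n → N.Dom .num)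
      (X : Fin m → N.Dom .str), (∀ i, x i ≤ B) → (∀ j, slen (X j) ≤ B) →
        (t.ofBase : Term L .num n m).eval N x X ≤ C
  | nvar i => ⟨B, fun _ _ h _ => h i⟩
  | zero => ⟨0, fun _ _ _ _ => le_rfl⟩
  | one => ⟨1, fun _ _ _ _ => le_rfl⟩
  | add s t => by
    obtain ⟨C, hC⟩ := exists_bound N B s
    obtain ⟨D, hD⟩ := exists_bound N B t
    exact ⟨C + D, fun x X h h' => add_le_add (hC x X h h') (hD x X h h')⟩
  | mul s t => by
    obtain ⟨C, hC⟩ := exists_bound N B s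
    obtain ⟨D, hD⟩ := exists_bound N B t
    exact ⟨C * D, fun x X h h' => mul_le_mul' (hC x X h h') (hD x X h h')⟩
  | len (svar j) => ⟨B, fun _ _ _ h => h j⟩
  | len (app f _ _) => nomatch f
  | app f _ _ => nomatch f

theorem Formula.IsQF.isSigma0B {L : Vocab} {n m : ℕ} {φ : Formula L true n m} (h : φ.IsQF) :
    φ.IsSigma0B := by
  obtain ⟨α, hα⟩ := h.exists_forget
  rw [forget_self] at hα
  exact hα ▸ .ofOpen α

/-- Replacement of the string variable `0` by its row with index `s`. -/
def Formula.rowSubst {q : Bool} {n m : ℕ} (s : Term LFTC0 .num n (m + 1))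
    (φ : Formula LFTC0 q n (m + 1)) : Formula LFTC0 q n (m + 1) :=
  φ.subst nvar (Fin.cons (rowT s (svar 0)) fun j => svar j.succ)

@[simp] theorem Formula.holds_rowSubst {M : Struc LFTC0} {q : Bool} {n m : ℕ}
    (s : Term LFTC0 .num n (m + 1)) (φ : Formula LFTC0 q n (m + 1)) (x : Fin n → M.Dom .num)
    (W : M.Dom .str) (X : Fin m → M.Dom .str) : (φ.rowSubst s).Holds M x (Fin.cons W X) ↔
      φ.Holds M x (Fin.cons (row (s.eval M x (Fin.cons W X)) W) X) := by
  rw [rowSubst, holds_subst, comp_finCons (fun T => Term.eval M x (Fin.cons W X) T)]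
  simp

/-- Two strings are the rows of one array. -/
theorem exists_rows {M : Struc LFTC0} [TB M] {A B : M.Dom .str} {c : M.Dom .num} (hA : slen A ≤ c)
    (hB : slen B ≤ c) : ∃ W : M.Dom .str, slen W ≤ pr 1 c ∧ row 0 W = A ∧ row 1 W = B := by
  obtain ⟨W, hW⟩ := V0.comp (M := M) (I := Empty)
    (fun ω => ∃ y ≤ ω none, (ω none = pr 0 y ∧ y ∈ A) ∨ (ω none = pr 1 y ∧ y ∈ B))
    (.exLe (.var _) (((SP.eq (.var _) (.pr (.const _) (.var _))).and (.mem _ (.var _))).or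
      ((SP.eq (.var _) (.pr (.const _) (.var _))).and (.mem _ (.var _))))) Empty.elim (pr 1 c)
  have h01 : (0 : M.Dom .num) ≠ 1 := zero_ne_one
  refine ⟨W, V0.slen_le fun z hz => ((hW z).1 hz).1, V0.str_ext fun y => ?_,
    V0.str_ext fun y => ?_⟩
  · rw [mem_row, hW]
    simp only [ocons_none, pr_inj, true_and, h01, false_and, or_false]
    exact ⟨by rintro ⟨-, _, -, rfl, h⟩; exact h, fun h =>
      ⟨pr_lt_pr zero_le ((V0.lt_len _ _ h).trans_le hA), y, right_le_pr _ _, rfl, h⟩⟩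
  · rw [mem_row, hW]
    simp only [ocons_none, pr_inj, true_and, h01.symm, false_and, false_or]
    exact ⟨by rintro ⟨-, _, -, rfl, h⟩; exact h, fun h =>
      ⟨pr_lt_pr le_rfl ((V0.lt_len _ _ h).trans_le hB), y, right_le_pr _ _, rfl, h⟩⟩

theorem finCons_le {α : Type*} [LinearOrder α] {n : ℕ} {x : Fin n → α} {y B C : α}
    (hx : ∀ i, x i ≤ B) (hy : y ≤ C) (i : Fin (n + 1)) :
    (Fin.cons y x : Fin (n + 1) → α) i ≤ max B C :=
  Fin.cases (hy.trans (le_max_right _ _)) (fun i => (hx i).trans (le_max_left _ _)) i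

/-- A `gΣ₁ᴮ` formula follows from an open formula with one witness, and is equivalent to its
existence, with a bound, in the presence of replacement. -/
theorem Formula.IsGSigma1B.exists_witness {n m : ℕ} {φ : Formula LFTC0 true n m}
    (h : φ.IsGSigma1B) : ∃ α : Formula LFTC0 false n (m + 1),
      (∀ (M : Struc LFTC0) [TB M] x X W, α.Holds M x (Fin.cons W X) → φ.Holds M x X) ∧
      ∀ (N : Struc LFTC0) [TB N], Replacement N → ∀ B : N.Dom .num, ∃ C : N.Dom .num,
        ∀ x X, (∀ i, x i ≤ B) → (∀ j, slen (X j) ≤ B) → φ.Holds N x X →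
          ∃ W, slen W ≤ C ∧ α.Holds N x (Fin.cons W X) := by
  induction h with
  | ofSigma0B h =>
    obtain ⟨α, hα⟩ := h.exists_open
    refine ⟨α.wkS, fun M _ x X W h => ?_, fun N _ _ B => ?_⟩
    · rwa [holds_wkS, ← hα] at h
    · refine ⟨slen N.nonemptyStr.some, fun x X _ _ h => ⟨_, le_rfl, ?_⟩⟩
      rwa [holds_wkS, ← hα]
  | and _ _ ih ih' =>
    obtain ⟨α, hα, hα'⟩ := ih
    obtain ⟨β, hβ, hβ'⟩ := ih'
    refine ⟨.and (α.rowSubst zero) (β.rowSubst one), fun M _ x X W h => ?_, fun N _ hN B => ?_⟩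
    · simp only [holds_and, holds_rowSubst] at h ⊢
      exact ⟨hα M _ _ _ h.1, hβ M _ _ _ h.2⟩
    · obtain ⟨C, hC⟩ := hα' N hN B
      obtain ⟨D, hD⟩ := hβ' N hN B
      refine ⟨pr 1 (max C D), fun x X hx hX h => ?_⟩
      obtain ⟨W, hW, h1⟩ := hC x X hx hX h.1
      obtain ⟨V, hV, h2⟩ := hD x X hx hX h.2
      obtain ⟨Z, hZ, rfl, rfl⟩ := exists_rows (hW.trans (le_max_left _ D))
        (hV.trans (le_max_right C _))
      refine ⟨Z, hZ, ?_⟩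
      simp only [holds_and, holds_rowSubst]
      exact ⟨h1, h2⟩
  | or _ _ ih ih' =>
    obtain ⟨α, hα, hα'⟩ := ih
    obtain ⟨β, hβ, hβ'⟩ := ih'
    refine ⟨.or α β, fun M _ x X W h => ?_, fun N _ hN B => ?_⟩
    · exact h.imp (hα M _ _ _) (hβ M _ _ _)
    · obtain ⟨C, hC⟩ := hα' N hN B
      obtain ⟨D, hD⟩ := hβ' N hN B
      refine ⟨max C D, fun x X hx hX h => ?_⟩
      rcases h with h | h
      · obtain ⟨W, hW, h1⟩ := hC x X hx hX h
        exact ⟨W, hW.trans (le_max_left _ _), .inl h1⟩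
      · obtain ⟨W, hW, h1⟩ := hD x X hx hX h
        exact ⟨W, hW.trans (le_max_right _ _), .inr h1⟩
  | allLe t _ ih =>
    obtain ⟨α, hα, hα'⟩ := ih
    obtain ⟨β, hβ⟩ := (IsSigma0B.allLe t.wkS
      (α.rowSubst (nvar 0)).isQF.forget.isSigma0B).exists_open
    simp only [ofBase_wkS, holds_allLe, holds_forget] at hβ
    refine ⟨β, fun M _ x X W h => ?_, fun N _ hN B => ?_⟩
    · rw [← hβ] at h
      simp only [eval_wkS, holds_rowSubst, eval_nvar, holds_allLe] at h ⊢
      exact fun y hy => hα M _ _ _ (h y hy)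
    · obtain ⟨C, hC⟩ := t.exists_bound N B
      obtain ⟨D, hD⟩ := hα' N hN (max B C)
      refine ⟨pr (C + 1) D, fun x X hx hX h => ?_⟩
      simp only [holds_allLe] at h
      obtain ⟨V, hV, hV'⟩ := hN _ _ α x X (t.ofBase.eval N x X + 1) D fun y hy => by
        rw [V0.lt_add_one_iff] at hy
        exact hD _ X (finCons_le hx (hy.trans (hC x X hx hX)))
          (fun j => (hX j).trans (le_max_left _ _)) (h y hy)
      refine ⟨V, hV.trans (pr_le_pr (by gcongr; exact hC x X hx hX) le_rfl), ?_⟩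
      rw [← hβ]
      simp only [eval_wkS, holds_rowSubst, eval_nvar]
      exact fun y hy => hV' y (V0.lt_add_one_iff.2 hy)
  | exLe t _ ih =>
    obtain ⟨α, hα, hα'⟩ := ih
    obtain ⟨β, hβ⟩ := (IsSigma0B.exLe t.wkS α.isQF.forget.isSigma0B).exists_open
    simp only [ofBase_wkS, holds_exLe, holds_forget] at hβ
    refine ⟨β, fun M _ x X W h => ?_, fun N _ hN B => ?_⟩
    · rw [← hβ] at h
      simp only [eval_wkS, holds_exLe] at h ⊢
      exact h.imp fun y hy => ⟨hy.1, hα M _ _ _ hy.2⟩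
    · obtain ⟨C, hC⟩ := t.exists_bound N B
      obtain ⟨D, hD⟩ := hα' N hN (max B C)
      refine ⟨D, fun x X hx hX h => ?_⟩
      simp only [holds_exLe] at h
      obtain ⟨y, hy, h⟩ := h
      obtain ⟨W, hW, h'⟩ := hD _ X (finCons_le hx (hy.trans (hC x X hx hX)))
        (fun j => (hX j).trans (le_max_left _ _)) h
      refine ⟨W, hW, (hβ _ _ _).1 ⟨y, ?_, h'⟩⟩
      simpa only [eval_wkS] using hy
  | allLt t _ ih =>
    obtain ⟨α, hα, hα'⟩ := ih
    obtain ⟨β, hβ⟩ := (IsSigma0B.allLt t.wkS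
      (α.rowSubst (nvar 0)).isQF.forget.isSigma0B).exists_open
    simp only [ofBase_wkS, holds_allLt, holds_forget] at hβ
    refine ⟨β, fun M _ x X W h => ?_, fun N _ hN B => ?_⟩
    · rw [← hβ] at h
      simp only [eval_wkS, holds_rowSubst, eval_nvar, holds_allLt] at h ⊢
      exact fun y hy => hα M _ _ _ (h y hy)
    · obtain ⟨C, hC⟩ := t.exists_bound N B
      obtain ⟨D, hD⟩ := hα' N hN (max B C)
      refine ⟨pr C D, fun x X hx hX h => ?_⟩
      simp only [holds_allLt] at h
      obtain ⟨V, hV, hV'⟩ := hN _ _ α x X (t.ofBase.eval N x X) D fun y hy =>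
        hD _ X (finCons_le hx (hy.le.trans (hC x X hx hX)))
          (fun j => (hX j).trans (le_max_left _ _)) (h y hy)
      refine ⟨V, hV.trans (pr_le_pr (hC x X hx hX) le_rfl), ?_⟩
      rw [← hβ]
      simp only [eval_wkS, holds_rowSubst, eval_nvar]
      exact hV'
  | exLt t _ ih =>
    obtain ⟨α, hα, hα'⟩ := ih
    obtain ⟨β, hβ⟩ := (IsSigma0B.exLt t.wkS α.isQF.forget.isSigma0B).exists_open
    simp only [ofBase_wkS, holds_exLt, holds_forget] at hβ
    refine ⟨β, fun M _ x X W h => ?_, fun N _ hN B => ?_⟩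
    · rw [← hβ] at h
      simp only [eval_wkS, holds_exLt] at h ⊢
      exact h.imp fun y hy => ⟨hy.1, hα M _ _ _ hy.2⟩
    · obtain ⟨C, hC⟩ := t.exists_bound N B
      obtain ⟨D, hD⟩ := hα' N hN (max B C)
      refine ⟨D, fun x X hx hX h => ?_⟩
      simp only [holds_exLt] at h
      obtain ⟨y, hy, h⟩ := h
      obtain ⟨W, hW, h'⟩ := hD _ X (finCons_le hx (hy.le.trans (hC x X hx hX)))
        (fun j => (hX j).trans (le_max_left _ _)) h
      refine ⟨W, hW, (hβ _ _ _).1 ⟨y, ?_, h'⟩⟩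
      simpa only [eval_wkS] using hy
  | @exSLe n m t φ _ ih =>
    obtain ⟨α, hα, hα'⟩ := ih
    let β : Formula LFTC0 false n (m + 1) := α.subst nvar
      (Fin.cons (rowT one (svar 0)) (Fin.cons (rowT zero (svar 0)) fun j => svar j.succ))
    have hβ : ∀ (M : Struc LFTC0) (x : Fin n → M.Dom .num) (X : Fin m → M.Dom .str)
        (W : M.Dom .str), β.Holds M x (Fin.cons W X) ↔
          α.Holds M x (Fin.cons (row 1 W) (Fin.cons (row 0 W) X)) := by
      intro M x X W
      simp only [β]
      rw [holds_subst, comp_finCons (fun T => Term.eval M x (Fin.cons W X) T),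
        comp_finCons (fun T => Term.eval M x (Fin.cons W X) T)]
      simp
    refine ⟨.and (.le (len (rowT zero (svar 0))) t.wkS.ofBase) β, fun M _ x X W h => ?_,
      fun N _ hN B => ?_⟩
    · simp only [holds_and, holds_le, hβ, eval_len, eval_rowT, eval_zero, eval_svar, Fin.cons_zero,
        ofBase_wkS, eval_wkS] at h
      rw [holds_exSLe]
      exact ⟨_, h.1, hα M _ _ _ h.2⟩
    · obtain ⟨C, hC⟩ := t.exists_bound N B
      obtain ⟨D, hD⟩ := hα' N hN (max B C)
      refine ⟨pr 1 (max C D), fun x X hx hX h => ?_⟩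
      rw [holds_exSLe] at h
      obtain ⟨Y, hY, h⟩ := h
      have hYC := hY.trans (hC x X hx hX)
      obtain ⟨W, hW, h'⟩ := hD x (Fin.cons Y X) (fun j => (hx j).trans (le_max_left _ _))
        (Fin.cases (hYC.trans (le_max_right _ _)) fun j => (hX j).trans (le_max_left _ _)) h
      obtain ⟨Z, hZ, rfl, rfl⟩ := exists_rows (hYC.trans (le_max_left _ D))
        (hW.trans (le_max_right C _))
      refine ⟨Z, hZ, ?_⟩
      simp only [holds_and, holds_le, hβ, eval_len, eval_rowT, eval_zero, eval_svar, Fin.cons_zero,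
        ofBase_wkS, eval_wkS]
      exact ⟨hY, h'⟩

/-- The negation of a `gΠ₁ᴮ` formula is equivalent to a `gΣ₁ᴮ` formula. -/
theorem Formula.IsGPi1B.exists_neg {L : Vocab} {n m : ℕ} {ψ : Formula L true n m}
    (h : ψ.IsGPi1B) : ∃ χ : Formula L true n m, χ.IsGSigma1B ∧
      ∀ (M : Struc L) x X, χ.Holds M x X ↔ ¬ ψ.Holds M x X := by
  induction h with
  | @ofSigma0B _ _ φ h => exact ⟨.not φ, .ofSigma0B h.not, fun M x X => Iff.rfl⟩
  | and _ _ ih ih' =>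
    obtain ⟨χ, h, hχ⟩ := ih
    obtain ⟨χ', h', hχ'⟩ := ih'
    exact ⟨.or χ χ', .or h h', fun M x X => by simp [hχ, hχ', imp_iff_not_or]⟩
  | or _ _ ih ih' =>
    obtain ⟨χ, h, hχ⟩ := ih
    obtain ⟨χ', h', hχ'⟩ := ih'
    exact ⟨.and χ χ', .and h h', fun M x X => by simp [hχ, hχ']⟩
  | allLe t _ ih =>
    obtain ⟨χ, h, hχ⟩ := ih
    exact ⟨.exLe t.ofBase χ, .exLe t h, fun M x X => by simp [hχ]⟩
  | exLe t _ ih =>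
    obtain ⟨χ, h, hχ⟩ := ih
    exact ⟨.allLe t.ofBase χ, .allLe t h, fun M x X => by simp [hχ]⟩
  | allLt t _ ih =>
    obtain ⟨χ, h, hχ⟩ := ih
    exact ⟨.exLt t.ofBase χ, .exLt t h, fun M x X => by simp [hχ]⟩
  | exLt t _ ih =>
    obtain ⟨χ, h, hχ⟩ := ih
    exact ⟨.allLt t.ofBase χ, .allLt t h, fun M x X => by simp [hχ]⟩
  | allSLe t _ ih =>
    obtain ⟨χ, h, hχ⟩ := ih
    exact ⟨.exSLe t.ofBase χ, .exSLe t h, fun M x X => by simp [hχ]⟩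

theorem exists_upper_bound {N : Struc LFTC0} [TB N] {n m : ℕ} (x : Fin n → N.Dom .num)
    (X : Fin m → N.Dom .str) (b : N.Dom .num) :
    ∃ B, b ≤ B ∧ (∀ i, x i ≤ B) ∧ ∀ j, slen (X j) ≤ B := by
  obtain ⟨B, hB⟩ := Finite.exists_le x
  obtain ⟨C, hC⟩ := Finite.exists_le fun j => slen (X j)
  exact ⟨max b (max B C), le_max_left _ _,
    fun i => (hB i).trans ((le_max_left _ _).trans (le_max_right _ _)),
    fun i => (hC i).trans ((le_max_right _ _).trans (le_max_right _ _))⟩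

theorem VTC0bar.admitsGDelta1BComprehension : Theory.AdmitsGDelta1BComprehension VTC0bar := by
  intro n m b φ ψ hφ hψ h M hM x X
  have : TB M := ⟨hM⟩
  obtain ⟨α, hα, hα'⟩ := hφ.exists_witness
  obtain ⟨χ, hχ, hχψ⟩ := hψ.exists_neg
  obtain ⟨β, hβ, hβ'⟩ := hχ.exists_witness
  obtain ⟨N, _, e, hN, he, hrefl⟩ := exists_extension M
  have hM' := h M hM x X
  have hN' := h N TB.models (fun i => e _ (x i)) (fun j => e _ (X j))
  simp only [holds_allLt, holds_iff, he] at hM' hN'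
  set b₀ := b.eval M x X with hb₀
  obtain ⟨B, hbB, hxB, hXB⟩ := exists_upper_bound (fun i => e _ (x i)) (fun j => e _ (X j))
    (e _ b₀)
  obtain ⟨C, hC⟩ := hα' N hN (max B B)
  obtain ⟨D, hD⟩ := hβ' N hN (max B B)
  obtain ⟨V, -, hV⟩ := hN _ _ (.or α β) (fun i => e _ (x i)) (fun j => e _ (X j)) (e _ b₀)
    (max C D) fun z hz => by
      have h1 := finCons_le hxB (hz.le.trans hbB)
      have h2 := fun j => (hXB j).trans (le_max_left B B)
      by_cases hz' : φ.Holds N (Fin.cons z fun i => e _ (x i)) fun j => e _ (X j)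
      · obtain ⟨W, hW, hW'⟩ := hC _ _ h1 h2 hz'
        exact ⟨W, hW.trans (le_max_left _ _), .inl hW'⟩
      · rw [hN' z hz, ← hχψ] at hz'
        obtain ⟨W, hW, hW'⟩ := hD _ _ h1 h2 hz'
        exact ⟨W, hW.trans (le_max_right _ _), .inr hW'⟩
  let γ : Formula LFTC0 true (n + 2) (m + 1) := ((Formula.or α β).subst
    (Fin.cons (nvar 0) fun i => nvar i.succ.succ)
    (Fin.cons (rowT (nvar 0) (svar 0)) fun j => svar j.succ)).forget
  have hγ : ∀ (M : Struc LFTC0) z b x W X, γ.Holds M (Fin.cons z (Fin.cons b x)) (Fin.cons W X) ↔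
      (Formula.or α β).Holds M (Fin.cons z x) (Fin.cons (row z W) X) := by
    intro M z b x W X
    simp only [γ]
    rw [holds_forget, holds_subst,
      comp_finCons (fun T => Term.eval M (Fin.cons z (Fin.cons b x)) (Fin.cons W X) T),
      comp_finCons (fun T => Term.eval M (Fin.cons z (Fin.cons b x)) (Fin.cons W X) T)]
    simp
  obtain ⟨δ, hδ⟩ := (IsSigma0B.allLt (nvar 0)
    (φ := γ) ((Formula.isQF _).forget.isSigma0B)).exists_open
  simp only [holds_allLt, Term.ofBase, eval_nvar] at hδ
  obtain ⟨V', hV'⟩ := hrefl δ (Fin.cons b₀ x) X V (by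
    rw [comp_finCons (e .num), ← hδ]
    intro z hz
    exact (hγ _ _ _ _ _ _).2 (hV z hz))
  rw [← hδ] at hV'
  have hV'' : ∀ z < b₀, α.Holds M (Fin.cons z x) (Fin.cons (row z V') X) ∨
      β.Holds M (Fin.cons z x) (Fin.cons (row z V') X) :=
    fun z hz => (hγ _ _ _ _ _ _).1 (hV' z hz)
  obtain ⟨F, -, hF⟩ := DefT.comp (M := M) (I := Empty) (b := fun _ => b₀)
    (P := fun _ z => α.Holds M (Fin.cons z x) (Fin.cons (row z V') X)) (by
      have := DefP.holds (M := M) (I := Option Empty) α.isQF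
        (u := Fin.cons (fun ω => ω none) fun i _ => x i)
        (U := Fin.cons (fun ω => row (ω none) V') fun j _ => X j)
        (Fin.cases (.var _) fun i => .const _)
        (Fin.cases (.row (.var _) (.const _)) fun i => .const _)
      convert this using 3 with ω
      · exact (comp_finCons (fun g : (Option Empty → M.Dom .num) → M.Dom .num => g ω)
          (fun ω => ω none) fun i _ => x i).symm
      · exact (comp_finCons (fun g : (Option Empty → M.Dom .num) → M.Dom .str => g ω)
          (fun ω => row (ω none) V') fun j _ => X j).symm) (.const _)
  rw [holds_exSLe]
  refine ⟨F Empty.elim, V0.slen_le fun z hz => ((hF _ _).1 hz).1, ?_⟩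
  simp only [holds_allLt, eval_wkS, holds_iff, holds_mem, eval_nvar, eval_svar, Fin.cons_zero,
    holds_wkS, hF]
  intro z hz
  refine ⟨fun h => hα M _ _ _ h.2, fun hz' => ⟨hz, (hV'' z hz).resolve_right fun hb => ?_⟩⟩
  exact (hχψ M _ _).1 (hβ M _ _ _ hb) ((hM' z hz).1 hz')


/-! ### Models of `VTC⁰` -/

theorem Formula.IsSigma0B.subst {n m : ℕ} {φ : Formula L2A true n m} (h : φ.IsSigma0B) :
    ∀ {n' m' : ℕ} (σ : Fin n → Term L2A .num n' m') (τ : Fin m → Term L2A .str n' m'),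
      (φ.subst σ τ).IsSigma0B := by
  induction h with
  | ofOpen α => exact fun σ τ => ((isQF_forget α).subst σ τ).isSigma0B
  | not _ ih => exact fun σ τ => (ih σ τ).not
  | and _ _ ih ih' => exact fun σ τ => (ih σ τ).and (ih' σ τ)
  | or _ _ ih ih' => exact fun σ τ => (ih σ τ).or (ih' σ τ)
  | allLe t _ ih =>
    intro n' m' σ τ
    have := IsSigma0B.allLe (t.subst σ τ) (ih (Fin.cons (nvar 0) fun i => (σ i).wkN)
      (fun j => (τ j).wkN))
    simpa only [Formula.allLe, imp, Formula.subst, Term.subst, Term.wkN_subst, ofBase_self,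
      Fin.cons_zero] using this
  | exLe t _ ih =>
    intro n' m' σ τ
    have := IsSigma0B.exLe (t.subst σ τ) (ih (Fin.cons (nvar 0) fun i => (σ i).wkN)
      (fun j => (τ j).wkN))
    simpa only [Formula.exLe, Formula.subst, Term.subst, Term.wkN_subst, ofBase_self,
      Fin.cons_zero] using this
  | allLt t _ ih =>
    intro n' m' σ τ
    have := IsSigma0B.allLt (t.subst σ τ) (ih (Fin.cons (nvar 0) fun i => (σ i).wkN)
      (fun j => (τ j).wkN))
    simpa only [Formula.allLt, imp, lt, Formula.subst, Term.subst, Term.wkN_subst, ofBase_self,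
      Fin.cons_zero] using this
  | exLt t _ ih =>
    intro n' m' σ τ
    have := IsSigma0B.exLt (t.subst σ τ) (ih (Fin.cons (nvar 0) fun i => (σ i).wkN)
      (fun j => (τ j).wkN))
    simpa only [Formula.exLt, lt, Formula.subst, Term.subst, Term.wkN_subst, ofBase_self,
      Fin.cons_zero] using this

/-- Models of `VTC⁰`. -/
class TV (M : Struc L2A) : Prop where
  models (n m : ℕ) (φ : Formula L2A true n m) : VTC0 n m φ → M.Models φ

section Realize

variable {M : Struc L2A} {I : Type}

/-- The relation is given by a `Σ₀ᴮ` formula in the formal variables of `E`. -/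
def Env.DefSigma (E : Env M I) (P : (I → M.Dom .num) → Prop) : Prop :=
  ∃ φ : Formula L2A true E.n E.m, φ.IsSigma0B ∧ ∀ ω, P ω ↔ φ.Holds M (E.val ω) E.A

theorem Env.DefSigma.mono {E E' : Env M I} (h : E ≤ E') {P : (I → M.Dom .num) → Prop}
    (hP : E.DefSigma P) : E'.DefSigma P := by
  obtain ⟨r, r', h, h'⟩ := h
  obtain ⟨φ, ho, hφ⟩ := hP
  refine ⟨φ.subst (fun j => nvar (r j)) (fun j => svar (r' j)), ho.subst _ _, fun ω => ?_⟩
  simp [Formula.holds_subst, hφ, Env.val, h, h']; rfl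

theorem Env.DefP.defSigma {E : Env M I} {P : (I → M.Dom .num) → Prop} (hP : E.DefP P) :
    E.DefSigma P := by
  obtain ⟨φ, ho, hφ⟩ := hP
  exact ⟨φ, ho.isSigma0B, hφ⟩

/-- A formula in a new variable is separated from the parameters. -/
theorem Env.DefSigma.exists_cons {E : Env M (Option I)} {P : (I → M.Dom .num) → M.Dom .num → Prop}
    (hP : E.DefSigma (fun ω => P (fun i => ω (some i)) (ω none))) :
    ∃ E' : Env M I, ∃ φ : Formula L2A true (E'.n + 1) E'.m, φ.IsSigma0B ∧
      ∀ ω z, P ω z ↔ φ.Holds M (Fin.cons z (E'.val ω)) E'.A := by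
  obtain ⟨φ, ho, hφ⟩ := hP
  let σ : Fin E.n → Term L2A .num (E.n + 1) E.m := fun j =>
    match E.c j with
    | .inl none => nvar 0
    | _ => nvar j.succ
  let c : Fin E.n → I ⊕ M.Dom .num := fun j =>
    match E.c j with
    | .inl none => .inr 0
    | .inl (some i) => .inl i
    | .inr a => .inr a
  refine ⟨⟨E.n, E.m, c, E.A⟩, φ.subst σ svar, ho.subst _ _, fun ω z => ?_⟩
  rw [holds_subst]
  refine (hφ (ocons z ω)).trans (iff_of_eq ?_)
  congr 1
  funext j
  simp only [Env.val, σ, c]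
  rcases h : E.c j with (_ | i) | a <;> simp [h, Env.val]

theorem SP.exists_env {P : (I → M.Dom .num) → Prop} (hP : SP M I P) :
    ∃ E : Env M I, E.DefSigma P := by
  induction hP with
  | le hf hg => exact Exists.imp (fun _ => Env.DefP.defSigma) (DefP.le hf.defT hg.defT)
  | eq hf hg => exact Exists.imp (fun _ => Env.DefP.defSigma) (DefP.eq hf.defT hg.defT)
  | mem A hf => exact Exists.imp (fun _ => Env.DefP.defSigma) (DefP.mem hf.defT (.const A))
  | not _ ih =>
    obtain ⟨E, φ, h, hφ⟩ := ih
    exact ⟨E, φ.not, h.not, fun ω => not_congr (hφ ω)⟩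
  | and _ _ ih ih' =>
    obtain ⟨E, hE⟩ := ih
    obtain ⟨E', hE'⟩ := ih'
    obtain ⟨F, h1, h2⟩ := exists_ge_ge E E'
    obtain ⟨φ, h, hφ⟩ := hE.mono h1
    obtain ⟨ψ, h', hψ⟩ := hE'.mono h2
    exact ⟨F, φ.and ψ, h.and h', fun ω => and_congr (hφ ω) (hψ ω)⟩
  | exLe hf _ ih =>
    obtain ⟨E, hE⟩ := ih
    obtain ⟨E, φ, h, hφ⟩ := hE.exists_cons
    obtain ⟨E', hE'⟩ := hf.defT
    obtain ⟨F, ⟨r, r', h1, h1'⟩, h2⟩ := exists_ge_ge E E'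
    obtain ⟨t, ht⟩ := hE'.mono h2
    refine ⟨F, .exLe t.ofBase (φ.subst (Fin.cons (nvar 0) fun j => nvar (r j).succ)
      fun j => svar (r' j)), .exLe t (h.subst _ _), fun ω => ?_⟩
    simp only [holds_exLe, ofBase_self, ht, hφ, holds_subst, eval_svar, h1']
    refine exists_congr fun z => and_congr_right fun _ => ?_
    rw [comp_finCons (fun s => Term.eval M (Fin.cons z (F.val ω)) F.A s)]
    simp only [eval_nvar, Fin.cons_zero, Fin.cons_succ, Env.val, h1]
    rfl

variable [hM : TV M]

instance : V0 M where
  add_one_ne_zero x := by simpa using hM.models _ _ _ (.basic .B1) ![x] ![]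
  add_one_inj x y := by simpa using hM.models _ _ _ (.basic .B2) ![x, y] ![]
  add_zero x := by simpa using hM.models _ _ _ (.basic .B3) ![x] ![]
  add_add_one x y := by simpa using hM.models _ _ _ (.basic .B4) ![x, y] ![]
  mul_zero x := by simpa using hM.models _ _ _ (.basic .B5) ![x] ![]
  mul_add_one x y := by simpa using hM.models _ _ _ (.basic .B6) ![x, y] ![]
  le_antisymm x y := by simpa using hM.models _ _ _ (.basic .B7) ![x, y] ![]
  zero_le x := by simpa using hM.models _ _ _ (.basic .B8) ![x] ![]
  le_trans x y z := by simpa using hM.models _ _ _ (.basic .B9) ![x, y, z] ![]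
  le_total x y := by simpa using hM.models _ _ _ (.basic .B10) ![x, y] ![]
  le_iff_lt_add_one x y := by simpa using hM.models _ _ _ (.basic .B11) ![x, y] ![]
  exists_add_one x h := by
    have := hM.models _ _ _ .B12 ![x] ![]
    simp only [holds_imp, holds_not, holds_exLt, holds_eqN, eval_nvar, eval_add] at this
    obtain ⟨y, -, hy⟩ := this h
    exact ⟨y, hy⟩
  lt_len y X := by simpa using hM.models _ _ _ (.basic .L1) ![y] ![X]
  mem_of_len y X := by simpa using hM.models _ _ _ (.basic .L2) ![y] ![X]
  ext X Y := by
    have := hM.models _ _ _ .SE ![] ![X, Y]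
    simp only [holds_iff, holds_and, holds_eqS, holds_eqN, holds_allLt, holds_mem, eval_len,
      eval_svar] at this
    exact fun h h' => this.2 ⟨h, h'⟩
  comp {I} P hP ω a := by
    obtain ⟨E, hE⟩ := hP.exists_env
    obtain ⟨E, φ, h, hφ⟩ := Env.DefSigma.exists_cons (P := fun ω z => P (ocons z ω))
      (E := E) (by simpa only [ocons_eta] using hE)
    have := hM.models _ _ _ (.comp (n := E.n + 1) 0 (φ.subst (Fin.cons (nvar 0) fun j =>
      nvar j.succ.succ) svar) (h.subst _ _)) (Fin.cons a (E.val ω)) E.A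
    simp only [holds_exSLe, holds_allLt, holds_iff, holds_mem, holds_wkS, eval_nvar, eval_svar,
      Fin.cons_zero, holds_subst] at this
    obtain ⟨X, hX, hX'⟩ := this
    have hφ' : ∀ z < a, z ∈ X ↔ P (ocons z ω) := by
      intro z hz
      rw [hX' z hz, hφ,
        comp_finCons (fun s => Term.eval M (Fin.cons z (Fin.cons a (E.val ω))) E.A s)]
      simp
    refine ⟨X, fun z => ⟨fun hz => ?_, fun hz => (hφ' z hz.1).2 hz.2⟩⟩
    have h1 : z < slen X := by
      have := hM.models _ _ _ (.basic .L1) ![z] ![X]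
      simp only [holds_imp, holds_mem, holds_lt] at this
      exact this hz
    have h2 : z ≤ a := by
      have := hM.models _ _ _ (.basic .B9) ![z, slen X, a] ![]
      simp only [holds_imp, holds_and, holds_le] at this
      exact this ⟨h1.1, hX⟩
    have h3 : z ≠ a := by
      rintro rfl
      have := hM.models _ _ _ (.basic .B7) ![z, slen X] ![]
      simp only [holds_imp, holds_and, holds_le, holds_eqN] at this
      exact h1.2 (this ⟨h1.1, hX⟩)
    exact ⟨⟨h2, h3⟩, (hφ' z ⟨h2, h3⟩).1 hz⟩

end Realize

/-! ### Locally definable families -/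

section Local

variable {L : Vocab} (M : Struc L) (I : Type)

/-- Relations that agree with `Σ₀ᴮ`-definable ones below any given bound. -/
def LP (P : (I → M.Dom .num) → Prop) : Prop :=
  ∀ a : M.Dom .num, ∃ Q, SP M I Q ∧ ∀ ω, (∀ i, ω i ≤ a) → (P ω ↔ Q ω)

/-- Functions that are bounded and have `Σ₀ᴮ`-definable graphs below any given bound. -/
def LN (u : (I → M.Dom .num) → M.Dom .num) : Prop :=
  (∀ a, ∃ c, ∀ ω, (∀ i, ω i ≤ a) → u ω ≤ c) ∧
    LP M (Option I) (fun ω => ω none = u (fun i => ω (some i)))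

/-- Families of strings that are bounded and `Σ₀ᴮ`-definable below any given bound. -/
def LS (S : (I → M.Dom .num) → M.Dom .str) : Prop :=
  (∀ a, ∃ c, ∀ ω, (∀ i, ω i ≤ a) → slen (S ω) ≤ c) ∧
    LP M (Option I) (fun ω => ω none ∈ S (fun i => ω (some i)))

variable {M I} {P Q : (I → M.Dom .num) → Prop}

theorem SP.lp (h : SP M I P) : LP M I P := fun _ => ⟨P, h, fun _ _ => Iff.rfl⟩

theorem LP.local (h : ∀ a : M.Dom .num, ∃ Q, LP M I Q ∧ ∀ ω, (∀ i, ω i ≤ a) → (P ω ↔ Q ω)) :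
    LP M I P := by
  intro a
  obtain ⟨Q, hQ, h⟩ := h a
  obtain ⟨R, hR, h'⟩ := hQ a
  exact ⟨R, hR, fun ω hω => (h ω hω).trans (h' ω hω)⟩

theorem LP.not (hP : LP M I P) : LP M I (fun ω => ¬ P ω) := by
  intro a
  obtain ⟨R, hR, h⟩ := hP a
  exact ⟨_, hR.not, fun ω hω => not_congr (h ω hω)⟩

theorem LP.and (hP : LP M I P) (hQ : LP M I Q) : LP M I (fun ω => P ω ∧ Q ω) := by
  intro a
  obtain ⟨R, hR, h⟩ := hP a
  obtain ⟨R', hR', h'⟩ := hQ a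
  exact ⟨_, hR.and hR', fun ω hω => and_congr (h ω hω) (h' ω hω)⟩

theorem LP.or (hP : LP M I P) (hQ : LP M I Q) : LP M I (fun ω => P ω ∨ Q ω) := by
  simpa only [not_and_or, not_not] using (hP.not.and hQ.not).not

theorem LP.imp (hP : LP M I P) (hQ : LP M I Q) : LP M I (fun ω => P ω → Q ω) := by
  simpa only [imp_iff_not_or] using hP.not.or hQ

theorem LP.iff (hP : LP M I P) (hQ : LP M I Q) : LP M I (fun ω => P ω ↔ Q ω) := by
  simpa only [iff_def] using (hP.imp hQ).and (hQ.imp hP)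

theorem LP.wk (hP : LP M I P) {J : Type} (e : I → J) : LP M J (fun ω => P (fun i => ω (e i))) := by
  intro a
  obtain ⟨R, hR, h⟩ := hP a
  exact ⟨_, hR.wk e, fun ω hω => h _ fun i => hω _⟩

theorem LN.wk {u : (I → M.Dom .num) → M.Dom .num} (hu : LN M I u) {J : Type} (e : I → J) :
    LN M J (fun ω => u (fun i => ω (e i))) :=
  ⟨fun a => (hu.1 a).imp fun _ h _ hω => h _ fun i => hω (e i), hu.2.wk (Option.map e)⟩

theorem LS.wk {S : (I → M.Dom .num) → M.Dom .str} (hS : LS M I S) {J : Type} (e : I → J) :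
    LS M J (fun ω => S (fun i => ω (e i))) :=
  ⟨fun a => (hS.1 a).imp fun _ h _ hω => h _ fun i => hω (e i), hS.2.wk (Option.map e)⟩

variable [hM : V0 M]

theorem LP.ex {P : (I → M.Dom .num) → M.Dom .num → Prop}
    (hP : LP M (Option I) (fun ω => P (fun i => ω (some i)) (ω none)))
    (hb : ∀ a, ∃ c, ∀ ω, (∀ i, ω i ≤ a) → ∀ x, P ω x → x ≤ c) :
    LP M I (fun ω => ∃ x, P ω x) := by
  intro a
  obtain ⟨c, hc⟩ := hb a
  obtain ⟨R, hR, h⟩ := hP (max a c)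
  refine ⟨fun ω => ∃ x ≤ c, R (ocons x ω), .exLe (.const c) (by simpa only [ocons_eta] using hR),
    fun ω hω => exists_congr fun x => ?_⟩
  have key : x ≤ c → (P ω x ↔ R (ocons x ω)) := fun hx => h (ocons x ω) fun i => by
    cases i with
    | none => exact hx.trans (le_max_right _ _)
    | some i => exact (hω i).trans (le_max_left _ _)
  exact ⟨fun hx => ⟨hc ω hω x hx, (key (hc ω hω x hx)).1 hx⟩, fun hx => (key hx.1).2 hx.2⟩

theorem LP.subst {P : (I → M.Dom .num) → M.Dom .num → Prop}
    (hP : LP M (Option I) (fun ω => P (fun i => ω (some i)) (ω none)))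
    {u : (I → M.Dom .num) → M.Dom .num} (hu : LN M I u) : LP M I (fun ω => P ω (u ω)) := by
  have := LP.ex (P := fun ω x => x = u ω ∧ P ω x) (hu.2.and hP) fun a =>
    (hu.1 a).imp fun c hc ω hω x hx => hx.1 ▸ hc ω hω
  simpa only [exists_eq_left] using this

theorem LP.subst₂ {P : (I → M.Dom .num) → M.Dom .num → M.Dom .num → Prop}
    (hP : LP M (Option (Option I)) (fun ω => P (fun i => ω (some (some i))) (ω none)
      (ω (some none)))) {u v : (I → M.Dom .num) → M.Dom .num} (hu : LN M I u) (hv : LN M I v) :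
    LP M I (fun ω => P ω (u ω) (v ω)) :=
  LP.subst (P := fun ω y => P ω (u ω) y)
    (LP.subst (P := fun ω x => P (fun i => ω (some i)) x (ω none)) hP (hu.wk some)) hv

theorem LP.exLt {P : (I → M.Dom .num) → M.Dom .num → Prop} {u : (I → M.Dom .num) → M.Dom .num}
    (hu : LN M I u) (hP : LP M (Option I) (fun ω => P (fun i => ω (some i)) (ω none))) :
    LP M I (fun ω => ∃ x < u ω, P ω x) :=
  LP.ex (P := fun ω x => x < u ω ∧ P ω x)
    ((LP.subst (P := fun ω y => ω none < y) (SP.lt (.var _) (.var _)).lp (hu.wk some)).and hP)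
    fun a => (hu.1 a).imp fun _ hc ω hω _ hx => hx.1.le.trans (hc ω hω)

theorem LP.allLt {P : (I → M.Dom .num) → M.Dom .num → Prop} {u : (I → M.Dom .num) → M.Dom .num}
    (hu : LN M I u) (hP : LP M (Option I) (fun ω => P (fun i => ω (some i)) (ω none))) :
    LP M I (fun ω => ∀ x < u ω, P ω x) := by
  have := (LP.exLt (P := fun ω x => ¬ P ω x) hu hP.not).not
  simpa only [not_exists, not_and, not_not] using this

theorem SN.exists_bound {f : (I → M.Dom .num) → M.Dom .num} (hf : SN M I f) (a : M.Dom .num) :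
    ∃ c, ∀ ω, (∀ i, ω i ≤ a) → f ω ≤ c := by
  induction hf with
  | var i => exact ⟨a, fun ω h => h i⟩
  | const b => exact ⟨b, fun _ _ => le_rfl⟩
  | add _ _ h h' =>
    obtain ⟨c, hc⟩ := h
    obtain ⟨d, hd⟩ := h'
    exact ⟨c + d, fun ω hω => add_le_add (hc ω hω) (hd ω hω)⟩
  | mul _ _ h h' =>
    obtain ⟨c, hc⟩ := h
    obtain ⟨d, hd⟩ := h'
    exact ⟨c * d, fun ω hω => mul_le_mul' (hc ω hω) (hd ω hω)⟩

theorem SN.ln {f : (I → M.Dom .num) → M.Dom .num} (hf : SN M I f) : LN M I f :=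
  ⟨hf.exists_bound, (SP.eq (.var _) (hf.wk some)).lp⟩

section Closure

variable {u v : (I → M.Dom .num) → M.Dom .num} {S T : (I → M.Dom .num) → M.Dom .str}

theorem LP.le (hu : LN M I u) (hv : LN M I v) : LP M I (fun ω => u ω ≤ v ω) :=
  LP.subst₂ (P := fun _ x y => x ≤ y) (SP.le (.var _) (.var _)).lp hu hv

theorem LP.eq (hu : LN M I u) (hv : LN M I v) : LP M I (fun ω => u ω = v ω) :=
  LP.subst₂ (P := fun _ x y => x = y) (SP.eq (.var _) (.var _)).lp hu hv

theorem LP.lt (hu : LN M I u) (hv : LN M I v) : LP M I (fun ω => u ω < v ω) :=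
  LP.subst₂ (P := fun _ x y => x < y) (SP.lt (.var _) (.var _)).lp hu hv

theorem LP.mem (hu : LN M I u) (hS : LS M I S) : LP M I (fun ω => u ω ∈ S ω) :=
  LP.subst (P := fun ω x => x ∈ S ω) hS.2 hu

theorem LP.eqS (hS : LS M I S) (hT : LS M I T) : LP M I (fun ω => S ω = T ω) := by
  have := (LP.ex (P := fun ω y => ¬ (y ∈ S ω ↔ y ∈ T ω)) (hS.2.iff hT.2).not fun a => by
    obtain ⟨c, hc⟩ := hS.1 a
    obtain ⟨d, hd⟩ := hT.1 a
    refine ⟨max c d, fun ω hω x hx => ?_⟩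
    by_cases h : x ∈ S ω
    · exact ((hM.lt_len _ _ h).le.trans (hc ω hω)).trans (le_max_left _ _)
    · have h' : x ∈ T ω := by_contra fun h' => hx (iff_of_false h h')
      exact ((hM.lt_len _ _ h').le.trans (hd ω hω)).trans (le_max_right _ _)).not
  convert this using 2 with ω
  simp only [not_exists, not_not]
  exact ⟨fun h y => by rw [h], V0.str_ext⟩

theorem LN.var (i : I) : LN M I (fun ω => ω i) := (SN.var i).ln

theorem LN.const (a : M.Dom .num) : LN M I (fun _ => a) := (SN.const a).ln

theorem LN.add (hu : LN M I u) (hv : LN M I v) : LN M I (fun ω => u ω + v ω) := by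
  refine ⟨fun a => ?_, LP.subst₂ (P := fun ω x y => ω none = x + y)
    (SP.eq (.var _) (.add (.var _) (.var _))).lp (hu.wk some) (hv.wk some)⟩
  obtain ⟨c, hc⟩ := hu.1 a
  obtain ⟨d, hd⟩ := hv.1 a
  exact ⟨c + d, fun ω hω => add_le_add (hc ω hω) (hd ω hω)⟩

theorem LN.mul (hu : LN M I u) (hv : LN M I v) : LN M I (fun ω => u ω * v ω) := by
  refine ⟨fun a => ?_, LP.subst₂ (P := fun ω x y => ω none = x * y)
    (SP.eq (.var _) (.mul (.var _) (.var _))).lp (hu.wk some) (hv.wk some)⟩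
  obtain ⟨c, hc⟩ := hu.1 a
  obtain ⟨d, hd⟩ := hv.1 a
  exact ⟨c * d, fun ω hω => mul_le_mul' (hc ω hω) (hd ω hω)⟩

theorem slen_eq_iff {X : M.Dom .str} {a : M.Dom .num} :
    a = slen X ↔ (¬ ∃ y, y ∈ X ∧ ¬ y < a) ∧ (a = 0 ∨ ∃ y, y + 1 = a ∧ y ∈ X) := by
  constructor
  · rintro rfl
    refine ⟨fun ⟨y, hy, hn⟩ => hn (hM.lt_len _ _ hy), ?_⟩
    by_cases h : slen X = 0
    · exact .inl h
    · obtain ⟨y, hy⟩ := hM.exists_add_one _ h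
      exact .inr ⟨y, hy, hM.mem_of_len _ _ hy⟩
  · rintro ⟨h, h'⟩
    push Not at h
    refine le_antisymm ?_ (V0.slen_le h)
    rcases h' with rfl | ⟨y, rfl, hy⟩
    · exact zero_le
    · exact V0.add_one_le_iff.2 (hM.lt_len _ _ hy)

theorem LN.len (hS : LS M I S) : LN M I (fun ω => slen (S ω)) := by
  refine ⟨hS.1, ?_⟩
  simp only [slen_eq_iff]
  have hS' := hS.2.wk (Option.map (some (α := I)))
  have hb : ∀ a, ∃ c, ∀ ω : Option I → M.Dom .num, (∀ i, ω i ≤ a) → ∀ x,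
      x ∈ S (fun i => ω (some i)) → x ≤ c := fun a =>
    (hS.1 a).imp fun c hc ω hω x hx => (hM.lt_len _ _ hx).le.trans (hc _ fun i => hω _)
  refine (LP.not (LP.ex (hS'.and (LP.not (.lt (.var _) (.var _)))) fun a =>
    (hb a).imp fun c hc ω hω x hx => hc ω hω x hx.1)).and
    (.or (.eq (.var _) (.const _)) (LP.ex (.and (.eq (.add (.var _) (.const _)) (.var _)) hS')
      fun a => (hb a).imp fun c hc ω hω x hx => hc ω hω x hx.2))

theorem LS.const (A : M.Dom .str) : LS M I (fun _ => A) :=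
  ⟨fun _ => ⟨slen A, fun _ _ => le_rfl⟩, (SP.mem A (.var _)).lp⟩

/-- Least numbers below a bound, or else the bound. -/
theorem LN.least (hu : LN M I u) {P : (I → M.Dom .num) → M.Dom .num → Prop}
    (hP : LP M (Option I) (fun ω => P (fun i => ω (some i)) (ω none)))
    (h1 : ∀ ω, v ω ≤ u ω) (h2 : ∀ ω, v ω < u ω → P ω (v ω))
    (h3 : ∀ ω, ∀ z < v ω, ¬ P ω z) : LN M I v := by
  refine ⟨fun a => (hu.1 a).imp fun c hc ω hω => (h1 ω).trans (hc ω hω), ?_⟩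
  have : LP M (Option I) (fun ω => ω none ≤ u (fun i => ω (some i)) ∧
      (ω none < u (fun i => ω (some i)) → P (fun i => ω (some i)) (ω none)) ∧
      ∀ z < ω none, ¬ P (fun i => ω (some i)) z) :=
    (LP.le (.var _) (hu.wk some)).and (((LP.lt (.var _) (hu.wk some)).imp hP).and
      (LP.allLt (.var none) (hP.wk (Option.map some)).not))
  convert this using 2 with ω
  constructor
  · intro h
    rw [h]
    exact ⟨h1 _, h2 _, h3 _⟩
  · rintro ⟨k1, k2, k3⟩
    refine le_antisymm (not_lt.1 fun h => ?_) (not_lt.1 fun h => ?_)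
    · exact k3 _ h (h2 _ (h.trans_le k1))
    · exact h3 _ _ h (k2 (h.trans_le (h1 _)))

end Closure

section Composition

variable {u : M.Dom .num → M.Dom .num} {v : (I → M.Dom .num) → M.Dom .num}

theorem LP.comp {P : M.Dom .num → Prop} (hP : LP M Unit (fun ω => P (ω ()))) (hv : LN M I v) :
    LP M I (fun ω => P (v ω)) :=
  LP.subst (P := fun _ x => P x) (hP.wk fun _ => none) hv

theorem LN.comp (hu : LN M Unit (fun ω => u (ω ()))) (hv : LN M I v) :
    LN M I (fun ω => u (v ω)) := by
  refine ⟨fun a => ?_, LP.subst (P := fun ω x => ω none = u x)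
    (hu.2.wk (Option.elim · (some none) fun _ => none)) (hv.wk some)⟩
  obtain ⟨c, hc⟩ := hv.1 a
  obtain ⟨d, hd⟩ := hu.1 c
  exact ⟨d, fun ω hω => hd (fun _ => v ω) fun _ => hc ω hω⟩

theorem LS.comp {S : M.Dom .num → M.Dom .str} (hS : LS M Unit (fun ω => S (ω ())))
    (hv : LN M I v) : LS M I (fun ω => S (v ω)) := by
  refine ⟨fun a => ?_, LP.subst (P := fun ω x => ω none ∈ S x)
    (hS.2.wk (Option.elim · (some none) fun _ => none)) (hv.wk some)⟩
  obtain ⟨c, hc⟩ := hv.1 a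
  obtain ⟨d, hd⟩ := hS.1 c
  exact ⟨d, fun ω hω => hd (fun _ => v ω) fun _ => hc ω hω⟩

end Composition

theorem LP.induction {P : M.Dom .num → Prop} (hP : LP M Unit (fun ω => P (ω ()))) (h0 : P 0)
    (hs : ∀ x, P x → P (x + 1)) (a : M.Dom .num) : P a := by
  obtain ⟨Q, hQ, h⟩ := hP a
  have key : ∀ x ≤ a, (P x ↔ Q fun _ => x) := fun x hx => h (fun _ => x) fun _ => hx
  refine (key a le_rfl).2 (V0.induction (P := fun x => x ≤ a → Q fun _ => x)
    (.imp (.le (.var _) (.const _)) (hQ.wk fun _ => none)) (fun h => (key _ h).1 h0)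
    (fun x ih hx => ?_) a le_rfl)
  have hx' := (V0.lt_add_one x).le.trans hx
  exact (key _ hx).1 (hs x ((key _ hx').2 (ih hx')))

theorem LP.exists_str [Finite I] {P : (I → M.Dom .num) → M.Dom .num → Prop}
    (hP : LP M (Option I) (fun ω => P (fun i => ω (some i)) (ω none))) (ω : I → M.Dom .num)
    (b : M.Dom .num) : ∃ X : M.Dom .str, ∀ z, z ∈ X ↔ z < b ∧ P ω z := by
  obtain ⟨a, ha⟩ := Finite.exists_le ω
  obtain ⟨Q, hQ, h⟩ := hP (max a b)
  obtain ⟨X, hX⟩ := hM.comp Q hQ ω b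
  refine ⟨X, fun z => (hX z).trans (and_congr_right fun hz => (h (ocons z ω) fun i => ?_).symm)⟩
  cases i with
  | none => exact hz.le.trans (le_max_right _ _)
  | some i => exact (ha i).trans (le_max_left _ _)

theorem LP.exists_least [Finite I] {P : (I → M.Dom .num) → M.Dom .num → Prop}
    (hP : LP M (Option I) (fun ω => P (fun i => ω (some i)) (ω none))) (ω : I → M.Dom .num)
    (b : M.Dom .num) : ∃ y ≤ b, (y < b → P ω y) ∧ ∀ z < y, ¬ P ω z := by
  obtain ⟨X, hX⟩ := LP.exists_str hP ω b
  obtain ⟨y, hy, h1, h2⟩ := V0.exists_least_fiber (M := M) (I := Empty) (a := b)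
    (P := fun ω => ω none = b ∨ ω none ∈ X)
    (.or (.eq (.var _) (.const _)) (.mem _ (.var _))) Empty.elim (.inl rfl)
  refine ⟨y, hy, fun hyb => ?_, fun z hz hP => ?_⟩
  · exact ((hX y).1 (h1.resolve_left hyb.ne)).2
  · exact h2 z hz (.inr ((hX z).2 ⟨hz.trans_le hy, hP⟩))

end Local


/-! ### Counting -/

section Counting

variable {M : Struc L2A} [hM : TV M]

theorem exists_counting (X : M.Dom .str) : ∃ c : M.Dom .num → M.Dom .num,
    LN M Unit (fun ω => c (ω ())) ∧ c 0 = 0 ∧ (∀ z ∈ X, c (z + 1) = c z + 1) ∧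
      ∀ z ∉ X, c (z + 1) = c z := by
  obtain ⟨Y, hY⟩ := hM.models _ _ _ .numones ![] ![] X
  have hY' : phiNumones.Holds M ![] ![Y, X] := by
    convert hY using 1
    funext i
    fin_cases i <;> rfl
  obtain ⟨⟨h1, h0⟩, h2⟩ := (holds_phiNumones M _ X Y).1 hY'
  choose! f hf hfY hf' using h1
  have hle : ∀ z, min z (slen X) ≤ slen X := fun z => min_le_right _ _
  have key : ∀ z ≤ slen X, ∀ y, y = f z ↔ y ≤ slen X ∧ pr z y ∈ Y := fun z hz y =>
    ⟨by rintro rfl; exact ⟨hf z hz, hfY z hz⟩, fun h => hf' z hz y h.1 h.2⟩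
  have hfle : ∀ z ≤ slen X, f z ≤ z := by
    intro z hz
    suffices ∃ y ≤ z, y ≤ slen X ∧ pr z y ∈ Y by
      obtain ⟨y, hy, h⟩ := this
      rwa [← (key z hz y).2 h]
    refine V0.induction (M := M) (P := fun z => z ≤ slen X → ∃ y ≤ z, y ≤ slen X ∧ pr z y ∈ Y)
      (.imp (.le (.var _) (.const _)) (.exLe (P := fun ω y => y ≤ slen X ∧ pr (ω none) y ∈ Y)
        (.var _) (.and (.le (.var _) (.const _)) (.mem _ (.pr (.var _) (.var _))))))
      (fun _ => ⟨0, le_rfl, zero_le, h0⟩) (fun z ih hz => ?_) z hz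
    have hz' := V0.add_one_le_iff.1 hz
    obtain ⟨y, hy, hyX, hyY⟩ := ih hz'.le
    have := h2 z hz' y hyX hyY
    by_cases h : z ∈ X
    · have hy' : y + 1 ≤ z + 1 := by gcongr
      exact ⟨y + 1, hy', hy'.trans hz, this.1 h⟩
    · exact ⟨y, hy.trans (V0.lt_add_one z).le, hyX, this.2 h⟩
  refine ⟨fun z => f (min z (slen X)), ⟨fun _ => ⟨slen X, fun _ _ => hf _ (hle _)⟩, ?_⟩, ?_, ?_, ?_⟩
  · have h : SP M (Option Unit) (fun ω =>
        (ω (some ()) ≤ slen X ∧ ω none ≤ slen X ∧ pr (ω (some ())) (ω none) ∈ Y) ∨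
          (slen X < ω (some ()) ∧ ω none ≤ slen X ∧ pr (slen X) (ω none) ∈ Y)) :=
      .or (.and (.le (.var _) (.const _)) (.and (.le (.var _) (.const _))
          (.mem _ (.pr (.var _) (.var _)))))
        (.and (.lt (.const _) (.var _)) (.and (.le (.var _) (.const _))
          (.mem _ (.pr (.const _) (.var _)))))
    convert h.lp using 2 with ω
    rw [key _ (hle _)]
    rcases le_or_gt (ω (some ())) (slen X) with h | h
    · simp [h, h.not_gt]
    · simp [h, h.not_ge, h.le]
  · exact ((key _ (hle _) _).2 ⟨zero_le, by rwa [min_eq_left zero_le]⟩).symm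
  · intro z hz
    have hz' : z < slen X := V0.lt_len z X hz
    simp only [min_eq_left hz'.le, min_eq_left (V0.add_one_le_iff.2 hz')]
    have := (h2 z hz' _ (hf z hz'.le) (hfY z hz'.le)).1 hz
    refine ((key _ (V0.add_one_le_iff.2 hz') _).2 ⟨?_, this⟩).symm
    exact (add_le_add_left (hfle z hz'.le) 1).trans (V0.add_one_le_iff.2 hz')
  · intro z hz
    rcases lt_or_ge z (slen X) with hz' | hz'
    · simp only [min_eq_left hz'.le, min_eq_left (V0.add_one_le_iff.2 hz')]
      have := (h2 z hz' _ (hf z hz'.le) (hfY z hz'.le)).2 hz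
      exact ((key _ (V0.add_one_le_iff.2 hz') _).2 ⟨hf z hz'.le, this⟩).symm
    · simp only [min_eq_right hz', min_eq_right (hz'.trans (V0.lt_add_one z).le)]

/-- The number of elements of `X` below `z`. -/
noncomputable def cnt (X : M.Dom .str) : M.Dom .num → M.Dom .num :=
  (exists_counting X).choose

theorem ln_cnt (X : M.Dom .str) : LN M Unit (fun ω => cnt X (ω ())) :=
  (exists_counting X).choose_spec.1

theorem cnt_zero (X : M.Dom .str) : cnt X 0 = 0 := (exists_counting X).choose_spec.2.1

theorem cnt_add_one_of_mem {X : M.Dom .str} {z : M.Dom .num} (h : z ∈ X) :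
    cnt X (z + 1) = cnt X z + 1 := (exists_counting X).choose_spec.2.2.1 z h

theorem cnt_add_one_of_notMem {X : M.Dom .str} {z : M.Dom .num} (h : z ∉ X) :
    cnt X (z + 1) = cnt X z := (exists_counting X).choose_spec.2.2.2 z h

theorem cnt_le (X : M.Dom .str) (z : M.Dom .num) : cnt X z ≤ z := by
  refine LP.induction (P := fun z => cnt X z ≤ z) (.le (ln_cnt X) (.var _)) (cnt_zero X).le
    (fun z h => ?_) z
  by_cases hz : z ∈ X
  · rw [cnt_add_one_of_mem hz]; gcongr
  · rw [cnt_add_one_of_notMem hz]; exact h.trans (V0.lt_add_one _).le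

omit hM in
theorem mul_add_inj [V0 M] {d z y z' y' : M.Dom .num} (hy : y < d) (hy' : y' < d) :
    z * d + y = z' * d + y' ↔ z = z' ∧ y = y' := by
  have aux : ∀ {z y z' y' : M.Dom .num}, y < d → z < z' → z * d + y < z' * d + y' := by
    intro z y z' y' hy h
    calc z * d + y < z * d + d := by gcongr
      _ = (z + 1) * d := by ring
      _ ≤ z' * d := mul_le_mul_left (V0.add_one_le_iff.2 h) _
      _ ≤ z' * d + y' := le_self_add
  refine ⟨fun h => ?_, by rintro ⟨rfl, rfl⟩; rfl⟩
  rcases lt_trichotomy z z' with hz | rfl | hz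
  · exact absurd h (aux hy hz).ne
  · exact ⟨rfl, add_left_cancel h⟩
  · exact absurd h (aux hy' hz).ne'

/-- The members of a family of strings are counted by means of a single string, their
concatenation. -/
theorem exists_cnt_concat {S : M.Dom .num → M.Dom .str} (hS : LS M Unit (fun ω => S (ω ())))
    (a : M.Dom .num) : ∃ (d : M.Dom .num) (W : M.Dom .str), ∀ z ≤ a, ∀ v ≤ a,
      cnt W (z * d + v) = cnt W (z * d) + cnt (S z) v := by
  obtain ⟨W, hW⟩ := LP.exists_str (M := M) (I := Empty)
    (P := fun _ w => ∃ z < a + 1, ∃ y < a + 1, w = z * (a + 1) + y ∧ y ∈ S z)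
    (.exLt (P := fun ω z => ∃ y < a + 1, ω none = z * (a + 1) + y ∧ y ∈ S z) (.const _)
      (.exLt (P := fun ω y => ω (some none) = ω none * (a + 1) + y ∧ y ∈ S (ω none)) (.const _)
        (.and (.eq (.var _) (.add (.mul (.var _) (.const _)) (.var _)))
          (.mem (.var _) (hS.comp (.var _))))))
    Empty.elim ((a + 1) * (a + 1))
  have key : ∀ z ≤ a, ∀ y < a + 1, z * (a + 1) + y ∈ W ↔ y ∈ S z := by
    intro z hz y hy
    rw [hW]
    constructor
    · rintro ⟨-, z', -, y', hy', e, h⟩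
      obtain ⟨rfl, rfl⟩ := (mul_add_inj hy hy').1 e
      exact h
    · refine fun h => ⟨?_, z, V0.lt_add_one_iff.2 hz, y, hy, rfl, h⟩
      calc z * (a + 1) + y < z * (a + 1) + (a + 1) := by gcongr
        _ = (z + 1) * (a + 1) := by ring
        _ ≤ (a + 1) * (a + 1) := mul_le_mul_left (add_le_add_left hz 1) _
  refine ⟨a + 1, W, fun z hz v => ?_⟩
  refine LP.induction (P := fun v => v ≤ a →
    cnt W (z * (a + 1) + v) = cnt W (z * (a + 1)) + cnt (S z) v)
    (.imp (.le (.var _) (.const _)) (.eq ((ln_cnt W).comp (.add (.const _) (.var _)))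
      (.add (.const _) (ln_cnt _)))) (fun _ => by rw [cnt_zero, add_zero, add_zero])
    (fun v ih hv => ?_) v
  have hv' := (V0.lt_add_one v).le.trans hv
  have hk := key z hz v (V0.lt_add_one_iff.2 hv')
  rw [← add_assoc]
  by_cases h : v ∈ S z
  · rw [cnt_add_one_of_mem h, cnt_add_one_of_mem (hk.2 h), ih hv', add_assoc]
  · rw [cnt_add_one_of_notMem h, cnt_add_one_of_notMem (mt hk.1 h), ih hv']

theorem LN.cnt {S : M.Dom .num → M.Dom .str} (hS : LS M Unit (fun ω => S (ω ())))
    {u : M.Dom .num → M.Dom .num} (hu : LN M Unit (fun ω => u (ω ()))) :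
    LN M Unit (fun ω => cnt (S (ω ())) (u (ω ()))) := by
  refine ⟨fun a => (hu.1 a).imp fun c hc ω hω => (cnt_le _ _).trans (hc ω hω), ?_⟩
  refine LP.subst (P := fun ω v => ω none = TwoSorted.cnt (S (ω (some ()))) v)
    (.local fun a => ?_) (hu.wk some)
  obtain ⟨d, W, h⟩ := exists_cnt_concat hS a
  have hz : LN M (Option (Option Unit)) fun ω => ω (some (some ())) * d :=
    .mul (.var _) (.const _)
  refine ⟨fun ω => TwoSorted.cnt W (ω (some (some ())) * d + ω none)
    = TwoSorted.cnt W (ω (some (some ())) * d) + ω (some none),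
    .eq ((ln_cnt W).comp (.add hz (.var _))) (.add ((ln_cnt W).comp hz) (.var _)),
    fun ω hω => ?_⟩
  dsimp only
  rw [h _ (hω _) _ (hω _), add_right_inj, eq_comm]

end Counting

/-! ### Projections of pairs -/

section Projections

variable {L : Vocab} {M : Struc L}

/-- The first component of a pair. -/
noncomputable def pfst (w : M.Dom .num) : M.Dom .num :=
  open Classical in if h : ∃ x y, w = pr x y then h.choose else 0

/-- The second component of a pair. -/
noncomputable def psnd (w : M.Dom .num) : M.Dom .num :=
  open Classical in if h : ∃ y x, w = pr x y then h.choose else 0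

variable [hM : V0 M]

@[simp] theorem pfst_pr (x y : M.Dom .num) : pfst (pr x y) = x := by
  have h : ∃ x' y', pr x y = pr x' y' := ⟨x, y, rfl⟩
  obtain ⟨y', h'⟩ := h.choose_spec
  rw [pfst, dif_pos h]
  exact (pr_inj.1 h').1.symm

@[simp] theorem psnd_pr (x y : M.Dom .num) : psnd (pr x y) = y := by
  have h : ∃ y' x', pr x y = pr x' y' := ⟨y, x, rfl⟩
  obtain ⟨y', h'⟩ := h.choose_spec
  rw [psnd, dif_pos h]
  exact (pr_inj.1 h').2.symm

theorem ln_pfst : LN M Unit (fun ω => pfst (ω ())) := by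
  have hb : ∀ w : M.Dom .num, ∀ y, y = pfst w ↔
      (∃ z ≤ w, w = pr y z) ∨ (y = 0 ∧ ¬ ∃ x ≤ w, ∃ z ≤ w, w = pr x z) := by
    intro w y
    by_cases h : ∃ x z, w = pr x z
    · obtain ⟨x, z, rfl⟩ := h
      rw [pfst_pr, or_iff_left fun h' => h'.2 ⟨x, left_le_pr _ _, z, right_le_pr _ _, rfl⟩]
      exact ⟨by rintro rfl; exact ⟨z, right_le_pr _ _, rfl⟩,
        fun ⟨z', _, h⟩ => (pr_inj.1 h).1.symm⟩
    · rw [pfst, dif_neg h]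
      refine ⟨fun e => .inr ⟨e, fun ⟨x, _, z, _, h'⟩ => h ⟨x, z, h'⟩⟩, ?_⟩
      rintro (⟨z, -, h'⟩ | h')
      · exact absurd ⟨y, z, h'⟩ h
      · exact h'.1
  have hP : SP M (Option Unit) (fun ω => (∃ z ≤ ω (some ()), ω (some ()) = pr (ω none) z) ∨
      (ω none = 0 ∧ ¬ ∃ x ≤ ω (some ()), ∃ z ≤ ω (some ()), ω (some ()) = pr x z)) :=
    .or (.exLe (P := fun ω z => ω (some ()) = pr (ω none) z) (.var _)
        (.eq (.var _) (.pr (.var _) (.var _))))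
      (.and (.eq (.var _) (.const _)) (.not
        (.exLe (P := fun ω x => ∃ z ≤ ω (some ()), ω (some ()) = pr x z) (.var _)
          (.exLe (P := fun ω z => ω (some (some ())) = pr (ω none) z) (.var _)
            (.eq (.var _) (.pr (.var _) (.var _)))))))
  refine ⟨fun a => ⟨a, fun ω hω => ?_⟩, by simpa only [hb] using hP.lp⟩
  rcases (hb (ω ()) _).1 rfl with ⟨z, -, h⟩ | h
  · exact (le_of_le_of_eq (left_le_pr _ z) h.symm).trans (hω _)
  · exact le_of_eq_of_le h.1 zero_le

theorem ln_psnd : LN M Unit (fun ω => psnd (ω ())) := by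
  have hb : ∀ w : M.Dom .num, ∀ y, y = psnd w ↔
      (∃ z ≤ w, w = pr z y) ∨ (y = 0 ∧ ¬ ∃ x ≤ w, ∃ z ≤ w, w = pr x z) := by
    intro w y
    by_cases h : ∃ z x, w = pr x z
    · obtain ⟨z, x, rfl⟩ := h
      rw [psnd_pr, or_iff_left fun h' => h'.2 ⟨x, left_le_pr _ _, z, right_le_pr _ _, rfl⟩]
      exact ⟨by rintro rfl; exact ⟨x, left_le_pr _ _, rfl⟩,
        fun ⟨z', _, h⟩ => (pr_inj.1 h).2.symm⟩
    · rw [psnd, dif_neg h]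
      refine ⟨fun e => .inr ⟨e, fun ⟨x, _, z, _, h'⟩ => h ⟨z, x, h'⟩⟩, ?_⟩
      rintro (⟨z, -, h'⟩ | h')
      · exact absurd ⟨y, z, h'⟩ h
      · exact h'.1
  have hP : SP M (Option Unit) (fun ω => (∃ z ≤ ω (some ()), ω (some ()) = pr z (ω none)) ∨
      (ω none = 0 ∧ ¬ ∃ x ≤ ω (some ()), ∃ z ≤ ω (some ()), ω (some ()) = pr x z)) :=
    .or (.exLe (P := fun ω z => ω (some ()) = pr z (ω none)) (.var _)
        (.eq (.var _) (.pr (.var _) (.var _))))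
      (.and (.eq (.var _) (.const _)) (.not
        (.exLe (P := fun ω x => ∃ z ≤ ω (some ()), ω (some ()) = pr x z) (.var _)
          (.exLe (P := fun ω z => ω (some (some ())) = pr (ω none) z) (.var _)
            (.eq (.var _) (.pr (.var _) (.var _)))))))
  refine ⟨fun a => ⟨a, fun ω hω => ?_⟩, by simpa only [hb] using hP.lp⟩
  rcases (hb (ω ()) _).1 rfl with ⟨z, -, h⟩ | h
  · exact (le_of_le_of_eq (right_le_pr z _) h.symm).trans (hω _)
  · exact le_of_eq_of_le h.1 zero_le

end Projections


/-! ### Expansion of a model of `VTC⁰` to the vocabulary of `VTC⁰-bar` -/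

variable (M : Struc L2A) [hM : TV M]

mutual

/-- The interpretation of the symbols of the vocabulary of `VTC⁰-bar` in a model of `VTC⁰`. -/
noncomputable def interp : {s : Srt} → {k l : ℕ} → LFTC0 s k l → (Fin k → M.Dom .num) →
    (Fin l → M.Dom .str) → M.Dom s
  | _, _, _, .pd => fun x _ => Classical.epsilon fun y => (x 0 = 0 ∧ y = 0) ∨ y + 1 = x 0
  | _, _, _, .fSE => fun _ X => Classical.epsilon fun y => y ≤ slen (X 0) ∧
      (y < slen (X 0) → ¬ (y ∈ X 0 ↔ y ∈ X 1)) ∧ ∀ z < y, ¬ ¬ (z ∈ X 0 ↔ z ∈ X 1)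
  | _, _, _, .numones => fun x X => cnt (X 0) (x 0)
  | _, _, _, .F α t => fun x X => Classical.epsilon fun S =>
      ∀ z, z ∈ S ↔ z < t.eval M x X ∧ formulaValue α (Fin.cons z x) X
  | _, _, _, .f α t => fun x X => Classical.epsilon fun y => y ≤ t.eval M x X ∧
      (y < t.eval M x X → formulaValue α (Fin.cons y x) X) ∧
        ∀ z < y, ¬ formulaValue α (Fin.cons z x) X

/-- The value of a term under the interpretation `interp`. -/
noncomputable def termValue : {s : Srt} → {n m : ℕ} → Term LFTC0 s n m → (Fin n → M.Dom .num) →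
    (Fin m → M.Dom .str) → M.Dom s
  | _, _, _, .nvar i => fun x _ => x i
  | _, _, _, .svar i => fun _ X => X i
  | _, _, _, .zero => fun _ _ => M.zero
  | _, _, _, .one => fun _ _ => M.one
  | _, _, _, .add s t => fun x X => M.add (termValue s x X) (termValue t x X)
  | _, _, _, .mul s t => fun x X => M.mul (termValue s x X) (termValue t x X)
  | _, _, _, .len T => fun x X => M.len (termValue T x X)
  | _, _, _, .app f ts Ts => fun x X =>
      interp f (fun i => termValue (ts i) x X) (fun i => termValue (Ts i) x X)

/-- Truth of a formula under the interpretation `interp`. -/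
noncomputable def formulaValue : {q : Bool} → {n m : ℕ} → Formula LFTC0 q n m →
    (Fin n → M.Dom .num) → (Fin m → M.Dom .str) → Prop
  | _, _, _, .top => fun _ _ => True
  | _, _, _, .bot => fun _ _ => False
  | _, _, _, .eqN s t => fun x X => termValue s x X = termValue t x X
  | _, _, _, .eqS s t => fun x X => termValue s x X = termValue t x X
  | _, _, _, .le s t => fun x X => M.le (termValue s x X) (termValue t x X)
  | _, _, _, .mem s t => fun x X => M.mem (termValue s x X) (termValue t x X)
  | _, _, _, .not φ => fun x X => ¬ formulaValue φ x X
  | _, _, _, .and φ ψ => fun x X => formulaValue φ x X ∧ formulaValue ψ x X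
  | _, _, _, .or φ ψ => fun x X => formulaValue φ x X ∨ formulaValue ψ x X
  | _, _, _, .allN φ => fun x X => ∀ a, formulaValue φ (Fin.cons a x) X
  | _, _, _, .exN φ => fun x X => ∃ a, formulaValue φ (Fin.cons a x) X
  | _, _, _, .allS φ => fun x X => ∀ A, formulaValue φ x (Fin.cons A X)
  | _, _, _, .exS φ => fun x X => ∃ A, formulaValue φ x (Fin.cons A X)

end

/-- The expansion of a model of `VTC⁰` to the vocabulary of `VTC⁰-bar`. -/
@[reducible] noncomputable def Struc.expand : Struc LFTC0 where
  Dom := M.Dom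
  nonemptyStr := M.nonemptyStr
  zero := M.zero
  one := M.one
  add := M.add
  mul := M.mul
  len := M.len
  le := M.le
  mem := M.mem
  fn := interp M

theorem termValue_eq_eval {s : Srt} {n m : ℕ} (t : Term LFTC0 s n m) (x : Fin n → M.Dom .num)
    (X : Fin m → M.Dom .str) : termValue M t x X = t.eval M.expand x X := by
  induction t with
  | nvar i => rfl
  | svar i => rfl
  | zero => rfl
  | one => rfl
  | add s t h h' => simp only [termValue, h, h']; rfl
  | mul s t h h' => simp only [termValue, h, h']; rfl
  | len T h => simp only [termValue, h]; rfl
  | app f ts Ts h h' => simp only [termValue, h, h']; rfl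

theorem formulaValue_iff_holds {q : Bool} {n m : ℕ} (φ : Formula LFTC0 q n m)
    (x : Fin n → M.Dom .num) (X : Fin m → M.Dom .str) :
    formulaValue M φ x X ↔ φ.Holds M.expand x X := by
  induction φ with
  | top => rfl
  | bot => rfl
  | eqN s t => simp only [formulaValue, termValue_eq_eval]; rfl
  | eqS s t => simp only [formulaValue, termValue_eq_eval]; rfl
  | le s t => simp only [formulaValue, termValue_eq_eval]; rfl
  | mem s t => simp only [formulaValue, termValue_eq_eval]; rfl
  | not φ h => simp only [formulaValue, h]; rfl
  | and φ ψ h h' => simp only [formulaValue, h, h']; rfl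
  | or φ ψ h h' => simp only [formulaValue, h, h']; rfl
  | allN φ h => simp only [formulaValue, h]; rfl
  | exN φ h => simp only [formulaValue, h]; rfl
  | allS φ h => simp only [formulaValue, h]; rfl
  | exS φ h => simp only [formulaValue, h]; rfl

variable {M}

/-- Families of elements of either sort, indexed by numbers, that are bounded and locally
`Σ₀ᴮ`-definable. -/
def LV : {s : Srt} → (M.Dom .num → M.Dom s) → Prop
  | .num, u => LN M Unit (fun ω => u (ω ()))
  | .str, S => LS M Unit (fun ω => S (ω ()))

theorem LV.eval_base {n m : ℕ} {s : Srt} (t : Term L2A s n m) {u : Fin n → M.Dom .num → M.Dom .num}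
    {U : Fin m → M.Dom .num → M.Dom .str} (hu : ∀ i, LV (u i)) (hU : ∀ j, LV (U j)) :
    LV (fun w => t.eval M (fun i => u i w) (fun j => U j w)) := by
  induction t with
  | nvar i => exact hu i
  | svar j => exact hU j
  | zero => exact LN.const _
  | one => exact LN.const _
  | add s t h h' => exact LN.add (h hu hU) (h' hu hU)
  | mul s t h h' => exact LN.mul (h hu hU) (h' hu hU)
  | len T h => exact LN.len (h hu hU)
  | app f => exact f.elim

/-- The relation is locally `Σ₀ᴮ`-definable on families that are. -/
def GoodP {n m : ℕ} (P : (Fin n → M.Dom .num) → (Fin m → M.Dom .str) → Prop) : Prop :=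
  ∀ (u : Fin n → M.Dom .num → M.Dom .num) (U : Fin m → M.Dom .num → M.Dom .str),
    (∀ i, LV (u i)) → (∀ j, LV (U j)) →
      LP M Unit (fun ω => P (fun i => u i (ω ())) (fun j => U j (ω ())))

/-- The function maps families that are bounded and locally `Σ₀ᴮ`-definable to such families. -/
def GoodV {n m : ℕ} {s : Srt} (F : (Fin n → M.Dom .num) → (Fin m → M.Dom .str) → M.Dom s) :
    Prop :=
  ∀ (u : Fin n → M.Dom .num → M.Dom .num) (U : Fin m → M.Dom .num → M.Dom .str),
    (∀ i, LV (u i)) → (∀ j, LV (U j)) → LV (fun w => F (fun i => u i w) (fun j => U j w))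

section Good

variable {n m : ℕ} {P : (Fin (n + 1) → M.Dom .num) → (Fin m → M.Dom .str) → Prop}

theorem GoodP.cons (hP : GoodP P) {u : Fin n → M.Dom .num → M.Dom .num}
    {U : Fin m → M.Dom .num → M.Dom .str} (hu : ∀ i, LV (u i)) (hU : ∀ j, LV (U j)) :
    LP M (Option Unit) (fun ω => P (Fin.cons (ω none) fun i => u i (ω (some ())))
      (fun j => U j (ω (some ())))) := by
  have h := hP (Fin.cons psnd fun i w => u i (pfst w)) (fun j w => U j (pfst w))
    (Fin.cases ln_psnd fun i => LN.comp (u := u i) (hu i) ln_pfst) (fun j => LS.comp (S := U j) (hU j) ln_pfst)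
  have h' := LP.comp (P := fun w => P (Fin.cons (psnd w) fun i => u i (pfst w))
    (fun j => U j (pfst w))) (by
      convert h using 3 with ω
      funext i
      refine Fin.cases ?_ (fun i => ?_) i <;> rfl)
    (SN.pr (.var (some ())) (.var none)).ln
  simpa only [pfst_pr, psnd_pr] using h'

theorem GoodP.exists_str (hP : GoodP P) (x : Fin n → M.Dom .num) (X : Fin m → M.Dom .str)
    (b : M.Dom .num) : ∃ S : M.Dom .str, ∀ z, z ∈ S ↔ z < b ∧ P (Fin.cons z x) X :=
  LP.exists_str (P := fun _ z => P (Fin.cons z x) X)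
    (hP.cons (u := fun i _ => x i) (U := fun j _ => X j) (fun i => LN.const (x i))
      fun j => LS.const (X j)) (fun _ => 0) b

theorem GoodP.exists_least (hP : GoodP P) (x : Fin n → M.Dom .num) (X : Fin m → M.Dom .str)
    (b : M.Dom .num) : ∃ y ≤ b, (y < b → P (Fin.cons y x) X) ∧ ∀ z < y, ¬ P (Fin.cons z x) X :=
  LP.exists_least (P := fun _ z => P (Fin.cons z x) X)
    (hP.cons (u := fun i _ => x i) (U := fun j _ => X j) (fun i => LN.const (x i))
      fun j => LS.const (X j)) (fun _ => 0) b

end Good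

theorem interp_pd (x : Fin 1 → M.Dom .num) (X : Fin 0 → M.Dom .str) :
    (x 0 = 0 ∧ interp M .pd x X = 0) ∨ interp M .pd x X + 1 = x 0 := by
  have h : ∃ y, (x 0 = 0 ∧ y = 0) ∨ y + 1 = x 0 := by
    by_cases h : x 0 = 0
    · exact ⟨0, .inl ⟨h, rfl⟩⟩
    · exact (V0.exists_add_one _ h).imp fun _ => .inr
  rw [interp]
  exact Classical.epsilon_spec h

theorem interp_fSE (x : Fin 0 → M.Dom .num) (X : Fin 2 → M.Dom .str) :
    interp M .fSE x X ≤ slen (X 0) ∧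
      (interp M .fSE x X < slen (X 0) → ¬ (interp M .fSE x X ∈ X 0 ↔ interp M .fSE x X ∈ X 1)) ∧
        ∀ z < interp M .fSE x X, ¬ ¬ (z ∈ X 0 ↔ z ∈ X 1) := by
  have h := LP.exists_least (M := M) (I := Empty) (P := fun _ y => ¬ (y ∈ X 0 ↔ y ∈ X 1))
    (LP.not (.iff (.mem (.var _) (.const _)) (.mem (.var _) (.const _)))) Empty.elim (slen (X 0))
  rw [interp]
  exact Classical.epsilon_spec (p := fun y => _) h

theorem mem_interp_F {n m : ℕ} {α : Formula LFTC0 false (n + 1) m} (t : Term L2A .num n m)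
    (hα : GoodP (formulaValue M α)) (x : Fin n → M.Dom .num) (X : Fin m → M.Dom .str)
    (z : M.Dom .num) :
    z ∈ interp M (.F α t) x X ↔ z < t.eval M x X ∧ formulaValue M α (Fin.cons z x) X := by
  rw [interp]
  exact Classical.epsilon_spec (p := fun S : M.Dom .str => ∀ z, z ∈ S ↔ _)
    (hα.exists_str x X (t.eval M x X)) z

theorem interp_f {n m : ℕ} {α : Formula LFTC0 false (n + 1) m} (t : Term L2A .num n m)
    (hα : GoodP (formulaValue M α)) (x : Fin n → M.Dom .num) (X : Fin m → M.Dom .str) :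
    interp M (.f α t) x X ≤ t.eval M x X ∧
      (interp M (.f α t) x X < t.eval M x X →
        formulaValue M α (Fin.cons (interp M (.f α t) x X) x) X) ∧
      ∀ z < interp M (.f α t) x X, ¬ formulaValue M α (Fin.cons z x) X := by
  rw [interp]
  exact Classical.epsilon_spec (p := fun y => y ≤ _ ∧ _)
    (hα.exists_least x X (t.eval M x X))

mutual

theorem goodV_interp : ∀ {s : Srt} {k l : ℕ} (f : LFTC0 s k l), GoodV (interp M f)
  | _, _, _, .pd => fun u U hu hU => by
    refine ⟨fun a => ?_, ?_⟩
    · obtain ⟨c, hc⟩ := (hu 0).1 a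
      refine ⟨c, fun ω hω => le_trans ?_ (hc ω hω)⟩
      rcases interp_pd (fun i => u i (ω ())) (fun j => U j (ω ())) with h | h
      · exact le_of_eq_of_le h.2 zero_le
      · exact le_of_le_of_eq (V0.lt_add_one _).le h
    · have hu' : LN M (Option Unit) fun ω => u 0 (ω (some ())) := LN.wk (hu 0) some
      have h : LP M (Option Unit) fun ω => (u 0 (ω (some ())) = 0 ∧ ω none = 0) ∨
          ω none + 1 = u 0 (ω (some ())) :=
        .or (.and (.eq hu' (.const _)) (.eq (.var _) (.const _)))
          (.eq (.add (.var _) (.const _)) hu')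
      convert h using 2 with ω
      have hp := interp_pd (fun i => u i (ω (some ()))) (fun j => U j (ω (some ())))
      constructor
      · intro e
        rw [e]
        exact hp
      · rintro (⟨h, h'⟩ | h) <;> rcases hp with ⟨k, k'⟩ | k
        · exact h'.trans k'.symm
        · exact absurd (k.trans h) (V0.add_one_ne_zero _)
        · exact absurd (h.trans k) (V0.add_one_ne_zero _)
        · exact V0.add_one_inj _ _ (h.trans k.symm)
  | _, _, _, .fSE => fun u U hu hU =>
    LN.least (P := fun ω y => ¬ (y ∈ U 0 (ω ()) ↔ y ∈ U 1 (ω ()))) (LN.len (hU 0))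
      (LP.not (.iff (.mem (.var _) (LS.wk (hU 0) some)) (.mem (.var _) (LS.wk (hU 1) some))))
      (fun ω => (interp_fSE _ _).1) (fun ω => (interp_fSE _ _).2.1)
      (fun ω => (interp_fSE _ _).2.2)
  | _, _, _, .numones => fun u U hu hU => by
    simp only [interp]
    exact LN.cnt (hU 0) (hu 0)
  | _, _, _, .F α t => fun u U hu hU => by
    have hα : GoodP (formulaValue M α) := goodP_formulaValue α rfl
    have ht : LN M Unit _ := LV.eval_base t hu hU
    refine ⟨fun a => (ht.1 a).imp fun c hc ω hω => (V0.slen_le fun z hz => ?_).trans (hc ω hω), ?_⟩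
    · exact ((mem_interp_F t hα _ _ z).1 hz).1
    · simp only [mem_interp_F t hα]
      exact .and (.lt (.var _) (ht.wk some)) (hα.cons hu hU)
  | _, _, _, .f α t => fun u U hu hU => by
    have hα : GoodP (formulaValue M α) := goodP_formulaValue α rfl
    have ht : LN M Unit _ := LV.eval_base t hu hU
    exact LN.least (P := fun ω y => formulaValue M α (Fin.cons y fun i => u i (ω ()))
      (fun j => U j (ω ()))) ht (hα.cons hu hU) (fun ω => (interp_f t hα _ _).1)
      (fun ω => (interp_f t hα _ _).2.1) (fun ω => (interp_f t hα _ _).2.2)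

theorem goodV_termValue : ∀ {s : Srt} {n m : ℕ} (t : Term LFTC0 s n m), GoodV (termValue M t)
  | _, _, _, .nvar i => fun _ _ hu _ => hu i
  | _, _, _, .svar j => fun _ _ _ hU => hU j
  | _, _, _, .zero => fun _ _ _ _ => LN.const _
  | _, _, _, .one => fun _ _ _ _ => LN.const _
  | _, _, _, .add s t => fun u U hu hU =>
    LN.add (goodV_termValue s u U hu hU) (goodV_termValue t u U hu hU)
  | _, _, _, .mul s t => fun u U hu hU =>
    LN.mul (goodV_termValue s u U hu hU) (goodV_termValue t u U hu hU)
  | _, _, _, .len T => fun u U hu hU => LN.len (goodV_termValue T u U hu hU)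
  | _, _, _, .app f ts Ts => fun u U hu hU =>
    goodV_interp f _ _ (fun i => goodV_termValue (ts i) u U hu hU)
      (fun j => goodV_termValue (Ts j) u U hu hU)

theorem goodP_formulaValue : ∀ {q : Bool} {n m : ℕ} (φ : Formula LFTC0 q n m), q = false →
    GoodP (formulaValue M φ)
  | _, _, _, .top => fun _ u U hu hU => by
    simpa only [formulaValue] using (SP.eq (M := M) (.const 0) (.const 0)).lp
  | _, _, _, .bot => fun _ u U hu hU => by
    simpa only [formulaValue, not_true] using (SP.eq (M := M) (.const 0) (.const 0)).not.lp
  | _, _, _, .eqN s t => fun _ u U hu hU =>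
    LP.eq (goodV_termValue s u U hu hU) (goodV_termValue t u U hu hU)
  | _, _, _, .eqS s t => fun _ u U hu hU =>
    LP.eqS (goodV_termValue s u U hu hU) (goodV_termValue t u U hu hU)
  | _, _, _, .le s t => fun _ u U hu hU =>
    LP.le (goodV_termValue s u U hu hU) (goodV_termValue t u U hu hU)
  | _, _, _, .mem s t => fun _ u U hu hU =>
    LP.mem (goodV_termValue s u U hu hU) (goodV_termValue t u U hu hU)
  | _, _, _, .not φ => fun h u U hu hU => (goodP_formulaValue φ h u U hu hU).not
  | _, _, _, .and φ ψ => fun h u U hu hU =>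
    (goodP_formulaValue φ h u U hu hU).and (goodP_formulaValue ψ h u U hu hU)
  | _, _, _, .or φ ψ => fun h u U hu hU =>
    (goodP_formulaValue φ h u U hu hU).or (goodP_formulaValue ψ h u U hu hU)
  | _, _, _, .allN _ => fun h => nomatch h
  | _, _, _, .exN _ => fun h => nomatch h
  | _, _, _, .allS _ => fun h => nomatch h
  | _, _, _, .exS _ => fun h => nomatch h

end


/-! ### Conservativity and the comprehension rule for `VTC⁰` -/

theorem holds_expand (M : Struc L2A) [TV M] {q : Bool} {n m : ℕ} (φ : Formula L2A q n m)
    (x : Fin n → M.Dom .num) (X : Fin m → M.Dom .str) :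
    φ.ofBase.Holds M.expand x X ↔ φ.Holds M x X := by
  refine (holds_reduct M.expand φ x X).symm.trans (iff_of_eq ?_)
  have e : @Struc.fn _ M.expand.reduct = @Struc.fn _ M := by
    funext s k l f
    exact nomatch f
  exact congrArg (fun fn => φ.Holds (⟨M.Dom, M.nonemptyStr, M.zero, M.one, M.add, M.mul, M.len,
    M.le, M.mem, fn⟩ : Struc L2A) x X) e

theorem eval_expand (M : Struc L2A) [TV M] {s : Srt} {n m : ℕ} (t : Term L2A s n m)
    (x : Fin n → M.Dom .num) (X : Fin m → M.Dom .str) :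
    t.ofBase.eval M.expand x X = t.eval M x X := by
  refine (eval_reduct M.expand x X t).symm.trans ?_
  have e : @Struc.fn _ M.expand.reduct = @Struc.fn _ M := by
    funext s k l f
    exact nomatch f
  exact congrArg (fun fn => t.eval (⟨M.Dom, M.nonemptyStr, M.zero, M.one, M.add, M.mul, M.len,
    M.le, M.mem, fn⟩ : Struc L2A) x X) e

theorem TV.models_expand (M : Struc L2A) [hM : TV M] {n m : ℕ} {φ : Formula LFTC0 true n m}
    (h : VTC0bar n m φ) : M.expand.Models φ := by
  intro x X
  cases h with
  | basic h =>
    cases h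
    · exact hM.models _ _ _ (.basic .B1) x X
    · exact hM.models _ _ _ (.basic .B2) x X
    · exact hM.models _ _ _ (.basic .B3) x X
    · exact hM.models _ _ _ (.basic .B4) x X
    · exact hM.models _ _ _ (.basic .B5) x X
    · exact hM.models _ _ _ (.basic .B6) x X
    · exact hM.models _ _ _ (.basic .B7) x X
    · exact hM.models _ _ _ (.basic .B8) x X
    · exact hM.models _ _ _ (.basic .B9) x X
    · exact hM.models _ _ _ (.basic .B10) x X
    · exact hM.models _ _ _ (.basic .B11) x X
    · exact hM.models _ _ _ (.basic .L1) x X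
    · exact hM.models _ _ _ (.basic .L2) x X
  | B12' =>
    rcases interp_pd (M := M) (fun i => (![zero] i : Term LFTC0 .num 0 0).eval M.expand x X)
      (fun i => (![] i : Term LFTC0 .str 0 0).eval M.expand x X) with h | h
    · exact h.2
    · exact absurd h (V0.add_one_ne_zero _)
  | B12'' =>
    rw [holds_imp]
    intro h
    rcases interp_pd (M := M) (fun i => (![nvar 0] i : Term LFTC0 .num 1 0).eval M.expand x X)
      (fun i => (![] i : Term LFTC0 .str 1 0).eval M.expand x X) with h' | h'
    · exact absurd h'.1 h
    · exact h'
  | SE' =>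
    simp only [holds_imp, holds_iff, holds_and, holds_mem, holds_eqN, holds_eqS, eval_svar,
      eval_len]
    intro h
    rw [h]
    exact ⟨rfl, fun _ => Iff.rfl⟩
  | SE'' =>
    rw [holds_imp]
    rintro ⟨h, h'⟩
    refine V0.ext (M := M) _ _ h fun z hz => ?_
    exact not_not.1 (interp_fSE (M := M)
      (fun i => (![] i : Term LFTC0 .num 0 2).eval M.expand x X)
      (fun i => (![svar 0, svar 1] i : Term LFTC0 .str 0 2).eval M.expand x X) |>.2.2 z (lt_of_lt_of_eq hz (Eq.symm h')))
  | fSE1 => exact (interp_fSE (M := M)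
      (fun i => (![] i : Term LFTC0 .num 0 2).eval M.expand x X)
      (fun i => (![svar 0, svar 1] i : Term LFTC0 .str 0 2).eval M.expand x X)).1
  | fSE2 =>
    rw [holds_imp, holds_not, holds_iff]
    exact (interp_fSE (M := M)
      (fun i => (![] i : Term LFTC0 .num 0 2).eval M.expand x X)
      (fun i => (![svar 0, svar 1] i : Term LFTC0 .str 0 2).eval M.expand x X)).2.1
  | fSE3 =>
    rw [holds_imp, holds_iff]
    intro h
    exact not_not.1 ((interp_fSE (M := M)
      (fun i => (![] i : Term LFTC0 .num 1 2).eval M.expand x X)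
      (fun i => (![svar 0, svar 1] i : Term LFTC0 .str 1 2).eval M.expand x X)).2.2 _ h)
  | numones1 => exact cnt_zero (M := M) _
  | numones2 =>
    rw [holds_imp]
    exact fun h => cnt_add_one_of_mem (M := M) h
  | numones3 =>
    rw [holds_imp]
    exact fun h => cnt_add_one_of_notMem (M := M) h
  | defF α t =>
    obtain ⟨z, x, rfl⟩ : ∃ z x', x = Fin.cons z x' := ⟨_, _, (Fin.cons_self_tail x).symm⟩
    simp only [holds_iff, holds_mem, holds_and, holds_lt, holds_forget, eval_wkN, eval_nvar,
      Fin.cons_zero, eval_expand]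
    rw [← formulaValue_iff_holds]
    exact mem_interp_F t (goodP_formulaValue α rfl) x X z
  | deff1 α t =>
    refine le_of_le_of_eq (interp_f (M := M) t (goodP_formulaValue α rfl) x X).1 ?_
    exact (eval_expand M t x X).symm
  | deff2 α t =>
    have e : (fun i => Term.eval M.expand x X ((Fin.cons (fT α t) nvar : Fin _ → _) i))
        = Fin.cons (interp M (.f α t) x X) x := by
      funext i
      refine Fin.cases ?_ (fun i => ?_) i <;> rfl
    simp only [holds_imp, holds_subst, holds_forget, holds_lt, e, eval_expand]
    rw [← formulaValue_iff_holds]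
    exact (interp_f (M := M) t (goodP_formulaValue α rfl) x X).2.1
  | deff3 α t =>
    obtain ⟨z, x, rfl⟩ : ∃ z x', x = Fin.cons z x' := ⟨_, _, (Fin.cons_self_tail x).symm⟩
    simp only [holds_imp, holds_not, holds_forget, holds_lt, eval_wkN, eval_nvar, Fin.cons_zero]
    rw [← formulaValue_iff_holds]
    exact (interp_f (M := M) t (goodP_formulaValue α rfl) x X).2.2 z

/-- `VTC⁰` admits the `gΔ₁ᴮ` comprehension rule. -/
theorem VTC0.admitsGDelta1BComprehension : Theory.AdmitsGDelta1BComprehension VTC0 := by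
  intro n m b φ ψ hφ hψ h M hM x X
  have : TV M := ⟨hM⟩
  have key := VTC0bar.admitsGDelta1BComprehension n m b.ofBase φ.ofBase ψ.ofBase hφ.ofBase
    hψ.ofBase (fun N hN x X => by
      have : TB N := ⟨hN⟩
      have := (holds_reduct N _ x X).1 (h N.reduct (fun _ _ _ => TB.models_reduct) x X)
      rwa [ofBase_allLt] at this) M.expand (fun _ _ _ => TV.models_expand M) x X
  simp only [holds_exSLe, holds_allLt, holds_iff, holds_wkS, holds_mem, holds_expand,
    eval_expand, eval_wkS] at key ⊢
  exact key

end TwoSorted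

/-- `VTC⁰` and `VTC⁰-bar` admit the `gΔ₁ᴮ` comprehension rule, each over its own vocabulary. -/
theorem theoremt :
    TwoSorted.Theory.AdmitsGDelta1BComprehension TwoSorted.VTC0 ∧
      TwoSorted.Theory.AdmitsGDelta1BComprehension TwoSorted.VTC0bar :=
  ⟨TwoSorted.VTC0.admitsGDelta1BComprehension, TwoSorted.VTC0bar.admitsGDelta1BComprehension⟩
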